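/- Let $k$ be an algebraically closed field and let $\mathcal C$ be a $k$-linear, Hom-finite triangulated category with suspension $\Sigma$ which is 2-Calabi–Yau, i.e. there are $k$-linear isomorphisms $\operatorname{Hom}(X,Y)\cong D\operatorname{Hom}(Y,\Sigma^2X)$ natural in $X$ and $Y$, where $D=\operatorname{Hom}_k(-,k)$. Let $T\in\mathcal C$ be a cluster-tilting object, i.e. for all $X$ one has $X\in\operatorname{add}T$ if and only if $\operatorname{Hom}(T,\Sigma X)=0$, and suppose that $\Lambda=\operatorname{End}_{\mathcal C}(T)$ is a symmetric algebra. Let $\operatorname{mod}\Lambda$ be the category of finitely generated right $\Lambda$-modules, $\underline{\operatorname{mod}}\,\Lambda$ its stable category modulo projectives, $\tau_\Lambda=D\operatorname{Tr}$ the Auslander–Reiten translation and $\Omega$ the syzygy. The stable Auslander–Reiten quiver of $\Lambda$ has as vertices the isomorphism classes of indecomposable nonprojective modules, with $\dim_k \operatorname{rad}(M,N)/\operatorname{rad}^2(M,N)$ arrows from $M$ to $N$, and translation $\tau_\Lambda$. A stable tube of rank $r\ge 1$ is the translation quiver $\mathbb ZA_\infty/\langle\tau^r\rangle$. 1. Every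 connected component of the stable Auslander–Reiten quiver of $\Lambda$ that belongs to a block of $\Lambda$ of infinite representation type is a stable tube of rank $1$ or $2$. In particular, if no block of $\Lambda$ is representation-finite, then the stable Auslander–Reiten quiver of $\Lambda$ consists only of stable tubes of rank $1$ or $2$. 2. Without any assumption on the representation type, $\tau_\Lambda^2M\cong M$ and $\Omega^4M\cong M$ in $\underline{\operatorname{mod}}\,\Lambda$ for every finitely generated $\Lambda$-module $M$. -/

import Mathlib

open CategoryTheory CategoryTheory.Limits

universe w v u

/-! ### Triangulated categories: 2-Calabi-Yau duality and cluster-tilting objects -/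

/-- A `k`-linear category is Hom-finite if all its morphism spaces are finite dimensional. -/
def IsHomFinite (k : Type w) [Field k] (C : Type u) [Category.{v} C] [Preadditive C]
    [Linear k C] : Prop :=
  ∀ X Y : C, FiniteDimensional k (X ⟶ Y)

/-- The square `Σ²` of the suspension is a Serre functor: there are `k`-linear isomorphisms
`Hom(X, Y) ≅ D Hom(Y, Σ² X)` which are natural in `X` and in `Y`. -/
def IsTwoCalabiYau (k : Type w) [Field k] (C : Type u) [Category.{v} C] [Preadditive C]
    [Linear k C] [HasShift C ℤ] : Prop :=
  ∃ e : ∀ X Y : C, (X ⟶ Y) ≃ₗ[k] Module.Dual k (Y ⟶ X⟦(2 : ℤ)⟧),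
    ∀ (X X' Y Y' : C) (a : X' ⟶ X) (f : X ⟶ Y) (b : Y ⟶ Y') (g : Y' ⟶ X'⟦(2 : ℤ)⟧),
      e X' Y' (a ≫ f ≫ b) g = e X Y f (b ≫ g ≫ a⟦(2 : ℤ)⟧')

/-- `X` belongs to `add T`: it is a direct summand of a finite direct sum of copies of `T`. -/
def InAdd {C : Type u} [Category.{v} C] [Preadditive C] [HasFiniteBiproducts C]
    (T X : C) : Prop :=
  ∃ n : ℕ, Nonempty (Retract X (⨁ fun _ : Fin n => T))

/-- `T` is cluster-tilting: `add T` consists exactly of the objects `X` with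
`Hom(T, Σ X) = 0`. -/
def IsClusterTilting {C : Type u} [Category.{v} C] [Preadditive C] [HasFiniteBiproducts C]
    [HasShift C ℤ] (T : C) : Prop :=
  ∀ X : C, InAdd T X ↔ ∀ f : T ⟶ X⟦(1 : ℤ)⟧, f = 0

/-! ### Symmetric algebras -/

/-- A finite dimensional `k`-algebra is symmetric if it carries a linear form `t` such that
`(a, b) ↦ t (a * b)` is a symmetric nondegenerate bilinear form. -/
def IsSymmetricFDAlgebra (k : Type w) [Field k] (A : Type v) [Ring A] [Algebra k A] : Prop :=
  FiniteDimensional k A ∧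
    ∃ t : A →ₗ[k] k, (∀ a b, t (a * b) = t (b * a)) ∧ ∀ a, (∀ b, t (a * b) = 0) → a = 0

/-! ### The radical of a linear category and irreducible morphisms -/

section Radical

variable (k : Type w) [Field k] {D : Type u} [Category.{v} D] [Preadditive D] [Linear k D]

/-- The radical `rad(X, Y)`: the `f : X ⟶ Y` such that `1 - g f` is invertible for all
`g : Y ⟶ X`. -/
def radHom (X Y : D) : Submodule k (X ⟶ Y) where
  carrier := {f | ∀ g : Y ⟶ X, IsIso (𝟙 X - f ≫ g)}
  zero_mem' := fun g => by
    simp only [zero_comp, sub_zero]; infer_instance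
  add_mem' := by
    intro f f' hf hf' g
    have h1 : IsIso (𝟙 X - f ≫ g) := hf g
    have h2 : IsIso (𝟙 X - f' ≫ (g ≫ inv (𝟙 X - f ≫ g))) := hf' _
    have h3 : 𝟙 X - (f + f') ≫ g
        = (𝟙 X - f' ≫ (g ≫ inv (𝟙 X - f ≫ g))) ≫ (𝟙 X - f ≫ g) := by
      rw [Preadditive.sub_comp (𝟙 X)]
      simp only [Category.assoc, IsIso.inv_hom_id, Category.comp_id, Category.id_comp,
        Preadditive.add_comp]
      abel
    rw [h3]; infer_instance
  smul_mem' := by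
    intro c f hf g
    have h := hf (c • g)
    rwa [Linear.comp_smul, ← Linear.smul_comp] at h

/-- The square `rad²(X, Y)` of the radical: sums of composites of two radical morphisms. -/
def radSqHom (X Y : D) : Submodule k (X ⟶ Y) :=
  Submodule.span k {h | ∃ (Z : D) (f : X ⟶ Z) (g : Z ⟶ Y),
    f ∈ radHom k X Z ∧ g ∈ radHom k Z Y ∧ h = f ≫ g}

/-- The dimension of the space of irreducible morphisms `rad(X, Y) / rad²(X, Y)`. -/
noncomputable def irrDim (X Y : D) : ℕ :=
  Module.finrank k (radHom k X Y ⧸ (radSqHom k X Y).submoduleOf (radHom k X Y))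

end Radical

/-! ### Stable isomorphism, syzygies and the Auslander-Reiten translation -/

section Modules

variable (k : Type w) [Field k] {A : Type v} [Ring A] [Algebra k A]

/-- A morphism of `mod A` factors through a finitely generated projective module. -/
def FactorsThroughProjective {M N : FGModuleCat.{v} A} (f : M ⟶ N) : Prop :=
  ∃ (P : FGModuleCat.{v} A) (a : M ⟶ P) (b : P ⟶ N), Module.Projective A P ∧ f = a ≫ b

/-- `M` and `N` are isomorphic in the stable category of `mod A`, whose morphisms are the
module homomorphisms modulo those that factor through a projective module. -/
def StablyIso (M N : FGModuleCat.{v} A) : Prop :=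
  ∃ (f : M ⟶ N) (g : N ⟶ M),
    FactorsThroughProjective (f ≫ g - 𝟙 M) ∧ FactorsThroughProjective (g ≫ f - 𝟙 N)

/-- `N` is a syzygy `Ω M` of `M`: there is an exact sequence `0 → N → P → M → 0` with `P`
finitely generated projective. -/
def IsSyzygy (M N : FGModuleCat.{v} A) : Prop :=
  ∃ (P : FGModuleCat.{v} A) (i : N →ₗ[A] P) (p : P →ₗ[A] M),
    Module.Projective A P ∧ Function.Injective i ∧ Function.Exact i p ∧ Function.Surjective p

/-- For an `A`-linear map `f : P₁ → P₀`, the map `Hom(P₀, A) → Hom(P₁, A)` of right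
`A`-modules. -/
def starMap {P₁ P₀ : Type v} [AddCommGroup P₁] [Module A P₁] [AddCommGroup P₀] [Module A P₀]
    (f : P₁ →ₗ[A] P₀) : (P₀ →ₗ[A] A) →ₗ[Aᵐᵒᵖ] (P₁ →ₗ[A] A) where
  toFun φ := φ.comp f
  map_add' _ _ := rfl
  map_smul' _ _ := rfl

/-- The transpose: the cokernel of `Hom(P₀, A) → Hom(P₁, A)`, a right `A`-module. -/
abbrev Transpose {P₁ P₀ : Type v} [AddCommGroup P₁] [Module A P₁] [AddCommGroup P₀]
    [Module A P₀] (f : P₁ →ₗ[A] P₀) : Type v :=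
  (P₁ →ₗ[A] A) ⧸ LinearMap.range (starMap f)

/-- The `k`-dual `D X = Hom_k(X, k)` of a right `A`-module `X`, with the left action
`(a φ)(x) = φ(x a)`. -/
def KDual (k : Type w) [Field k] (_A : Type v) (X : Type v) [AddCommGroup X] [Module k X] :
    Type (max v w) :=
  Module.Dual k X

instance (X : Type v) [AddCommGroup X] [Module k X] : AddCommGroup (KDual k A X) :=
  inferInstanceAs (AddCommGroup (Module.Dual k X))

instance (X : Type v) [AddCommGroup X] [Module k X] [Module Aᵐᵒᵖ X]
    [IsScalarTower k Aᵐᵒᵖ X] : Module A (KDual k A X) where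
  smul a φ := LinearMap.comp (φ : X →ₗ[k] k) (Module.toModuleEnd k X (MulOpposite.op a))
  one_smul φ := LinearMap.ext fun x => congrArg (DFunLike.coe (F := X →ₗ[k] k) φ)
    (one_smul Aᵐᵒᵖ x)
  mul_smul a b φ := LinearMap.ext fun x => congrArg (DFunLike.coe (F := X →ₗ[k] k) φ)
    (mul_smul (MulOpposite.op b) (MulOpposite.op a) x)
  smul_zero _ := rfl
  smul_add _ _ _ := rfl
  add_smul a b φ := LinearMap.ext fun x =>
    (congrArg (DFunLike.coe (F := X →ₗ[k] k) φ)
      (add_smul (MulOpposite.op a) (MulOpposite.op b) x)).trans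
      (LinearMap.map_add (σ := RingHom.id k) φ _ _)
  zero_smul φ := LinearMap.ext fun x =>
    (congrArg (DFunLike.coe (F := X →ₗ[k] k) φ) (zero_smul Aᵐᵒᵖ x)).trans
      (LinearMap.map_zero (σ := RingHom.id k) φ)

/-- `P₁ → P₀ → M → 0` is a minimal projective presentation: it is exact, and both `P₀ → M` and
`P₁ → im(P₁ → P₀)` are projective covers, that is, their kernels are superfluous. -/
structure IsMinimalPresentation {M P₁ P₀ : FGModuleCat.{v} A} (f : P₁ →ₗ[A] P₀)
    (g : P₀ →ₗ[A] M) : Prop where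
  projective₁ : Module.Projective A P₁
  projective₀ : Module.Projective A P₀
  exact : Function.Exact f g
  surjective : Function.Surjective g
  superfluous₀ : ∀ K : Submodule A P₀, K ⊔ LinearMap.ker g = ⊤ → K = ⊤
  superfluous₁ : ∀ K : Submodule A P₁, K ⊔ LinearMap.ker f = ⊤ → K = ⊤

/-- `N` is isomorphic to the Auslander-Reiten translate `τ M = D Tr M`, where `Tr M` is computed
from a minimal projective presentation of `M`. -/
def IsARTranslate (M N : FGModuleCat.{v} A) : Prop :=
  ∃ (P₁ P₀ : FGModuleCat.{v} A) (f : P₁ →ₗ[A] P₀) (g : P₀ →ₗ[A] M),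
    IsMinimalPresentation f g ∧ Nonempty (N ≃ₗ[A] KDual k A (Transpose f))

/-! ### The stable Auslander-Reiten quiver of a self-injective algebra

The stable Auslander-Reiten quiver is considered here for self-injective algebras only, where
the vertices that remain after removing the `τ`-orbits of projective and injective modules are the
isomorphism classes of indecomposable nonprojective modules.
-/

/-- A representative of an isomorphism class of finitely generated modules. -/
noncomputable abbrev isoClassRep (x : Skeleton (FGModuleCat.{v} A)) : FGModuleCat.{v} A :=
  (fromSkeleton (FGModuleCat.{v} A)).obj x

variable (A) in
/-- Vertices: isomorphism classes of finitely generated indecomposable nonprojective modules. -/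
def StableVertex : Type (v + 1) :=
  {x : Skeleton (FGModuleCat.{v} A) //
    Indecomposable (isoClassRep x).obj ∧ ¬ Module.Projective A (isoClassRep x)}

/-- The number of arrows from `x` to `y` in the stable Auslander-Reiten quiver (over an
algebraically closed field). -/
noncomputable def arrowCount (x y : StableVertex A) : ℕ :=
  irrDim k (isoClassRep x.1) (isoClassRep y.1)

/-- The translation of the stable Auslander-Reiten quiver: `y = τ x`. -/
def IsTranslate (x y : StableVertex A) : Prop :=
  IsARTranslate k (isoClassRep x.1) (isoClassRep y.1)

/-- The connected component of `x` in the stable Auslander-Reiten quiver. -/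
def stableComponent (x : StableVertex A) : Set (StableVertex A) :=
  {y | Relation.EqvGen (fun a b => arrowCount k a b ≠ 0) x y}

/-- The number of arrows from `p` to `q` in `ℤA_∞ / ⟨τ^r⟩`. The vertices of `ℤA_∞` are the pairs
`(i, j)` with `i ∈ ℤ` and `j ∈ ℕ`, its arrows are `(i, j) → (i, j + 1)` and
`(i, j + 1) → (i + 1, j)`, and `τ (i, j) = (i - 1, j)`. -/
def tubeArrows (r : ℕ) (p q : ZMod r × ℕ) : ℕ :=
  (if q.1 = p.1 ∧ q.2 = p.2 + 1 then 1 else 0) + (if q.1 = p.1 + 1 ∧ p.2 = q.2 + 1 then 1 else 0)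

/-- A full subquiver of the stable Auslander-Reiten quiver is a stable tube of rank `r`: it is
isomorphic, as a translation quiver, to `ℤA_∞ / ⟨τ^r⟩`. -/
def IsStableTube (r : ℕ) (S : Set (StableVertex A)) : Prop :=
  ∃ e : ZMod r × ℕ ≃ S,
    (∀ p q, arrowCount k (e p).1 (e q).1 = tubeArrows r p q) ∧
    ∀ p, IsTranslate k (e p).1 (e (p.1 - 1, p.2)).1

/-- The indecomposable module `M` belongs to a block of `A` of infinite representation type. For
every central idempotent `c` with `c M = M`, that is, for every product `c A` of blocks one of which
is the block of `M`, there are infinitely many isomorphism classes of finitely generated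
indecomposable modules `N` with `c N = N`. -/
def BlockIsRepInfinite (M : FGModuleCat.{v} A) : Prop :=
  ∀ c : A, c ∈ Subring.center A → IsIdempotentElem c → (∀ m : M, c • m = m) →
    {x : Skeleton (FGModuleCat.{v} A) |
      Indecomposable (isoClassRep x).obj ∧ ∀ n : isoClassRep x, c • n = n}.Infinite

end Modules

section Indec

/-- A module is indecomposable if it is nonzero and has no idempotent endomorphisms other than
`0` and `1`. -/
def IsIndec (A : Type*) [Ring A] (M : Type*) [AddCommGroup M] [Module A M] : Prop :=
  Nontrivial M ∧ ∀ e : Module.End A M, e * e = e → e = 0 ∨ e = 1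

variable {A : Type*} [Ring A] {M N : Type*} [AddCommGroup M] [Module A M] [AddCommGroup N]
  [Module A N]

theorem IsIndec.of_equiv (h : IsIndec A M) (e : M ≃ₗ[A] N) : IsIndec A N := by
  have := h.1
  refine ⟨e.symm.toEquiv.nontrivial, fun f hf => ?_⟩
  have h1 := h.2 (e.symm.toLinearMap ∘ₗ f ∘ₗ e.toLinearMap) (by
    ext x
    have := LinearMap.congr_fun hf (e x)
    simpa using this)
  refine h1.imp (fun h0 => ?_) (fun h0 => ?_)
  · ext x
    have := LinearMap.congr_fun h0 (e.symm x)
    simpa using this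
  · ext x
    have := LinearMap.congr_fun h0 (e.symm x)
    simpa using this

/-- Two complementary submodules of an indecomposable module are trivial. -/
theorem IsIndec.eq_bot_or_eq_bot (h : IsIndec A M) {p q : Submodule A M} (hpq : IsCompl p q) :
    p = ⊥ ∨ q = ⊥ := by
  have hid : (p.projection q hpq : Module.End A M) * p.projection q hpq = p.projection q hpq := by
    ext x
    simp
  rcases h.2 _ hid with h0 | h1
  · left
    rw [eq_bot_iff]
    intro x hx
    have := LinearMap.congr_fun h0 x
    rw [Submodule.projection_apply_of_mem_left hpq hx] at this
    simpa using this
  · right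
    rw [eq_bot_iff]
    intro x hx
    have := LinearMap.congr_fun h1 x
    rw [Submodule.projection_apply_of_mem_right hpq hx] at this
    simpa using this.symm

/-- Fitting's lemma for indecomposable modules. -/
theorem IsIndec.isUnit_or_isNilpotent [IsArtinian A M] [IsNoetherian A M] (h : IsIndec A M)
    (f : Module.End A M) : IsUnit f ∨ IsNilpotent f := by
  obtain ⟨n, hn⟩ := (f.eventually_isCompl_ker_pow_range_pow.and
    (Filter.eventually_ge_atTop 1)).exists
  rcases h.eq_bot_or_eq_bot hn.1 with h0 | h0
  · left
    have h1 : Function.Injective f := by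
      intro x y hxy
      apply LinearMap.ker_eq_bot.1 h0
      obtain ⟨m, rfl⟩ := Nat.exists_eq_add_of_le' hn.2
      simp [pow_succ, hxy]
    exact (Module.End.isUnit_iff f).2 (IsArtinian.bijective_of_injective_endomorphism f h1)
  · exact Or.inr ⟨n, LinearMap.range_eq_bot.1 h0⟩

theorem IsIndec.isUnit_or_isUnit_of_add [IsArtinian A M] [IsNoetherian A M] (h : IsIndec A M)
    {f g : Module.End A M} (hfg : IsUnit (f + g)) : IsUnit f ∨ IsUnit g := by
  obtain ⟨u, hu⟩ := hfg
  have key : f * ↑u⁻¹ + g * ↑u⁻¹ = 1 := by rw [← add_mul, ← hu, Units.mul_inv]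
  rcases h.isUnit_or_isNilpotent (f * ↑u⁻¹) with h1 | h1
  · left
    exact (Units.isUnit_mul_units f u⁻¹).1 h1
  · right
    have : g * ↑u⁻¹ = 1 - f * ↑u⁻¹ := by rw [← key]; abel
    rw [← Units.isUnit_mul_units g u⁻¹, this]
    exact h1.isUnit_one_sub

/-- A split monomorphism from a nonzero module to an indecomposable module is bijective. -/
theorem IsIndec.bijective_of_isUnit_comp [Nontrivial M] (hN : IsIndec A N) (f : M →ₗ[A] N)
    (g : N →ₗ[A] M) (hgf : IsUnit (g ∘ₗ f : Module.End A M)) :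
    Function.Bijective f ∧ Function.Bijective g := by
  obtain ⟨u, hu⟩ := hgf
  have hu1 : ∀ x, (↑u⁻¹ : Module.End A M) (g (f x)) = x := fun x => by
    have := LinearMap.congr_fun (Units.inv_mul u) x
    rw [hu] at this
    exact this
  have hu2 : ∀ x, g (f ((↑u⁻¹ : Module.End A M) x)) = x := fun x => by
    have := LinearMap.congr_fun (Units.mul_inv u) x
    rw [hu] at this
    exact this
  have hid : (f ∘ₗ (↑u⁻¹ : Module.End A M) ∘ₗ g : Module.End A N) *
      (f ∘ₗ (↑u⁻¹ : Module.End A M) ∘ₗ g) = f ∘ₗ (↑u⁻¹ : Module.End A M) ∘ₗ g := by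
    ext x
    simp [hu1]
  have hfi : Function.Injective f := fun x y hxy => by rw [← hu1 x, hxy, hu1]
  have hgs : Function.Surjective g := fun x => ⟨_, hu2 x⟩
  rcases hN.2 _ hid with h0 | h1
  · exfalso
    obtain ⟨x, hx⟩ := exists_ne (0 : M)
    have := LinearMap.congr_fun h0 (f x)
    simp only [LinearMap.comp_apply, hu1, LinearMap.zero_apply] at this
    exact hx (hfi (by simpa using this))
  · have h3 : ∀ y, f ((↑u⁻¹ : Module.End A M) (g y)) = y := fun y => LinearMap.congr_fun h1 y
    refine ⟨⟨hfi, fun y => ⟨_, h3 y⟩⟩, ⟨fun x y hxy => ?_, hgs⟩⟩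
    rw [← h3 x, hxy, h3]

end Indec

section Decomposition

variable {A : Type v} [Ring A]

/-- Finite decomposition into indecomposable modules. -/
theorem exists_decomposition [IsNoetherianRing A] (M : Type v) [AddCommGroup M] [Module A M]
    [IsArtinian A M] [Module.Finite A M] :
    ∃ (ι : Type) (_ : Fintype ι) (Y : ι → FGModuleCat.{v} A), (∀ i, IsIndec A (Y i)) ∧
      Nonempty (M ≃ₗ[A] ∀ i, Y i) := by
  suffices H : ∀ p : Submodule A M, ∃ (ι : Type) (_ : Fintype ι) (Y : ι → FGModuleCat.{v} A),
      (∀ i, IsIndec A (Y i)) ∧ Nonempty (p ≃ₗ[A] ∀ i, Y i) by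
    obtain ⟨ι, hι, Y, hY, ⟨e⟩⟩ := H ⊤
    exact ⟨ι, hι, Y, hY, ⟨Submodule.topEquiv.symm.trans e⟩⟩
  intro p
  induction p using IsArtinian.induction (R := A) (M := M) with
  | hgt p ih =>
  by_cases hp : Nontrivial p
  swap
  · rw [not_nontrivial_iff_subsingleton] at hp
    exact ⟨Empty, inferInstance, Empty.elim, fun i => i.elim,
      ⟨LinearEquiv.ofSubsingleton p (∀ i : Empty, (Empty.elim i : FGModuleCat A))⟩⟩
  by_cases hi : IsIndec A p
  · exact ⟨Unit, inferInstance, fun _ => FGModuleCat.of A p, fun _ => hi,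
      ⟨(LinearEquiv.funUnique Unit A p).symm⟩⟩
  simp only [IsIndec, hp, true_and, not_forall, not_or] at hi
  obtain ⟨e, he, h0, h1⟩ := hi
  have hc : IsCompl (LinearMap.ker e) (LinearMap.range e) := by
    refine ⟨?_, ?_⟩
    · rw [Submodule.disjoint_def]
      rintro x hx ⟨y, rfl⟩
      rw [LinearMap.mem_ker] at hx
      rw [← LinearMap.congr_fun he y]
      exact hx
    · rw [codisjoint_iff, eq_top_iff]
      rintro x -
      refine Submodule.mem_sup.2 ⟨x - e x, ?_, e x, ⟨x, rfl⟩, by abel⟩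
      have := LinearMap.congr_fun he x
      simp only [Module.End.mul_apply] at this
      simp [this]
  have hlt : ∀ q : Submodule A p, q ≠ ⊤ → q.map p.subtype < p := fun q hq => by
    refine lt_of_le_of_ne (Submodule.map_subtype_le p q) fun h => hq ?_
    rw [eq_top_iff]
    rintro ⟨x, hx⟩ -
    rw [← h] at hx
    obtain ⟨y, hy, rfl⟩ := hx
    exact hy
  have hk : LinearMap.ker e ≠ ⊤ := fun h => h0 (LinearMap.ker_eq_top.1 h)
  have hr : LinearMap.range e ≠ ⊤ := fun h => h1 <| by
    ext x
    obtain ⟨y, rfl⟩ := LinearMap.range_eq_top.1 h x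
    simpa using congrArg Subtype.val (LinearMap.congr_fun he y)
  obtain ⟨ι₁, hι₁, Y₁, hY₁, ⟨e₁⟩⟩ := ih _ (hlt _ hk)
  obtain ⟨ι₂, hι₂, Y₂, hY₂, ⟨e₂⟩⟩ := ih _ (hlt _ hr)
  refine ⟨ι₁ ⊕ ι₂, inferInstance, Sum.elim Y₁ Y₂, by rintro (i | i); exacts [hY₁ i, hY₂ i], ⟨?_⟩⟩
  let E₁ : LinearMap.ker e ≃ₗ[A] ∀ i, Y₁ i :=
    (Submodule.equivMapOfInjective p.subtype p.injective_subtype _).trans e₁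
  let E₂ : LinearMap.range e ≃ₗ[A] ∀ i, Y₂ i :=
    (Submodule.equivMapOfInjective p.subtype p.injective_subtype _).trans e₂
  exact ((Submodule.prodEquivOfIsCompl _ _ hc).symm.trans (LinearEquiv.prodCongr E₁ E₂)).trans
    (LinearEquiv.sumPiEquivProdPi A ι₁ ι₂ fun i => (Sum.elim Y₁ Y₂ i : FGModuleCat A)).symm

/-- The inclusions and projections of a decomposition into indecomposable modules. -/
theorem exists_decomposition_maps [IsNoetherianRing A] (M : Type v) [AddCommGroup M] [Module A M]
    [IsArtinian A M] [Module.Finite A M] :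
    ∃ (ι : Type) (_ : Fintype ι) (Y : ι → FGModuleCat.{v} A) (_ : M ≃ₗ[A] ∀ i, Y i)
      (a : ∀ i, Y i →ₗ[A] M) (b : ∀ i, M →ₗ[A] Y i), (∀ i, IsIndec A (Y i)) ∧
      (∀ i, b i ∘ₗ a i = LinearMap.id) ∧ (∀ i j, i ≠ j → b j ∘ₗ a i = 0) ∧
      ∑ i, a i ∘ₗ b i = LinearMap.id := by
  classical
  obtain ⟨ι, _, Y, hY, ⟨e⟩⟩ := exists_decomposition (A := A) M
  refine ⟨ι, inferInstance, Y, e,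
    fun i => e.symm.toLinearMap ∘ₗ LinearMap.single A (fun i => (Y i : Type v)) i,
    fun i => LinearMap.proj i ∘ₗ e.toLinearMap, hY, fun i => ?_, fun i j hij => ?_, ?_⟩
  · ext x
    simp
  · ext x
    simp [hij.symm]
  · ext x
    apply e.injective
    rw [LinearMap.sum_apply, map_sum]
    conv_rhs => rw [LinearMap.id_apply, ← Finset.univ_sum_single (e x)]
    refine Finset.sum_congr rfl fun i _ => ?_
    simp

end Decomposition

section ProjectiveCover

variable {A : Type v} [Ring A] [IsArtinianRing A]

theorem exists_projectiveCover (M : Type v) [AddCommGroup M] [Module A M] [Module.Finite A M] :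
    ∃ (P : FGModuleCat.{v} A) (p : P →ₗ[A] M), Module.Projective A P ∧ Function.Surjective p ∧
      ∀ K : Submodule A P, K ⊔ LinearMap.ker p = ⊤ → K = ⊤ := by
  obtain ⟨n, q, hq⟩ := Module.Finite.exists_fin' A M
  obtain ⟨P, ⟨hP, hPs⟩, hmin⟩ := IsArtinian.set_has_minimal (R := A) (M := Fin n → A)
    {K | Module.Projective A K ∧ Function.Surjective (q ∘ₗ K.subtype)}
    ⟨⊤, Module.Projective.of_equiv (Submodule.topEquiv (R := A) (M := Fin n → A)).symm, fun m => by
      obtain ⟨x, rfl⟩ := hq m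
      exact ⟨⟨x, trivial⟩, rfl⟩⟩
  refine ⟨FGModuleCat.of A P, q ∘ₗ P.subtype, hP, hPs, fun K hK => ?_⟩
  change Submodule A P at K
  have hKs : Function.Surjective ((q ∘ₗ P.subtype) ∘ₗ K.subtype) := fun m => by
    obtain ⟨x, rfl⟩ := hPs m
    obtain ⟨y, hy, z, hz, rfl⟩ := Submodule.mem_sup.1 (hK ▸ Submodule.mem_top : x ∈ K ⊔ _)
    refine ⟨⟨y, hy⟩, ?_⟩
    rw [map_add, LinearMap.mem_ker.1 hz, add_zero]
    rfl
  obtain ⟨φ, hφ⟩ := Module.projective_lifting_property _ (q ∘ₗ P.subtype) hKs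
  let f : Module.End A P := K.subtype ∘ₗ φ
  have hf : (q ∘ₗ P.subtype) ∘ₗ f = q ∘ₗ P.subtype := by rw [← LinearMap.comp_assoc]; exact hφ
  have hfn : ∀ n x, q (P.subtype ((f ^ n) x)) = q (P.subtype x) := fun n => by
    induction n with
    | zero => intro x; rfl
    | succ n ih =>
      intro x
      rw [pow_succ, Module.End.mul_apply, ih]
      exact LinearMap.congr_fun hf x
  obtain ⟨m, hm, hm1⟩ := (f.eventually_isCompl_ker_pow_range_pow.and
    (Filter.eventually_ge_atTop 1)).exists
  have hproj : Module.Projective A (LinearMap.range (f ^ m)) :=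
    Module.Projective.of_split (LinearMap.range (f ^ m)).subtype
      (Submodule.projectionOnto _ _ hm.symm) (LinearMap.ext fun x =>
        Submodule.projectionOnto_apply_left hm.symm x)
  have hle : (LinearMap.range (f ^ m)).map P.subtype ≤ P := Submodule.map_subtype_le _ _
  have heq := eq_of_le_of_not_lt hle (hmin _ ⟨Module.Projective.of_equiv
    (Submodule.equivMapOfInjective _ P.injective_subtype (LinearMap.range (f ^ m))), fun x => by
      obtain ⟨y, rfl⟩ := hPs x
      exact ⟨⟨_, ⟨_, ⟨y, rfl⟩, rfl⟩⟩, hfn m y⟩⟩)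
  rw [eq_top_iff]
  rintro ⟨x, hx⟩ -
  rw [← heq] at hx
  obtain ⟨_, ⟨y, rfl⟩, hyx⟩ := hx
  have : (⟨x, heq ▸ hx⟩ : P) = (f ^ m) y := Subtype.ext hyx.symm
  obtain ⟨l, rfl⟩ := Nat.exists_eq_add_of_le' hm1
  have h3 : (f ^ (l + 1)) y ∈ K := by
    rw [pow_succ']
    exact (φ ((f ^ l) y)).2
  convert h3

end ProjectiveCover

section LinearAlgebra

variable {k : Type*} [Field k] {V W : Type*} [AddCommGroup V] [Module k V] [AddCommGroup W]
  [Module k W]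

/-- A linear form that vanishes on the left kernel of a bilinear pairing is represented by it. -/
theorem exists_eq_pairing [FiniteDimensional k V] (B : V →ₗ[k] W →ₗ[k] k) (φ : V →ₗ[k] k)
    (h : ∀ v, (∀ w, B v w = 0) → φ v = 0) : ∃ w, ∀ v, φ v = B v w := by
  have h1 : φ ∈ (LinearMap.range B.flip).dualCoannihilator.dualAnnihilator := by
    rw [Submodule.mem_dualAnnihilator]
    intro v hv
    apply h
    intro w
    rw [Submodule.mem_dualCoannihilator] at hv
    exact hv _ ⟨w, rfl⟩
  rw [Subspace.dualCoannihilator_dualAnnihilator_eq] at h1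
  obtain ⟨w, hw⟩ := h1
  exact ⟨w, fun v => by rw [← hw]; rfl⟩

end LinearAlgebra

section HomSpaces

variable (k : Type*) [Field k] (A : Type*) [Ring A] [Algebra k A]

theorem finiteDimensional_of_finite [FiniteDimensional k A] (M : Type*) [AddCommGroup M]
    [Module A M] [Module k M] [IsScalarTower k A M] [Module.Finite A M] :
    FiniteDimensional k M :=
  Module.Finite.trans A M

theorem finiteDimensional_linearMap (M N : Type*) [AddCommGroup M]
    [Module A M] [Module k M] [IsScalarTower k A M] [FiniteDimensional k M] [AddCommGroup N]
    [Module A N] [Module k N] [IsScalarTower k A N] [FiniteDimensional k N] :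
    FiniteDimensional k (M →ₗ[A] N) :=
  Module.Finite.of_injective (LinearMap.restrictScalarsₗ k A M N k)
    (LinearMap.restrictScalars_injective k)

variable {A} in
/-- Composition `Hom(M, N) × Hom(N, L) → Hom(M, L)` as a `k`-bilinear map. -/
def homComp (M N L : Type*) [AddCommGroup M] [Module A M]
    [AddCommGroup N] [Module A N] [Module k N] [IsScalarTower k A N]
    [AddCommGroup L] [Module A L] [Module k L] [IsScalarTower k A L] :
    (M →ₗ[A] N) →ₗ[k] (N →ₗ[A] L) →ₗ[k] (M →ₗ[A] L) :=
  LinearMap.mk₂ k (fun f g => g ∘ₗ f) (fun f f' g => LinearMap.comp_add _ _ _)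
    (fun c f g => by ext x; exact g.map_smul_of_tower c (f x))
    (fun f g g' => LinearMap.add_comp _ _ _) (fun c f g => rfl)

end HomSpaces

section Factorization

variable {A : Type*} [Ring A] {M N L : Type*} [AddCommGroup M] [Module A M] [AddCommGroup N]
  [Module A N] [AddCommGroup L] [Module A L]

theorem exists_comp_eq_of_injective (i : N →ₗ[A] L) (hi : Function.Injective i) (h : M →ₗ[A] L)
    (hr : ∀ y, ∃ z, i z = h y) : ∃ g : M →ₗ[A] N, i ∘ₗ g = h :=
  ⟨(LinearEquiv.ofInjective i hi).symm.toLinearMap ∘ₗ h.codRestrict (LinearMap.range i) hr, by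
    ext y
    exact congrArg Subtype.val
      ((LinearEquiv.ofInjective i hi).apply_symm_apply ⟨h y, hr y⟩)⟩

theorem exists_comp_eq_of_surjective (p : M →ₗ[A] N) (hp : Function.Surjective p) (h : M →ₗ[A] L)
    (hk : ∀ x, p x = 0 → h x = 0) : ∃ g : N →ₗ[A] L, g ∘ₗ p = h :=
  ⟨(LinearMap.ker p).liftQ h hk ∘ₗ (p.quotKerEquivOfSurjective hp).symm.toLinearMap, by
    ext x
    have : (p.quotKerEquivOfSurjective hp).symm (p x) = Submodule.Quotient.mk x := by
      rw [LinearEquiv.symm_apply_eq]; rfl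
    rw [LinearMap.comp_apply, LinearMap.comp_apply, LinearEquiv.coe_coe, this]
    rfl⟩

end Factorization

section DualBasis

theorem exists_dualBasis (A : Type*) [Ring A] (P : Type*) [AddCommGroup P] [Module A P]
    [Module.Finite A P] [Module.Projective A P] :
    ∃ (n : ℕ) (x : Fin n → P) (α : Fin n → P →ₗ[A] A), ∀ y, ∑ i, α i y • x i = y := by
  obtain ⟨n, f, hf⟩ := Module.Finite.exists_fin' A P
  obtain ⟨g, hg⟩ := Module.projective_lifting_property f LinearMap.id hf
  refine ⟨n, fun i => f (Pi.single i 1), fun i => LinearMap.proj i ∘ₗ g, fun y => ?_⟩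
  conv_rhs => rw [← LinearMap.id_apply (R := A) y, ← hg, LinearMap.comp_apply,
    ← Finset.univ_sum_single (g y), map_sum]
  refine Finset.sum_congr rfl fun i _ => ?_
  rw [← map_smul]
  congr 1
  ext j
  by_cases h : i = j
  · subst h; simp
  · simp [Ne.symm h]

end DualBasis

section FactorsProj

variable {A : Type*} [Ring A] {M N L : Type*} [AddCommGroup M] [Module A M] [AddCommGroup N]
  [Module A N] [AddCommGroup L] [Module A L]

/-- A linear map factors through a finitely generated free module. -/
def FactorsProj (f : M →ₗ[A] N) : Prop :=
  ∃ (n : ℕ) (a : M →ₗ[A] (Fin n → A)) (b : (Fin n → A) →ₗ[A] N), f = b ∘ₗ a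

theorem FactorsProj.of_comp {P : Type*} [AddCommGroup P] [Module A P] [Module.Finite A P]
    [Module.Projective A P] (a : M →ₗ[A] P) (b : P →ₗ[A] N) : FactorsProj (b ∘ₗ a) := by
  obtain ⟨n, f, hf⟩ := Module.Finite.exists_fin' A P
  obtain ⟨g, hg⟩ := Module.projective_lifting_property f LinearMap.id hf
  exact ⟨n, g ∘ₗ a, b ∘ₗ f, by rw [LinearMap.comp_assoc, ← LinearMap.comp_assoc a, hg,
    LinearMap.id_comp]⟩

theorem FactorsProj.comp_left {f : M →ₗ[A] N} (h : FactorsProj f) (g : N →ₗ[A] L) :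
    FactorsProj (g ∘ₗ f) := by
  obtain ⟨n, a, b, rfl⟩ := h
  exact ⟨n, a, g ∘ₗ b, rfl⟩

theorem FactorsProj.comp_right {f : M →ₗ[A] N} (h : FactorsProj f) (g : L →ₗ[A] M) :
    FactorsProj (f ∘ₗ g) := by
  obtain ⟨n, a, b, rfl⟩ := h
  exact ⟨n, a ∘ₗ g, b, rfl⟩

theorem FactorsProj.zero : FactorsProj (0 : M →ₗ[A] N) := ⟨0, 0, 0, by simp⟩

theorem FactorsProj.add {f g : M →ₗ[A] N} (hf : FactorsProj f) (hg : FactorsProj g) :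
    FactorsProj (f + g) := by
  obtain ⟨n, a, b, rfl⟩ := hf
  obtain ⟨m, c, d, rfl⟩ := hg
  have : b ∘ₗ a + d ∘ₗ c = (b.coprod d) ∘ₗ (a.prod c) := by ext x; simp
  rw [this]
  exact FactorsProj.of_comp _ _

theorem FactorsProj.neg {f : M →ₗ[A] N} (hf : FactorsProj f) : FactorsProj (-f) := by
  have := hf.comp_left (-LinearMap.id)
  simpa using this

/-- A map that factors through a projective module lifts along surjections. -/
theorem FactorsProj.exists_lift {f : M →ₗ[A] N} (hf : FactorsProj f) (p : L →ₗ[A] N)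
    (hp : Function.Surjective p) : ∃ g : M →ₗ[A] L, p ∘ₗ g = f := by
  obtain ⟨n, a, b, rfl⟩ := hf
  obtain ⟨c, hc⟩ := Module.projective_lifting_property p b hp
  exact ⟨c ∘ₗ a, by rw [← LinearMap.comp_assoc, hc]⟩

theorem projective_of_factorsProj_id (h : FactorsProj (LinearMap.id : M →ₗ[A] M)) :
    Module.Projective A M := by
  obtain ⟨n, a, b, h⟩ := h
  exact Module.Projective.of_split a b h.symm

end FactorsProj

section Trace

variable {k : Type*} [Field k] {A : Type*} [Ring A] [Algebra k A] (t : A →ₗ[k] k)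

/-- A linear form on `End P` extending `t` in the sense that the endomorphism `x ↦ β x • y` has
value `t (β y)`. -/
def IsTraceForm {P : Type*} [AddCommGroup P] [Module A P] [Module k P] [IsScalarTower k A P]
    (Tr : (P →ₗ[A] P) →ₗ[k] k) : Prop :=
  ∀ (β : P →ₗ[A] A) (y : P), Tr (β.smulRight y) = t (β y)

variable {t} (ht : ∀ a b, t (a * b) = t (b * a))
include ht

theorem exists_isTraceForm (P : Type*) [AddCommGroup P] [Module A P] [Module k P]
    [IsScalarTower k A P] [Module.Finite A P] [Module.Projective A P] :
    ∃ Tr : (P →ₗ[A] P) →ₗ[k] k, IsTraceForm t Tr := by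
  obtain ⟨n, x, α, h⟩ := exists_dualBasis A P
  refine ⟨⟨⟨fun u => ∑ i, t (α i (u (x i))), fun u v => by simp [Finset.sum_add_distrib]⟩,
    fun c u => ?_⟩, fun β y => ?_⟩
  · simp only [LinearMap.smul_apply, RingHom.id_apply, smul_eq_mul, Finset.mul_sum]
    refine Finset.sum_congr rfl fun i _ => ?_
    rw [LinearMap.map_smul_of_tower, map_smul, smul_eq_mul]
  · simp only [LinearMap.coe_mk, AddHom.coe_mk, LinearMap.smulRight_apply, map_smul, smul_eq_mul]
    conv_rhs => rw [← h y, map_sum, map_sum]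
    refine Finset.sum_congr rfl fun i _ => ?_
    rw [ht, map_smul, smul_eq_mul]

omit ht in
theorem IsTraceForm.comm {P Q : Type*} [AddCommGroup P] [Module A P] [Module k P]
    [IsScalarTower k A P] [Module.Finite A P] [Module.Projective A P] [AddCommGroup Q] [Module A Q]
    [Module k Q] [IsScalarTower k A Q] {TrP : (P →ₗ[A] P) →ₗ[k] k} (hP : IsTraceForm t TrP)
    {TrQ : (Q →ₗ[A] Q) →ₗ[k] k} (hQ : IsTraceForm t TrQ) (u : P →ₗ[A] Q) (v : Q →ₗ[A] P) :
    TrP (v ∘ₗ u) = TrQ (u ∘ₗ v) := by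
  obtain ⟨n, x, α, h⟩ := exists_dualBasis A P
  have h1 : v ∘ₗ u = ∑ i, (α i).smulRight (v (u (x i))) := by
    ext y
    conv_lhs => rw [← h y]
    simp
  have h2 : u ∘ₗ v = ∑ i, (α i ∘ₗ v).smulRight (u (x i)) := by
    ext y
    conv_lhs => rw [LinearMap.comp_apply, ← h (v y)]
    simp
  rw [h1, h2, map_sum, map_sum]
  refine Finset.sum_congr rfl fun i _ => ?_
  rw [hP, hQ, LinearMap.comp_apply]

variable (hn : ∀ a, (∀ b, t (a * b) = 0) → a = 0)
include hn

/-- Every `k`-linear form on `M` is of the form `t ∘ h` for an `A`-linear `h : M → A`. -/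
theorem exists_linearMap_of_form [FiniteDimensional k A] {M : Type*} [AddCommGroup M] [Module A M]
    [Module k M] [IsScalarTower k A M] (ξ : M →ₗ[k] k) :
    ∃ h : M →ₗ[A] A, ∀ m, t (h m) = ξ m := by
  have hex : ∀ m, ∃ a : A, ∀ b, ξ (b • m) = t (b * a) := fun m =>
    exists_eq_pairing ((LinearMap.mul k A).compr₂ t)
      (ξ ∘ₗ (LinearMap.toSpanSingleton A M m).restrictScalars k) fun v hv => by
        rw [hn v hv, map_zero]
  choose h hh using hex
  have hinj : ∀ a a' : A, (∀ b, t (b * a) = t (b * a')) → a = a' := fun a a' haa => by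
    rw [← sub_eq_zero]
    refine hn _ fun b => ?_
    rw [ht, mul_sub, map_sub, haa, sub_self]
  refine ⟨⟨⟨h, fun m m' => hinj _ _ fun b => ?_⟩, fun a m => hinj _ _ fun b => ?_⟩, fun m => ?_⟩
  · rw [← hh, smul_add, map_add, hh, hh, mul_add, map_add]
  · rw [← hh, smul_smul, hh, RingHom.id_apply, smul_eq_mul, mul_assoc]
  · have := hh m 1
    rw [one_smul, one_mul] at this
    exact this.symm

omit ht in
theorem IsTraceForm.eq_zero_of_left {P M : Type*} [AddCommGroup P] [Module A P] [Module k P]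
    [IsScalarTower k A P] [Module.Finite A P] [Module.Projective A P] [AddCommGroup M] [Module A M]
    {Tr : (P →ₗ[A] P) →ₗ[k] k} (hP : IsTraceForm t Tr)
    (h : M →ₗ[A] P) (h0 : ∀ b : P →ₗ[A] M, Tr (h ∘ₗ b) = 0) : h = 0 := by
  obtain ⟨n, x, α, hx⟩ := exists_dualBasis A P
  ext m
  rw [← hx (h m)]
  refine Finset.sum_eq_zero fun i _ => ?_
  have : α i (h m) = 0 := hn _ fun b => by
    have h1 := h0 (((LinearMap.toSpanSingleton A A b) ∘ₗ α i).smulRight m)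
    have h2 : h ∘ₗ ((LinearMap.toSpanSingleton A A b) ∘ₗ α i).smulRight m =
      ((LinearMap.toSpanSingleton A A b) ∘ₗ α i).smulRight (h m) := by ext y; simp
    rw [h2, hP] at h1
    simpa using h1
  rw [this, zero_smul]

theorem IsTraceForm.eq_zero_of_right [FiniteDimensional k A] {P M : Type*} [AddCommGroup P]
    [Module A P] [Module k P] [IsScalarTower k A P] [AddCommGroup M] [Module A M] [Module k M]
    [IsScalarTower k A M] {Tr : (P →ₗ[A] P) →ₗ[k] k} (hP : IsTraceForm t Tr)
    (b : P →ₗ[A] M) (h0 : ∀ h : M →ₗ[A] P, Tr (h ∘ₗ b) = 0) : b = 0 := by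
  ext y
  rw [LinearMap.zero_apply, ← Module.forall_dual_apply_eq_zero_iff k]
  intro ξ
  obtain ⟨h, hh⟩ := exists_linearMap_of_form ht hn ξ
  rw [← hh, ← h0 (h.smulRight y)]
  have : h.smulRight y ∘ₗ b = (h ∘ₗ b).smulRight y := by ext z; simp
  rw [this, hP, LinearMap.comp_apply]

end Trace

section StableDuality

variable {k : Type w} [Field k] {A : Type v} [Ring A] [Algebra k A]

/-- A linear form on `Hom(X, K)` such that the pairings `(f, g) ↦ φ (g ∘ f)` on
`Hom(X, N) × Hom(N, K)` become perfect modulo the maps that factor through projectives. -/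
structure IsStableDuality {X K : Type v} [AddCommGroup X] [Module A X] [AddCommGroup K]
    [Module A K] [Module k K] [IsScalarTower k A K] (φ : (X →ₗ[A] K) →ₗ[k] k) : Prop where
  map_eq_zero : ∀ h, FactorsProj h → φ h = 0
  left : ∀ (N : Type v) [AddCommGroup N] [Module A N] [Module.Finite A N] (f : X →ₗ[A] N),
    (∀ g : N →ₗ[A] K, φ (g ∘ₗ f) = 0) → FactorsProj f
  right : ∀ (N : Type v) [AddCommGroup N] [Module A N] [Module.Finite A N] (g : N →ₗ[A] K),
    (∀ f : X →ₗ[A] N, φ (g ∘ₗ f) = 0) → FactorsProj g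

theorem IsStableDuality.exists_of_form [FiniteDimensional k A] {X K N : Type v} [AddCommGroup X]
    [Module A X] [Module.Finite A X] [AddCommGroup K] [Module A K] [Module k K]
    [IsScalarTower k A K] [AddCommGroup N] [Module A N] [Module.Finite A N] [Module k N]
    [IsScalarTower k A N] {φ : (X →ₗ[A] K) →ₗ[k] k} (h : IsStableDuality φ)
    (ω : (X →ₗ[A] N) →ₗ[k] k) (hω : ∀ f, FactorsProj f → ω f = 0) :
    ∃ u : N →ₗ[A] K, ∀ f, ω f = φ (u ∘ₗ f) := by
  let _ : Module k X := Module.restrictScalars k A X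
  have : IsScalarTower k A X := IsScalarTower.restrictScalars k A X
  have := finiteDimensional_of_finite k A X
  have := finiteDimensional_of_finite k A N
  have := finiteDimensional_linearMap k A X N
  exact exists_eq_pairing ((homComp k X N K).compr₂ φ) ω fun v hv =>
    hω v (h.left N v hv)

/-- The second object of a stable duality is determined up to stable isomorphism. -/
theorem IsStableDuality.unique [FiniteDimensional k A] {X K K' : Type v} [AddCommGroup X]
    [Module A X] [Module.Finite A X]
    [AddCommGroup K] [Module A K] [Module.Finite A K] [Module k K] [IsScalarTower k A K]
    [AddCommGroup K'] [Module A K'] [Module.Finite A K'] [Module k K'] [IsScalarTower k A K']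
    {φ : (X →ₗ[A] K) →ₗ[k] k} (h : IsStableDuality φ)
    {φ' : (X →ₗ[A] K') →ₗ[k] k} (h' : IsStableDuality φ') :
    ∃ (u : K →ₗ[A] K') (v : K' →ₗ[A] K), FactorsProj (v ∘ₗ u - LinearMap.id) ∧
      FactorsProj (u ∘ₗ v - LinearMap.id) := by
  obtain ⟨v, hv⟩ := h.exists_of_form φ' h'.map_eq_zero
  obtain ⟨u, hu⟩ := h'.exists_of_form φ h.map_eq_zero
  refine ⟨u, v, h.right _ _ fun f => ?_, h'.right _ _ fun f => ?_⟩
  · rw [LinearMap.sub_comp, map_sub, LinearMap.comp_assoc, ← hv, ← hu, LinearMap.id_comp, sub_self]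
  · rw [LinearMap.sub_comp, map_sub, LinearMap.comp_assoc, ← hu, ← hv, LinearMap.id_comp, sub_self]

/-- Auslander-Reiten duality for a symmetric algebra: `D Hom(X, N) = Hom(N, Ω X)` modulo maps
through projectives. -/
theorem exists_isStableDuality [FiniteDimensional k A] {t : A →ₗ[k] k}
    (ht : ∀ a b, t (a * b) = t (b * a)) (hn : ∀ a, (∀ b, t (a * b) = 0) → a = 0)
    {X K P : Type v} [AddCommGroup X] [Module A X] [AddCommGroup K] [Module A K]
    [Module.Finite A K] [Module k K] [IsScalarTower k A K] [AddCommGroup P] [Module A P]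
    [Module.Finite A P] [Module.Projective A P] (i : K →ₗ[A] P) (p : P →ₗ[A] X)
    (hi : Function.Injective i) (hip : Function.Exact i p) (hp : Function.Surjective p) :
    ∃ φ : (X →ₗ[A] K) →ₗ[k] k, IsStableDuality φ := by
  let _ : Module k X := Module.restrictScalars k A X
  have : IsScalarTower k A X := IsScalarTower.restrictScalars k A X
  let _ : Module k P := Module.restrictScalars k A P
  have : IsScalarTower k A P := IsScalarTower.restrictScalars k A P
  have : Module.Finite A X := Module.Finite.of_surjective p hp
  obtain ⟨Tr, hTr⟩ := exists_isTraceForm ht P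
  have hpi : p ∘ₗ i = 0 := LinearMap.ext hip.apply_apply_eq_zero
  have hfac : ∀ {n : ℕ} {M : Type v} [AddCommGroup M] [Module A M] (a : P →ₗ[A] (Fin n → A))
      (b : (Fin n → A) →ₗ[A] M) (c : M →ₗ[A] P), a ∘ₗ c ∘ₗ b = 0 → Tr (c ∘ₗ b ∘ₗ a) = 0 := by
    intro n M _ _ a b c h
    obtain ⟨Tr', hTr'⟩ := exists_isTraceForm ht (Fin n → A)
    rw [← LinearMap.comp_assoc, hTr.comm hTr', h, map_zero]
  refine ⟨Tr ∘ₗ (homComp k P K P).flip i ∘ₗ homComp k P X K p,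
    ⟨?_, ?_, ?_⟩⟩
  · rintro h ⟨n, a, b, rfl⟩
    exact hfac (a ∘ₗ p) b i (by
      rw [LinearMap.comp_assoc, ← LinearMap.comp_assoc b, hpi, LinearMap.zero_comp,
        LinearMap.comp_zero])
  · intro N _ _ _ f hf
    let _ : Module k N := Module.restrictScalars k A N
    have : IsScalarTower k A N := IsScalarTower.restrictScalars k A N
    have := finiteDimensional_of_finite k A N
    have := finiteDimensional_of_finite k A X
    have := finiteDimensional_of_finite k A P
    have := finiteDimensional_linearMap k A N P
    obtain ⟨n, q, hq⟩ := Module.Finite.exists_fin' A N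
    obtain ⟨Tr', hTr'⟩ := exists_isTraceForm ht (Fin n → A)
    have := finiteDimensional_linearMap k A (Fin n → A) X
    obtain ⟨s, hs⟩ := exists_eq_pairing
      (V := N →ₗ[A] P) (W := X →ₗ[A] (Fin n → A))
      (((homComp k (Fin n → A) X (Fin n → A)).compr₂ Tr').comp
        (homComp k (Fin n → A) N X q ∘ₗ (homComp k N P X).flip p))
      (Tr ∘ₗ homComp k P N P (f ∘ₗ p)) (fun h hh => by
        have h1 : p ∘ₗ h ∘ₗ q = 0 := hTr'.eq_zero_of_right ht hn _ hh
        have h2 : p ∘ₗ h = 0 := by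
          ext y
          obtain ⟨z, rfl⟩ := hq y
          exact LinearMap.congr_fun h1 z
        have h3 : ∀ y, ∃ z, i z = h y := fun y => (hip (h y)).1 (LinearMap.congr_fun h2 y)
        obtain ⟨g, hg⟩ : ∃ g : N →ₗ[A] K, i ∘ₗ g = h :=
          exists_comp_eq_of_injective i hi h h3
        rw [← hg]
        exact hf g)
    refine ⟨n, s, q, ?_⟩
    have key : (f - q ∘ₗ s) ∘ₗ p = 0 := hTr.eq_zero_of_right ht hn _ fun h => by
      have h1 := hs h
      have h2 : Tr' (s ∘ₗ (p ∘ₗ h ∘ₗ q)) = Tr (h ∘ₗ (q ∘ₗ s) ∘ₗ p) := by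
        have := hTr'.comm hTr (h ∘ₗ q) (s ∘ₗ p)
        exact this
      change Tr (h ∘ₗ f ∘ₗ p) = Tr' (s ∘ₗ (p ∘ₗ h ∘ₗ q)) at h1
      rw [LinearMap.sub_comp, LinearMap.comp_sub, map_sub, h1, h2, sub_self]
    ext x
    obtain ⟨z, rfl⟩ := hp x
    have := LinearMap.congr_fun key z
    exact sub_eq_zero.1 this
  · intro N _ _ _ g hg
    let _ : Module k N := Module.restrictScalars k A N
    have : IsScalarTower k A N := IsScalarTower.restrictScalars k A N
    have := finiteDimensional_of_finite k A N
    have := finiteDimensional_of_finite k A P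
    have := finiteDimensional_linearMap k A P N
    obtain ⟨n, q, hq⟩ := Module.Finite.exists_fin' A K
    obtain ⟨Tr', hTr'⟩ := exists_isTraceForm ht (Fin n → A)
    obtain ⟨s, hs⟩ := exists_eq_pairing
      (V := P →ₗ[A] N) (W := N →ₗ[A] (Fin n → A))
      (((homComp k (Fin n → A) N (Fin n → A)).compr₂ Tr').comp
        (homComp k (Fin n → A) P N (i ∘ₗ q)))
      (Tr ∘ₗ (homComp k P N P).flip (i ∘ₗ g)) (fun b hb => by
        have h1 : b ∘ₗ i ∘ₗ q = 0 := hTr'.eq_zero_of_right ht hn _ hb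
        have h2 : b ∘ₗ i = 0 := by
          ext y
          obtain ⟨z, rfl⟩ := hq y
          exact LinearMap.congr_fun h1 z
        obtain ⟨f, hf⟩ : ∃ f : X →ₗ[A] N, f ∘ₗ p = b :=
          exists_comp_eq_of_surjective p hp b fun x hx => by
            obtain ⟨y, rfl⟩ := (hip x).1 hx
            exact LinearMap.congr_fun h2 y
        rw [← hf]
        exact hg f)
    refine ⟨n, s, q, ?_⟩
    have key : i ∘ₗ (g - q ∘ₗ s) = 0 := hTr.eq_zero_of_left hn _ fun b => by
      have h1 := hs b
      have h2 : Tr' (s ∘ₗ (b ∘ₗ i ∘ₗ q)) = Tr ((i ∘ₗ q ∘ₗ s) ∘ₗ b) :=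
        hTr'.comm hTr (i ∘ₗ q) (s ∘ₗ b)
      change Tr ((i ∘ₗ g) ∘ₗ b) = Tr' (s ∘ₗ (b ∘ₗ i ∘ₗ q)) at h1
      rw [LinearMap.comp_sub, LinearMap.sub_comp, map_sub, h1, h2, sub_self]
    ext x
    apply hi
    have := LinearMap.congr_fun key x
    rw [LinearMap.comp_apply, LinearMap.sub_apply, map_sub] at this
    exact sub_eq_zero.1 this

end StableDuality

section SelfInjective

variable {k : Type w} [Field k] {A : Type v} [Ring A] [Algebra k A]

theorem IsSymmetricFDAlgebra.isArtinianRing (hA : IsSymmetricFDAlgebra k A) : IsArtinianRing A :=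
  have := hA.1
  IsArtinianRing.of_finite k A

/-- Projective modules over a symmetric algebra are injective. -/
theorem IsSymmetricFDAlgebra.exists_extension (hA : IsSymmetricFDAlgebra k A)
    {M N P : Type*} [AddCommGroup M] [Module A M] [AddCommGroup N] [Module A N] [AddCommGroup P]
    [Module A P] [Module.Finite A P] [Module.Projective A P] (j : M →ₗ[A] N)
    (hj : Function.Injective j) (h : M →ₗ[A] P) : ∃ h' : N →ₗ[A] P, h' ∘ₗ j = h := by
  obtain ⟨_, t, ht, hn⟩ := hA
  let _ : Module k M := Module.restrictScalars k A M
  have : IsScalarTower k A M := IsScalarTower.restrictScalars k A M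
  let _ : Module k N := Module.restrictScalars k A N
  have : IsScalarTower k A N := IsScalarTower.restrictScalars k A N
  obtain ⟨r, hr⟩ := (j.restrictScalars k).exists_leftInverse_of_injective
    (LinearMap.ker_eq_bot.2 hj)
  have hr' : ∀ m, r (j m) = m := fun m => LinearMap.congr_fun hr m
  have key : ∀ h : M →ₗ[A] A, ∃ h' : N →ₗ[A] A, h' ∘ₗ j = h := fun h => by
    obtain ⟨h', hh'⟩ := exists_linearMap_of_form ht hn (t ∘ₗ h.restrictScalars k ∘ₗ r)
    refine ⟨h', LinearMap.ext fun m => sub_eq_zero.1 (hn _ fun b => ?_)⟩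
    have h1 := hh' (j (b • m))
    rw [LinearMap.comp_apply, LinearMap.comp_apply, hr', map_smul, map_smul] at h1
    rw [ht, mul_sub, map_sub, sub_eq_zero]
    refine h1.trans ?_
    rw [LinearMap.restrictScalars_apply, map_smul]
    rfl
  choose ext hext using key
  obtain ⟨n, x, α, hx⟩ := exists_dualBasis A P
  refine ⟨∑ i, (ext (α i ∘ₗ h)).smulRight (x i), LinearMap.ext fun m => ?_⟩
  rw [LinearMap.comp_apply, LinearMap.sum_apply]
  conv_rhs => rw [← hx (h m)]
  refine Finset.sum_congr rfl fun i _ => ?_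
  rw [LinearMap.smulRight_apply]
  congr 1
  exact LinearMap.congr_fun (hext (α i ∘ₗ h)) m

/-- An injection from a projective module over a symmetric algebra splits. -/
theorem IsSymmetricFDAlgebra.exists_retraction (hA : IsSymmetricFDAlgebra k A)
    {N P : Type*} [AddCommGroup N] [Module A N] [AddCommGroup P]
    [Module A P] [Module.Finite A P] [Module.Projective A P] (j : P →ₗ[A] N)
    (hj : Function.Injective j) : ∃ r : N →ₗ[A] P, r ∘ₗ j = LinearMap.id :=
  hA.exists_extension j hj LinearMap.id

theorem pow_comp_eq_of_comp_eq {M N : Type*} [AddCommGroup M] [Module A M] [AddCommGroup N]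
    [Module A N] {f : Module.End A M} {g : Module.End A N} {i : M →ₗ[A] N}
    (h : g ∘ₗ i = i ∘ₗ f) (n : ℕ) : (g ^ n) ∘ₗ i = i ∘ₗ (f ^ n : Module.End A M) := by
  ext x
  induction n generalizing x with
  | zero => rfl
  | succ n ih =>
    have h1 : g (i x) = i (f x) := LinearMap.congr_fun h x
    simp only [LinearMap.comp_apply, pow_succ, Module.End.mul_apply, h1] at ih ⊢
    exact ih (f x)

/-- The kernel of a projective cover of an indecomposable nonprojective module over a symmetric
algebra is indecomposable and nonprojective. -/
theorem IsSymmetricFDAlgebra.isIndec_syzygy (hA : IsSymmetricFDAlgebra k A)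
    {X K P : Type*} [AddCommGroup X] [Module A X] [AddCommGroup K] [Module A K] [AddCommGroup P]
    [Module A P] [Module.Finite A P] [Module.Projective A P] (i : K →ₗ[A] P) (p : P →ₗ[A] X)
    (hi : Function.Injective i) (hip : Function.Exact i p) (hp : Function.Surjective p)
    (hsup : ∀ L : Submodule A P, L ⊔ LinearMap.ker p = ⊤ → L = ⊤)
    (hX : IsIndec A X) (hXp : ¬ Module.Projective A X) :
    IsIndec A K ∧ ¬ Module.Projective A K := by
  have := hA.isArtinianRing
  have : Module.Finite A X := Module.Finite.of_surjective p hp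
  have : Module.Finite A K := Module.Finite.of_injective i hi
  have hpi : ∀ x, p (i x) = 0 := hip.apply_apply_eq_zero
  have hnt : Nontrivial K := by
    by_contra hK
    rw [not_nontrivial_iff_subsingleton] at hK
    refine hXp (Module.Projective.of_equiv (LinearEquiv.ofBijective p ⟨?_, hp⟩))
    rw [← LinearMap.ker_eq_bot, eq_bot_iff]
    intro x hx
    obtain ⟨y, rfl⟩ := (hip x).1 hx
    rw [Subsingleton.elim y 0, map_zero]
    exact Submodule.zero_mem _
  have hproj : ∀ e : Module.End A K, e * e = e → FactorsProj e → e = 0 := by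
    intro e he hfe
    have he' : ∀ x, e (e x) = e x := fun x => LinearMap.congr_fun he x
    have : Module.Projective A (LinearMap.range e) := by
      apply projective_of_factorsProj_id
      have h1 := (hfe.comp_left e.rangeRestrict).comp_right (LinearMap.range e).subtype
      convert h1
      ext ⟨_, ⟨y, rfl⟩⟩
      simp [he']
    obtain ⟨r, hr⟩ := hA.exists_retraction (i ∘ₗ (LinearMap.range e).subtype)
      (hi.comp (Submodule.injective_subtype _))
    have hr' : ∀ y, r (i (e y)) = ⟨e y, y, rfl⟩ := fun y => LinearMap.congr_fun hr ⟨e y, y, rfl⟩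
    have htop := hsup (LinearMap.ker r) (by
      rw [eq_top_iff]
      intro x _
      obtain ⟨y, hy⟩ := (r x).2
      refine Submodule.mem_sup.2 ⟨x - i (r x), ?_, i (r x), hpi _, by abel⟩
      rw [LinearMap.mem_ker, map_sub, ← hy, hr', sub_eq_zero]
      exact Subtype.ext hy.symm)
    ext y
    have : r (i (e y)) = 0 := LinearMap.mem_ker.1 (htop ▸ Submodule.mem_top)
    rw [hr'] at this
    exact congrArg Subtype.val this
  have hlift : ∀ e : Module.End A K, ∃ (ê : Module.End A P) (ē : Module.End A X),
      ê ∘ₗ i = i ∘ₗ e ∧ ē ∘ₗ p = p ∘ₗ ê := fun e => by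
    obtain ⟨ê, hê⟩ := hA.exists_extension i hi (i ∘ₗ e)
    obtain ⟨ē, hē⟩ := exists_comp_eq_of_surjective p hp (p ∘ₗ ê) fun x hx => by
      obtain ⟨y, rfl⟩ := (hip x).1 hx
      have : ê (i y) = i (e y) := LinearMap.congr_fun hê y
      rw [LinearMap.comp_apply, this, hpi]
    exact ⟨ê, ē, hê, hē⟩
  have hnil : ∀ (e : Module.End A K) (ê : Module.End A P) (ē : Module.End A X), e * e = e →
      ê ∘ₗ i = i ∘ₗ e → ē ∘ₗ p = p ∘ₗ ê → IsNilpotent ē → e = 0 := by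
    rintro e ê ē he h1 h2 ⟨n, hn⟩
    apply hproj e he
    obtain ⟨g, hg⟩ := exists_comp_eq_of_injective i hi (ê ^ (n + 1)) fun y => by
      rw [← Set.mem_range, ← (hip _), ← LinearMap.comp_apply, ← pow_comp_eq_of_comp_eq h2,
        LinearMap.comp_apply, pow_succ', hn, mul_zero, LinearMap.zero_apply]
    have : e = g ∘ₗ i := by
      ext x
      apply hi
      have h3 := LinearMap.congr_fun (pow_comp_eq_of_comp_eq h1 (n + 1)) x
      rw [IsIdempotentElem.pow_succ_eq n he] at h3
      rw [← LinearMap.comp_apply i, ← h3, ← hg]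
      rfl
    rw [this]
    exact FactorsProj.of_comp _ _
  refine ⟨⟨hnt, fun e he => ?_⟩, fun hK => ?_⟩
  · obtain ⟨ê, ē, h1, h2⟩ := hlift e
    rcases hX.isUnit_or_isNilpotent ē with h3 | h3
    · rcases hX.isUnit_or_isNilpotent (1 - ē) with h4 | h4
      · exfalso
        have h1' : ∀ x, ê (i x) = i (e x) := LinearMap.congr_fun h1
        have h2' : ∀ x, ē (p x) = p (ê x) := LinearMap.congr_fun h2
        obtain ⟨g, hg⟩ := exists_comp_eq_of_surjective p hp (ê * (1 - ê)) fun x hx => by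
          obtain ⟨y, rfl⟩ := (hip x).1 hx
          have : e (e y) = e y := LinearMap.congr_fun he y
          simp [h1', this]
        have h5 : ē * (1 - ē) = p ∘ₗ g := by
          ext x
          obtain ⟨y, rfl⟩ := hp x
          have := LinearMap.congr_fun hg y
          simp only [LinearMap.comp_apply, Module.End.mul_apply, LinearMap.sub_apply,
            Module.End.one_apply, map_sub] at this
          simp [this, h2']
        obtain ⟨u, hu⟩ := h3.mul h4
        rw [h5] at hu
        refine hXp (Module.Projective.of_split (g ∘ₗ (↑u⁻¹ : Module.End A X)) p ?_)
        rw [← LinearMap.comp_assoc, ← hu]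
        exact Units.mul_inv u
      · right
        have h5 := hnil (1 - e) (1 - ê) (1 - ē) (by
          rw [mul_sub, sub_mul, sub_mul, one_mul, one_mul, mul_one, he, sub_self, sub_zero]) (by
          ext x
          have := LinearMap.congr_fun h1 x
          simp only [LinearMap.comp_apply] at this
          simp [this]) (by
          ext x
          have := LinearMap.congr_fun h2 x
          simp only [LinearMap.comp_apply] at this
          simp [this]) h4
        exact (sub_eq_zero.1 h5).symm
    · exact Or.inl (hnil e ê ē he h1 h2 h3)
  · have h1 := hproj 1 (mul_one 1) (FactorsProj.of_comp (P := K) LinearMap.id LinearMap.id)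
    obtain ⟨x, hx⟩ := exists_ne (0 : K)
    exact hx (LinearMap.congr_fun h1 x)

end SelfInjective

section StableIso

variable {A : Type*} [Ring A] [IsArtinianRing A]

/-- Stably isomorphic indecomposable nonprojective modules are isomorphic. -/
theorem IsIndec.bijective_of_stablyIso {M N : Type*} [AddCommGroup M] [Module A M]
    [Module.Finite A M] [AddCommGroup N] [Module A N] (hM : IsIndec A M)
    (hN : IsIndec A N) (hMp : ¬ Module.Projective A M) (f : M →ₗ[A] N) (g : N →ₗ[A] M)
    (h : FactorsProj (g ∘ₗ f - LinearMap.id)) : Function.Bijective f := by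
  have := hM.1
  have hu : IsUnit (g ∘ₗ f : Module.End A M) := by
    rcases hM.isUnit_or_isUnit_of_add (f := g ∘ₗ f) (g := -(g ∘ₗ f - LinearMap.id)) (by
      have : g ∘ₗ f + -(g ∘ₗ f - LinearMap.id) = (1 : Module.End A M) := by
        rw [neg_sub, add_sub_cancel]; rfl
      rw [this]
      exact isUnit_one) with h1 | h1
    · exact h1
    · exfalso
      obtain ⟨u, hu⟩ := h1
      refine hMp (projective_of_factorsProj_id ?_)
      have h2 := h.neg.comp_left (↑u⁻¹ : Module.End A M)
      rw [← hu] at h2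
      convert h2
      exact (Units.inv_mul u).symm
  exact (hN.bijective_of_isUnit_comp f g hu).1

end StableIso

section AlmostSplit

variable {A : Type v} [Ring A]

/-- An exact sequence `0 → L → E → X → 0` such that maps to `X` that are not split epimorphisms
lift to `E`, and maps from `L` that are not split monomorphisms extend to `E`. -/
structure IsAlmostSplit {L E X : Type v} [AddCommGroup L] [Module A L] [AddCommGroup E] [Module A E]
    [AddCommGroup X] [Module A X] (i : L →ₗ[A] E) (p : E →ₗ[A] X) : Prop where
  injective : Function.Injective i
  exact : Function.Exact i p
  surjective : Function.Surjective p
  not_split : ∀ s : X →ₗ[A] E, p ∘ₗ s ≠ LinearMap.id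
  lift : ∀ (Y : Type v) [AddCommGroup Y] [Module A Y] [Module.Finite A Y] (r : Y →ₗ[A] X),
    (∀ s : X →ₗ[A] Y, r ∘ₗ s ≠ LinearMap.id) → ∃ r' : Y →ₗ[A] E, p ∘ₗ r' = r
  extend : ∀ (Y : Type v) [AddCommGroup Y] [Module A Y] [Module.Finite A Y] (r : L →ₗ[A] Y),
    (∀ s : Y →ₗ[A] L, s ∘ₗ r ≠ LinearMap.id) → ∃ r' : E →ₗ[A] Y, r' ∘ₗ i = r

/-- A right almost split map whose kernel is indecomposable defines an almost split sequence. -/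
theorem isAlmostSplit_of_lift [IsArtinianRing A] {L E X : Type v} [AddCommGroup L] [Module A L]
    [Module.Finite A L] [AddCommGroup E] [Module A E] [Module.Finite A E]
    [AddCommGroup X] [Module A X] (i : L →ₗ[A] E) (p : E →ₗ[A] X) (hi : Function.Injective i)
    (hip : Function.Exact i p) (hp : Function.Surjective p)
    (hs : ∀ s : X →ₗ[A] E, p ∘ₗ s ≠ LinearMap.id)
    (hl : ∀ (Y : Type v) [AddCommGroup Y] [Module A Y] [Module.Finite A Y] (r : Y →ₗ[A] X),
      (∀ s : X →ₗ[A] Y, r ∘ₗ s ≠ LinearMap.id) → ∃ r' : Y →ₗ[A] E, p ∘ₗ r' = r)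
    (hL : IsIndec A L) : IsAlmostSplit i p := by
  refine ⟨hi, hip, hp, hs, hl, fun Y _ _ _ r hr => ?_⟩
  have hpi : ∀ x, p (i x) = 0 := hip.apply_apply_eq_zero
  -- the pushout of `i` along `r`
  let Q : Submodule A (E × Y) := LinearMap.range (i.prod (-r))
  let j : Y →ₗ[A] (E × Y) ⧸ Q := Q.mkQ ∘ₗ LinearMap.inr A E Y
  let a : E →ₗ[A] (E × Y) ⧸ Q := Q.mkQ ∘ₗ LinearMap.inl A E Y
  let q : (E × Y) ⧸ Q →ₗ[A] X := Q.liftQ (p ∘ₗ LinearMap.fst A E Y) (by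
    rintro _ ⟨x, rfl⟩
    simp [hpi])
  have haj : a ∘ₗ i = j ∘ₗ r := by
    ext x
    refine (Submodule.Quotient.eq _).2 ⟨x, ?_⟩
    simp
  have hqa : q ∘ₗ a = p := by ext x; simp [q, a]
  have hqj : q ∘ₗ j = 0 := by ext x; simp [q, j]
  have hj : Function.Injective j := by
    rw [← LinearMap.ker_eq_bot, eq_bot_iff]
    intro y hy
    obtain ⟨x, hx⟩ := (Submodule.Quotient.mk_eq_zero Q).1 hy
    have h1 : i x = 0 := congrArg Prod.fst hx
    have h2 : -r x = y := congrArg Prod.snd hx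
    have : x = 0 := hi (by rw [h1, map_zero])
    rw [Submodule.mem_bot, ← h2, this, map_zero, neg_zero]
  have hjq : ∀ z, q z = 0 → ∃ y, j y = z := fun z hz => by
    obtain ⟨⟨e, y⟩, rfl⟩ := Submodule.Quotient.mk_surjective Q z
    have h1 : p e = 0 := hz
    obtain ⟨x, rfl⟩ := (hip e).1 h1
    refine ⟨y + r x, (Submodule.Quotient.eq _).2 ⟨-x, ?_⟩⟩
    simp
  by_cases hsplit : ∃ s : X →ₗ[A] (E × Y) ⧸ Q, q ∘ₗ s = LinearMap.id
  · obtain ⟨s, hs⟩ := hsplit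
    obtain ⟨g, hg⟩ := exists_comp_eq_of_injective j hj (LinearMap.id - s ∘ₗ q) fun z => hjq _ (by
      have : q (s (q z)) = q z := LinearMap.congr_fun hs (q z)
      simp [this])
    refine ⟨g ∘ₗ a, ?_⟩
    ext x
    apply hj
    have h1 := LinearMap.congr_fun hg (a (i x))
    have h2 : q (a (i x)) = 0 := by rw [← LinearMap.comp_apply q, hqa, hpi]
    have h3 : a (i x) = j (r x) := LinearMap.congr_fun haj x
    simp only [LinearMap.comp_apply, LinearMap.sub_apply, h2, map_zero, sub_zero,
      LinearMap.id_apply] at h1 ⊢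
    rw [h1, h3]
  · exfalso
    push Not at hsplit
    obtain ⟨b, hb⟩ := hl _ q hsplit
    have hpb : ∀ z, p (b z) = q z := LinearMap.congr_fun hb
    -- the endomorphism of `E` over `X`
    let v : Module.End A E := b ∘ₗ a
    have hpv : p ∘ₗ v = p := by
      ext x
      exact (hpb (a x)).trans (LinearMap.congr_fun hqa x)
    obtain ⟨c, hc⟩ := exists_comp_eq_of_injective i hi (b ∘ₗ j) fun y => (hip _).1 (by
      rw [LinearMap.comp_apply, hpb]
      exact LinearMap.congr_fun hqj y)
    have hvi : v ∘ₗ i = i ∘ₗ (c ∘ₗ r) := by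
      rw [← LinearMap.comp_assoc r, hc, LinearMap.comp_assoc, haj]
      rfl
    rcases hL.isUnit_or_isNilpotent (c ∘ₗ r) with ⟨u, hu⟩ | ⟨n, hn⟩
    · refine hr ((↑u⁻¹ : Module.End A L) ∘ₗ c) ?_
      rw [LinearMap.comp_assoc, ← hu]
      exact Units.inv_mul u
    · have h1 := pow_comp_eq_of_comp_eq hvi n
      obtain ⟨s, hs'⟩ := exists_comp_eq_of_surjective p hp (v ^ n) fun x hx => by
        obtain ⟨y, rfl⟩ := (hip x).1 hx
        have := LinearMap.congr_fun h1 y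
        rw [hn] at this
        simpa using this
      refine hs s ?_
      have h2 : ∀ m, p ∘ₗ (v ^ m : Module.End A E) = p := fun m => by
        induction m with
        | zero => rfl
        | succ m ih =>
          rw [pow_succ]
          change (p ∘ₗ (v ^ m : Module.End A E)) ∘ₗ v = p
          rw [ih, hpv]
      ext x
      obtain ⟨y, rfl⟩ := hp x
      have h3 := LinearMap.congr_fun hs' y
      have h4 := LinearMap.congr_fun (h2 n) y
      simp only [LinearMap.comp_apply] at h3 h4 ⊢
      rw [h3, h4]
      rfl

/-- Existence of almost split sequences over a symmetric algebra, with left hand term the second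
syzygy. -/
theorem IsSymmetricFDAlgebra.exists_isAlmostSplit {k : Type w} [Field k] [Algebra k A]
    (hA : IsSymmetricFDAlgebra k A) {X K L P P' : Type v}
    [AddCommGroup X] [Module A X] [AddCommGroup K] [Module A K] [AddCommGroup L] [Module A L]
    [AddCommGroup P] [Module A P] [Module.Finite A P] [Module.Projective A P]
    [AddCommGroup P'] [Module A P'] [Module.Finite A P'] [Module.Projective A P']
    (i : K →ₗ[A] P) (p : P →ₗ[A] X) (hi : Function.Injective i) (hip : Function.Exact i p)
    (hp : Function.Surjective p) (i' : L →ₗ[A] P') (p' : P' →ₗ[A] K) (hi' : Function.Injective i')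
    (hip' : Function.Exact i' p') (hp' : Function.Surjective p')
    (hX : IsIndec A X) (hXp : ¬ Module.Projective A X) (hL : IsIndec A L) :
    ∃ (E : FGModuleCat.{v} A) (a : L →ₗ[A] E) (b : E →ₗ[A] X), IsAlmostSplit a b := by
  have := hA.isArtinianRing
  have : Module.Finite A X := Module.Finite.of_surjective p hp
  have : Module.Finite A K := Module.Finite.of_injective i hi
  have : Module.Finite A L := Module.Finite.of_injective i' hi'
  obtain ⟨_, t, ht, hn⟩ := hA
  let _ : Module k K := Module.restrictScalars k A K
  have : IsScalarTower k A K := IsScalarTower.restrictScalars k A K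
  let _ : Module k X := Module.restrictScalars k A X
  have : IsScalarTower k A X := IsScalarTower.restrictScalars k A X
  obtain ⟨φ, hφ⟩ := exists_isStableDuality ht hn i p hi hip hp
  have := hX.1
  let nonunits : Submodule k (Module.End A X) :=
    { carrier := {f | ¬ IsUnit f}
      zero_mem' := not_isUnit_zero
      add_mem' := fun ha hb hab => (hX.isUnit_or_isUnit_of_add hab).elim ha hb
      smul_mem' := fun c f hf hcf => hf <| by
        have hc : c ≠ 0 := fun h => by simp [h] at hcf
        rw [Module.End.isUnit_iff] at hcf ⊢
        have : (f : X → X) = fun x => c⁻¹ • (c • f) x := by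
          ext x; simp [smul_smul, hc]
        rw [this]
        exact (LinearEquiv.smulOfNeZero k X c⁻¹ (inv_ne_zero hc)).bijective.comp hcf }
  obtain ⟨θ, hθ1, hθ⟩ := Submodule.exists_le_ker_of_notMem (p := nonunits) (v := 1)
    (fun h => h isUnit_one)
  obtain ⟨g, hg⟩ := hφ.exists_of_form (N := X) θ fun f hf => by
    refine hθ fun hu => ?_
    obtain ⟨u, rfl⟩ := hu
    refine hXp (projective_of_factorsProj_id ?_)
    convert hf.comp_left (↑u⁻¹ : Module.End A X)
    exact (Units.inv_mul u).symm
  let E : Submodule A (X × P') := LinearMap.ker (g ∘ₗ LinearMap.fst A X P' -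
    p' ∘ₗ LinearMap.snd A X P')
  have hE : ∀ x : E, g x.1.1 = p' x.1.2 := fun x => by
    have := LinearMap.mem_ker.1 x.2
    exact sub_eq_zero.1 this
  have hpi' : ∀ x, p' (i' x) = 0 := hip'.apply_apply_eq_zero
  refine ⟨FGModuleCat.of A E, (LinearMap.inr A X P' ∘ₗ i').codRestrict E (fun x => by
      simp [E, hpi']), LinearMap.fst A X P' ∘ₗ E.subtype, ?_⟩
  refine isAlmostSplit_of_lift _ _ ?_ ?_ ?_ ?_ ?_ hL
  · intro x y hxy
    exact hi' (congrArg (fun z : E => z.1.2) hxy)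
  · rintro ⟨⟨x, y⟩, hxy⟩
    have h1 := hE ⟨⟨x, y⟩, hxy⟩
    constructor
    · intro h
      obtain rfl : x = 0 := h
      rw [map_zero] at h1
      obtain ⟨z, rfl⟩ := (hip' y).1 h1.symm
      exact ⟨z, rfl⟩
    · rintro ⟨z, hz⟩
      exact (congrArg (fun z : E => z.1.1) hz).symm
  · intro x
    obtain ⟨y, hy⟩ := hp' (g x)
    exact ⟨⟨(x, y), by simp [E, hy]⟩, rfl⟩
  · intro s hs
    have h1 : FactorsProj g := by
      have : g = p' ∘ₗ (LinearMap.snd A X P' ∘ₗ E.subtype ∘ₗ s) := by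
        ext x
        have h2 : (s x).1.1 = x := LinearMap.congr_fun hs x
        conv_lhs => rw [← h2]
        exact hE (s x)
      rw [this]
      exact FactorsProj.of_comp _ _
    have h2 := hg 1
    rw [hφ.map_eq_zero _ (h1.comp_right _)] at h2
    exact hθ1 h2
  · intro Y _ _ _ r hr
    have h1 : FactorsProj (g ∘ₗ r) := hφ.right _ _ fun f => by
      rw [LinearMap.comp_assoc, ← hg]
      refine hθ fun hu => ?_
      obtain ⟨u, hu⟩ := hu
      refine hr (f ∘ₗ (↑u⁻¹ : Module.End A X)) ?_
      rw [← LinearMap.comp_assoc, ← hu]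
      exact Units.mul_inv u
    obtain ⟨s, hs⟩ := h1.exists_lift p' hp'
    refine ⟨(r.prod s).codRestrict E fun y => ?_, ?_⟩
    · have : p' (s y) = g (r y) := LinearMap.congr_fun hs y
      simp [E, this]
    · ext y
      rfl

end AlmostSplit

section Translate

variable {k : Type w} [Field k] {A : Type v} [Ring A] [Algebra k A]

/-- The form on the transpose defined by an element of the kernel. -/
noncomputable def transposeForm (t : A →ₗ[k] k) {P₁ P₀ : Type v} [AddCommGroup P₁] [Module A P₁]
    [AddCommGroup P₀] [Module A P₀] (f : P₁ →ₗ[A] P₀) (x : LinearMap.ker f) :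
    Transpose f →ₗ[k] k :=
  (Submodule.liftQ ((LinearMap.range (starMap f)).restrictScalars k)
    { toFun := fun α : P₁ →ₗ[A] A => t (α x)
      map_add' := fun α β => by simp
      map_smul' := fun c α => by simp } (by
      rintro _ ⟨β, rfl⟩
      have : f x = 0 := x.2
      simp [starMap, this])) ∘ₗ
    (Submodule.Quotient.restrictScalarsEquiv k (LinearMap.range (starMap f))).symm.toLinearMap

theorem nonempty_equiv_kDual_transpose [FiniteDimensional k A] {t : A →ₗ[k] k}
    (ht : ∀ a b, t (a * b) = t (b * a)) (hn : ∀ a, (∀ b, t (a * b) = 0) → a = 0)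
    {P₁ P₀ : Type v} [AddCommGroup P₁] [Module A P₁]
    [AddCommGroup P₀] [Module A P₀] [Module.Finite A P₁] [Module.Projective A P₁]
    [Module.Finite A P₀] [Module.Projective A P₀] (f : P₁ →ₗ[A] P₀) :
    Nonempty (LinearMap.ker f ≃ₗ[A] KDual k A (Transpose f)) := by
  have hsep : ∀ {P : Type v} [AddCommGroup P] [Module A P] [Module.Finite A P]
      [Module.Projective A P] (x : P), (∀ α : P →ₗ[A] A, t (α x) = 0) → x = 0 := by
    intro P _ _ _ _ x hx
    obtain ⟨n, y, α, h⟩ := exists_dualBasis A P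
    rw [← h x]
    refine Finset.sum_eq_zero fun i _ => ?_
    rw [hn (α i x) fun b => hx (LinearMap.toSpanSingleton A A b ∘ₗ α i), zero_smul]
  let Φ : LinearMap.ker f →ₗ[A] KDual k A (Transpose f) :=
    { toFun := fun x => transposeForm t f x
      map_add' := fun x y => by
        refine LinearMap.ext fun z => ?_
        obtain ⟨α, rfl⟩ := Submodule.Quotient.mk_surjective _ z
        change t (α (x + y)) = t (α x) + t (α y)
        rw [map_add, map_add]
      map_smul' := fun a x => by
        refine LinearMap.ext fun z => ?_
        obtain ⟨α, rfl⟩ := Submodule.Quotient.mk_surjective _ z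
        change t (α (a • x)) = t (α x * a)
        rw [map_smul, smul_eq_mul, ht] }
  refine ⟨LinearEquiv.ofBijective Φ ⟨?_, ?_⟩⟩
  · rw [← LinearMap.ker_eq_bot, eq_bot_iff]
    intro x hx
    refine Subtype.ext (hsep x.1 fun α => ?_)
    exact LinearMap.congr_fun (LinearMap.mem_ker.1 hx : (Φ x : Transpose f →ₗ[k] k) = 0)
      (Submodule.Quotient.mk α)
  · intro ψ
    change Transpose f →ₗ[k] k at ψ
    let ψ' : (P₁ →ₗ[A] A) →ₗ[k] k := ψ ∘ₗ ((LinearMap.range (starMap f)).mkQ.restrictScalars k)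
    obtain ⟨n, y, α, h⟩ := exists_dualBasis A P₁
    have hb : ∀ i, ∃ b : A, ∀ a, ψ' (MulOpposite.op a • α i) = t (a * b) := fun i =>
      exists_eq_pairing ((LinearMap.mul k A).compr₂ t)
        { toFun := fun a => ψ' (MulOpposite.op a • α i)
          map_add' := fun a a' => by rw [MulOpposite.op_add, add_smul, map_add]
          map_smul' := fun c a => by
            rw [MulOpposite.op_smul, smul_assoc, map_smul, RingHom.id_apply] }
        fun v hv => by
          change ψ' (MulOpposite.op v • α i) = 0
          rw [hn v hv, MulOpposite.op_zero, zero_smul, map_zero]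
    choose b hb using hb
    have key : ∀ β : P₁ →ₗ[A] A, t (β (∑ i, b i • y i)) = ψ' β := fun β => by
      have h1 : β = ∑ i, MulOpposite.op (β (y i)) • α i := by
        ext x
        conv_lhs => rw [← h x]
        simp
      conv_rhs => rw [h1]
      simp only [map_sum, hb, map_smul, smul_eq_mul]
      exact Finset.sum_congr rfl fun i _ => ht _ _
    refine ⟨⟨∑ i, b i • y i, ?_⟩, ?_⟩
    · refine hsep _ fun β => ?_
      refine (key (starMap f β)).trans ?_
      change ψ (Submodule.Quotient.mk (starMap f β)) = 0
      rw [(Submodule.Quotient.mk_eq_zero (LinearMap.range (starMap f))).2 ⟨β, rfl⟩, map_zero]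
    · refine LinearMap.ext fun z => ?_
      obtain ⟨β, rfl⟩ := Submodule.Quotient.mk_surjective _ z
      exact key β

/-- Over a symmetric algebra, the Auslander-Reiten translate is the kernel of a minimal projective
presentation. -/
theorem IsSymmetricFDAlgebra.isARTranslate_iff (hA : IsSymmetricFDAlgebra k A)
    (M N : FGModuleCat.{v} A) : IsARTranslate k M N ↔
      ∃ (P₁ P₀ : FGModuleCat.{v} A) (f : P₁ →ₗ[A] P₀) (g : P₀ →ₗ[A] M),
        IsMinimalPresentation f g ∧ Nonempty (N ≃ₗ[A] LinearMap.ker f) := by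
  obtain ⟨_, t, ht, hn⟩ := hA
  constructor
  · rintro ⟨P₁, P₀, f, g, h, ⟨e⟩⟩
    have := h.projective₁
    have := h.projective₀
    exact ⟨P₁, P₀, f, g, h, ⟨e.trans (nonempty_equiv_kDual_transpose ht hn f).some.symm⟩⟩
  · rintro ⟨P₁, P₀, f, g, h, ⟨e⟩⟩
    have := h.projective₁
    have := h.projective₀
    exact ⟨P₁, P₀, f, g, h, ⟨e.trans (nonempty_equiv_kDual_transpose ht hn f).some⟩⟩

theorem IsSymmetricFDAlgebra.exists_isARTranslate (hA : IsSymmetricFDAlgebra k A)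
    (M : FGModuleCat.{v} A) : ∃ N : FGModuleCat.{v} A, IsARTranslate k M N := by
  have := hA.isArtinianRing
  obtain ⟨P₀, g, hP₀, hg, hs₀⟩ := exists_projectiveCover (A := A) M
  obtain ⟨P₁, q, hP₁, hq, hs₁⟩ := exists_projectiveCover (A := A) (LinearMap.ker g)
  refine ⟨FGModuleCat.of A (LinearMap.ker ((LinearMap.ker g).subtype ∘ₗ q)),
    (hA.isARTranslate_iff _ _).2 ⟨P₁, P₀, (LinearMap.ker g).subtype ∘ₗ q, g,
      ⟨hP₁, hP₀, ?_, hg, hs₀, ?_⟩, ⟨LinearEquiv.refl _ _⟩⟩⟩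
  · intro x
    constructor
    · intro hx
      obtain ⟨y, hy⟩ := hq ⟨x, hx⟩
      exact ⟨y, congrArg Subtype.val hy⟩
    · rintro ⟨y, rfl⟩
      exact (q y).2
  · intro K hK
    apply hs₁
    rwa [LinearMap.ker_comp_of_ker_eq_bot _ (Submodule.ker_subtype _)] at hK

/-- The translate of an indecomposable nonprojective module over a symmetric algebra is
indecomposable and nonprojective, and both are the ends of an almost split sequence. -/
theorem IsSymmetricFDAlgebra.exists_isAlmostSplit_of_isARTranslate (hA : IsSymmetricFDAlgebra k A)
    {M N : FGModuleCat.{v} A} (h : IsARTranslate k M N) (hM : IsIndec A M)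
    (hMp : ¬ Module.Projective A M) : IsIndec A N ∧ ¬ Module.Projective A N ∧
      ∃ (E : FGModuleCat.{v} A) (a : N →ₗ[A] E) (b : E →ₗ[A] M), IsAlmostSplit a b := by
  obtain ⟨P₁, P₀, f, g, h, ⟨e⟩⟩ := (hA.isARTranslate_iff _ _).1 h
  have := h.projective₁
  have := h.projective₀
  have hgf : ∀ x, g (f x) = 0 := h.exact.apply_apply_eq_zero
  let f' : P₁ →ₗ[A] LinearMap.ker g := f.codRestrict _ hgf
  have hf' : Function.Surjective f' := fun ⟨x, hx⟩ => by
    obtain ⟨y, rfl⟩ := (h.exact x).1 hx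
    exact ⟨y, rfl⟩
  have hex : Function.Exact (LinearMap.ker g).subtype g := fun x => by simp
  obtain ⟨hK, hKp⟩ := hA.isIndec_syzygy (LinearMap.ker g).subtype g
    (Submodule.injective_subtype _) hex h.surjective h.superfluous₀ hM hMp
  let i : N →ₗ[A] P₁ := (LinearMap.ker f).subtype ∘ₗ e.toLinearMap
  have hi : Function.Injective i := (Submodule.injective_subtype _).comp e.injective
  have hif : Function.Exact i f' := fun x => by
    constructor
    · intro hx
      exact ⟨e.symm ⟨x, congrArg Subtype.val hx⟩, by simp [i]⟩
    · rintro ⟨y, rfl⟩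
      exact Subtype.ext (e y).2
  obtain ⟨hN, hNp⟩ := hA.isIndec_syzygy i f' hi hif hf' (fun L hL => h.superfluous₁ L (by
    have : LinearMap.ker f' = LinearMap.ker f := LinearMap.ker_codRestrict _ _ _
    rwa [this] at hL)) hK hKp
  exact ⟨hN, hNp, hA.exists_isAlmostSplit (LinearMap.ker g).subtype g
    (Submodule.injective_subtype _) hex h.surjective i f' hi hif hf' hM hMp hN⟩

theorem IsSymmetricFDAlgebra.isSyzygy_of_isARTranslate (hA : IsSymmetricFDAlgebra k A)
    {M N : FGModuleCat.{v} A} (h : IsARTranslate k M N) :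
    ∃ K : FGModuleCat.{v} A, IsSyzygy M K ∧ IsSyzygy K N := by
  have := hA.isArtinianRing
  obtain ⟨P₁, P₀, f, g, h, ⟨e⟩⟩ := (hA.isARTranslate_iff _ _).1 h
  have hgf : ∀ x, g (f x) = 0 := h.exact.apply_apply_eq_zero
  refine ⟨FGModuleCat.of A (LinearMap.ker g), ⟨P₀, (LinearMap.ker g).subtype, g, h.projective₀,
    Submodule.injective_subtype _, fun x => ?_, h.surjective⟩, ⟨P₁,
    (LinearMap.ker f).subtype ∘ₗ e.toLinearMap, f.codRestrict (LinearMap.ker g) hgf,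
    h.projective₁, (Submodule.injective_subtype _).comp e.injective, fun x => ?_, ?_⟩⟩
  · constructor
    · exact fun hx => ⟨⟨x, hx⟩, rfl⟩
    · rintro ⟨y, rfl⟩
      exact y.2
  · constructor
    · intro hx
      exact ⟨e.symm ⟨x, congrArg Subtype.val hx⟩, by simp⟩
    · rintro ⟨y, rfl⟩
      exact Subtype.ext (e y).2
  · rintro ⟨x, hx⟩
    obtain ⟨y, rfl⟩ := (h.exact x).1 hx
    exact ⟨y, rfl⟩

end Translate

section PairingRank

variable {k : Type*} [Field k] {V W : Type*} [AddCommGroup V] [Module k V] [AddCommGroup W]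
  [Module k W] [FiniteDimensional k W]

/-- The two quotients by the kernels of a pairing have the same dimension. -/
theorem finrank_quotient_ker_eq_flip (B : V →ₗ[k] W →ₗ[k] k) :
    Module.finrank k (V ⧸ LinearMap.ker B) = Module.finrank k (W ⧸ LinearMap.ker B.flip) := by
  rw [B.quotKerEquivRange.finrank_eq, B.flip.quotKerEquivRange.finrank_eq,
    ← LinearMap.finrank_range_dualMap_eq_finrank_range]
  have : B.flip = B.dualMap ∘ₗ Module.Dual.eval k W := by
    ext w v
    rfl
  rw [this, LinearMap.range_comp_of_range_eq_top]
  exact LinearMap.range_eq_top.2 (Module.evalEquiv k W).surjective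

end PairingRank

section RadicalIdeal

variable (k : Type w) [Field k] {D : Type u} [Category.{v} D] [Preadditive D] [Linear k D]

theorem isIso_one_sub_comp_comm {X Y : D} (f : X ⟶ Y) (g : Y ⟶ X) (h : IsIso (𝟙 X - f ≫ g)) :
    IsIso (𝟙 Y - g ≫ f) := by
  have h1 : inv (𝟙 X - f ≫ g) - f ≫ g ≫ inv (𝟙 X - f ≫ g) = 𝟙 X := by
    have := IsIso.hom_inv_id (𝟙 X - f ≫ g)
    rwa [Preadditive.sub_comp, Category.id_comp, Category.assoc] at this
  have h2 : inv (𝟙 X - f ≫ g) - inv (𝟙 X - f ≫ g) ≫ f ≫ g = 𝟙 X := by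
    have := IsIso.inv_hom_id (𝟙 X - f ≫ g)
    rwa [Preadditive.comp_sub, Category.comp_id] at this
  generalize inv (𝟙 X - f ≫ g) = v at h1 h2
  refine ⟨𝟙 Y + g ≫ v ≫ f, ?_, ?_⟩
  · have h3 : g ≫ (v - f ≫ g ≫ v) ≫ f = g ≫ f := by rw [h1, Category.id_comp]
    simp only [Preadditive.sub_comp, Preadditive.comp_sub, Preadditive.comp_add,
      Category.id_comp, Category.comp_id, Category.assoc] at h3 ⊢
    rw [← h3]
    abel
  · have h3 : g ≫ (v - v ≫ f ≫ g) ≫ f = g ≫ f := by rw [h2, Category.id_comp]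
    simp only [Preadditive.sub_comp, Preadditive.comp_sub, Preadditive.add_comp,
      Category.id_comp, Category.comp_id, Category.assoc] at h3 ⊢
    rw [sub_eq_iff_eq_add.1 h3]
    abel

variable {k}

theorem comp_mem_radHom_right {X Y Z : D} {f : X ⟶ Y} (hf : f ∈ radHom k X Y) (g : Y ⟶ Z) :
    f ≫ g ∈ radHom k X Z := fun h => by
  rw [Category.assoc]
  exact hf (g ≫ h)

theorem comp_mem_radHom_left {X Y Z : D} (f : X ⟶ Y) {g : Y ⟶ Z} (hg : g ∈ radHom k Y Z) :
    f ≫ g ∈ radHom k X Z := fun h => by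
  have := isIso_one_sub_comp_comm (g ≫ h) f (by rw [Category.assoc]; exact hg (h ≫ f))
  rwa [← Category.assoc] at this

theorem mem_radHom_iff_comp_mem {Y Z : D} (f : Y ⟶ Z) :
    f ∈ radHom k Y Z ↔ ∀ g : Z ⟶ Y, f ≫ g ∈ radHom k Y Y := by
  refine ⟨fun h g => comp_mem_radHom_right h g, fun h g => ?_⟩
  have := h g (𝟙 Y)
  rwa [Category.comp_id] at this

theorem mem_radHom_iff_comp_mem' {Y Z : D} (f : Z ⟶ Y) :
    f ∈ radHom k Z Y ↔ ∀ g : Y ⟶ Z, g ≫ f ∈ radHom k Y Y := by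
  refine ⟨fun h g => comp_mem_radHom_left g h, fun h g => ?_⟩
  have := h g (𝟙 Y)
  rw [Category.comp_id] at this
  exact isIso_one_sub_comp_comm _ _ this

/-- The object `Y` has local endomorphism ring with residue field `k`. -/
structure IsSplitLocal (k : Type w) [Field k] {D : Type u} [Category.{v} D] [Preadditive D]
    [Linear k D] (Y : D) : Prop where
  id_notMem : 𝟙 Y ∉ radHom k Y Y
  exists_sub_mem : ∀ u : Y ⟶ Y, ∃ c : k, u - c • 𝟙 Y ∈ radHom k Y Y

namespace IsSplitLocal

variable {Y Z : D}

theorem isIso_of_notMem (hY : IsSplitLocal k Y) {u : Y ⟶ Y} (hu : u ∉ radHom k Y Y) : IsIso u := by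
  obtain ⟨c, hc⟩ := hY.exists_sub_mem u
  have hc0 : c ≠ 0 := fun h => hu (by simpa [h] using hc)
  have h1 := hc (-c⁻¹ • 𝟙 Y)
  have h2 : u = c • (𝟙 Y - (u - c • 𝟙 Y) ≫ (-c⁻¹ • 𝟙 Y)) := by
    simp [smul_sub, smul_smul, hc0]
  rw [h2]
  refine ⟨c⁻¹ • inv (𝟙 Y - (u - c • 𝟙 Y) ≫ (-c⁻¹ • 𝟙 Y)), ?_, ?_⟩
  · rw [Linear.smul_comp, Linear.comp_smul, smul_smul, mul_inv_cancel₀ hc0, one_smul,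
      IsIso.hom_inv_id]
  · rw [Linear.smul_comp, Linear.comp_smul, smul_smul, inv_mul_cancel₀ hc0, one_smul,
      IsIso.inv_hom_id]

theorem notMem_of_isIso (hY : IsSplitLocal k Y) (u : Y ⟶ Z) [IsIso u] : u ∉ radHom k Y Z :=
  fun h => hY.id_notMem (by simpa using comp_mem_radHom_right h (inv u))

/-- A morphism between objects with local endomorphism rings is radical or invertible. -/
theorem mem_radHom_or_isIso (hY : IsSplitLocal k Y) (hZ : IsSplitLocal k Z) (f : Y ⟶ Z) :
    f ∈ radHom k Y Z ∨ IsIso f := by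
  rw [or_iff_not_imp_left, mem_radHom_iff_comp_mem]
  intro h
  push Not at h
  obtain ⟨g, hg⟩ := h
  have h1 := hY.isIso_of_notMem hg
  have h2 : g ≫ f ∉ radHom k Z Z := fun h2 => by
    have h3 : (f ≫ g) ≫ (f ≫ g) ∈ radHom k Y Y := by
      have := comp_mem_radHom_left f (comp_mem_radHom_right h2 g)
      simpa using this
    exact hY.notMem_of_isIso _ h3
  have h4 := hZ.isIso_of_notMem h2
  have : IsSplitMono f := ⟨⟨⟨g ≫ inv (f ≫ g), by rw [← Category.assoc, IsIso.hom_inv_id]⟩⟩⟩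
  have : Epi f := ⟨fun a b hab => by
    rw [← cancel_epi (g ≫ f), Category.assoc, Category.assoc, hab]⟩
  exact isIso_of_epi_of_isSplitMono f

/-- The residue map of a local endomorphism ring. -/
theorem exists_residue (hY : IsSplitLocal k Y) :
    ∃ θ : (Y ⟶ Y) →ₗ[k] k, ∀ u, θ u = 0 ↔ u ∈ radHom k Y Y := by
  obtain ⟨θ, h1, h2⟩ := Submodule.exists_le_ker_of_notMem hY.id_notMem
  refine ⟨θ, fun u => ⟨fun hu => ?_, fun hu => h2 hu⟩⟩
  obtain ⟨c, hc⟩ := hY.exists_sub_mem u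
  have h3 : θ (u - c • 𝟙 Y) = 0 := h2 hc
  rw [map_sub, hu, map_smul, smul_eq_mul, zero_sub, neg_eq_zero, mul_eq_zero] at h3
  rw [h3.resolve_right h1] at hc
  simpa using hc

/-- The multiplicity of `Y` as a direct summand of `E` computed with maps from or to `Y`. -/
theorem finrank_quotient_radHom_comm (hD : IsHomFinite k D) (hY : IsSplitLocal k Y) (E : D) :
    Module.finrank k ((Y ⟶ E) ⧸ radHom k Y E) = Module.finrank k ((E ⟶ Y) ⧸ radHom k E Y) := by
  obtain ⟨θ, hθ⟩ := hY.exists_residue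
  let B : (Y ⟶ E) →ₗ[k] (E ⟶ Y) →ₗ[k] k := (Linear.comp Y E Y).compr₂ θ
  have hB : ∀ a b, B a b = θ (a ≫ b) := fun _ _ => rfl
  have h1 : LinearMap.ker B = radHom k Y E := by
    ext a
    rw [LinearMap.mem_ker, mem_radHom_iff_comp_mem, LinearMap.ext_iff]
    exact forall_congr' fun b => by rw [hB, LinearMap.zero_apply, hθ]
  have h2 : LinearMap.ker B.flip = radHom k E Y := by
    ext a
    rw [LinearMap.mem_ker, mem_radHom_iff_comp_mem', LinearMap.ext_iff]
    exact forall_congr' fun b => by rw [LinearMap.flip_apply, hB, LinearMap.zero_apply, hθ]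
  have := hD E Y
  rw [← h1, ← h2]
  exact finrank_quotient_ker_eq_flip B

/-- Upper bound for the multiplicity of `Y` in a finite direct sum. -/
theorem finrank_quotient_radHom_le (hY : IsSplitLocal k Y) {E : D} {ι : Type*} [Fintype ι]
    {F : ι → D} (hF : ∀ i, IsSplitLocal k (F i)) (a : ∀ i, F i ⟶ E) (b : ∀ i, E ⟶ F i)
    (hab : ∑ i, b i ≫ a i = 𝟙 E) :
    Module.finrank k ((Y ⟶ E) ⧸ radHom k Y E) ≤ Nat.card {i // Nonempty (F i ≅ Y)} := by
  classical
  obtain ⟨θ, hθ⟩ := hY.exists_residue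
  let B : (Y ⟶ E) →ₗ[k] ({i // Nonempty (F i ≅ Y)} → k) := LinearMap.pi fun i =>
    θ ∘ₗ Linear.rightComp k Y (b i.1 ≫ i.2.some.hom)
  have hB : LinearMap.ker B ≤ radHom k Y E := fun h hh => by
    have h1 : h = ∑ i, (h ≫ b i) ≫ a i := by
      simp only [Category.assoc]
      rw [← Preadditive.comp_sum, hab, Category.comp_id]
    rw [h1]
    refine Submodule.sum_mem _ fun i _ => comp_mem_radHom_right ?_ _
    by_cases hi : Nonempty (F i ≅ Y)
    · have h2 : θ (h ≫ b i ≫ hi.some.hom) = 0 := congrFun (LinearMap.mem_ker.1 hh) ⟨i, hi⟩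
      rw [hθ] at h2
      simpa using comp_mem_radHom_right h2 hi.some.inv
    · exact (hY.mem_radHom_or_isIso (hF i) _).resolve_right fun h2 =>
        hi ⟨(asIso (h ≫ b i)).symm⟩
  have h3 : Module.finrank k ((Y ⟶ E) ⧸ LinearMap.ker B) ≤
      Nat.card {i // Nonempty (F i ≅ Y)} := by
    rw [B.quotKerEquivRange.finrank_eq, Nat.card_eq_fintype_card,
      ← Module.finrank_fintype_fun_eq_card k]
    exact Submodule.finrank_le _
  have : Module.Finite k ((Y ⟶ E) ⧸ LinearMap.ker B) :=
    Module.Finite.equiv B.quotKerEquivRange.symm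
  refine le_trans ?_ h3
  exact LinearMap.finrank_le_finrank_of_surjective (f := Submodule.factor hB)
    (Submodule.factor_surjective hB)

/-- A direct summand has positive multiplicity. -/
theorem finrank_quotient_radHom_ne_zero (hD : IsHomFinite k D) (hY : IsSplitLocal k Y) {E : D}
    (a : Y ⟶ E) (b : E ⟶ Y) (hab : a ≫ b = 𝟙 Y) :
    Module.finrank k ((Y ⟶ E) ⧸ radHom k Y E) ≠ 0 := by
  have := hD Y E
  have h1 : Submodule.Quotient.mk (p := radHom k Y E) a ≠ 0 := fun h => by
    rw [Submodule.Quotient.mk_eq_zero] at h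
    exact hY.id_notMem (hab ▸ comp_mem_radHom_right h b)
  have : Nontrivial ((Y ⟶ E) ⧸ radHom k Y E) := ⟨_, _, h1⟩
  exact Module.finrank_pos.ne'

end IsSplitLocal

/-- Irreducible maps to `X` are computed by a right almost split map. -/
theorem irrDim_eq_of_lift {L E X : D} (f : L ⟶ E) (g : E ⟶ X) (hf : f ∈ radHom k L E)
    (hg : g ∈ radHom k E X) (hker : ∀ (Y : D) (h : Y ⟶ E), h ≫ g = 0 → ∃ h', h' ≫ f = h)
    (hlift : ∀ (Y : D) (r : Y ⟶ X), r ∈ radHom k Y X → ∃ r', r' ≫ g = r) (Y : D) :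
    irrDim k Y X = Module.finrank k ((Y ⟶ E) ⧸ radHom k Y E) := by
  let Ψ : (Y ⟶ E) →ₗ[k] (radHom k Y X ⧸ (radSqHom k Y X).submoduleOf (radHom k Y X)) :=
    Submodule.mkQ _ ∘ₗ (Linear.rightComp k Y g).codRestrict (radHom k Y X)
      (fun h => comp_mem_radHom_left h hg)
  have hΨ : Function.Surjective Ψ := fun z => by
    obtain ⟨⟨r, hr⟩, rfl⟩ := Submodule.Quotient.mk_surjective _ z
    obtain ⟨r', rfl⟩ := hlift Y r hr
    exact ⟨r', rfl⟩
  have hsq : ∀ z ∈ radSqHom k Y X, ∃ h ∈ radHom k Y E, h ≫ g = z := fun z hz => by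
    induction hz using Submodule.span_induction with
    | mem z hz =>
      obtain ⟨Z, a, b, ha, hb, rfl⟩ := hz
      obtain ⟨b', rfl⟩ := hlift Z b hb
      exact ⟨a ≫ b', comp_mem_radHom_right ha b', Category.assoc _ _ _⟩
    | zero => exact ⟨0, Submodule.zero_mem _, zero_comp⟩
    | add x y _ _ hx hy =>
      obtain ⟨a, ha, rfl⟩ := hx
      obtain ⟨b, hb, rfl⟩ := hy
      exact ⟨a + b, Submodule.add_mem _ ha hb, Preadditive.add_comp _ _ _ _ _ _⟩
    | smul c x _ hx =>
      obtain ⟨a, ha, rfl⟩ := hx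
      exact ⟨c • a, Submodule.smul_mem _ _ ha, Linear.smul_comp _ _ _ _ _ _⟩
  have hk : LinearMap.ker Ψ = radHom k Y E := by
    ext h
    have h0 : Ψ h = 0 ↔ h ≫ g ∈ radSqHom k Y X := Submodule.Quotient.mk_eq_zero _
    rw [LinearMap.mem_ker, h0]
    constructor
    · intro hh
      obtain ⟨h', hh', h1⟩ := hsq _ hh
      obtain ⟨h'', h2⟩ := hker Y (h - h') (by rw [Preadditive.sub_comp, h1, sub_self])
      have h3 : h = h' + h'' ≫ f := by rw [h2]; abel
      rw [h3]
      exact Submodule.add_mem _ hh' (comp_mem_radHom_left _ hf)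
    · intro hh
      exact Submodule.subset_span ⟨E, h, g, hh, hg, rfl⟩
  rw [irrDim, ← hk]
  exact (Ψ.quotKerEquivOfSurjective hΨ).finrank_eq.symm

/-- Irreducible maps from `L` are computed by a left almost split map. -/
theorem irrDim_eq_of_extend {L E X : D} (f : L ⟶ E) (g : E ⟶ X) (hf : f ∈ radHom k L E)
    (hg : g ∈ radHom k E X) (hcoker : ∀ (Y : D) (h : E ⟶ Y), f ≫ h = 0 → ∃ h', g ≫ h' = h)
    (hext : ∀ (Y : D) (r : L ⟶ Y), r ∈ radHom k L Y → ∃ r', f ≫ r' = r) (Y : D) :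
    irrDim k L Y = Module.finrank k ((E ⟶ Y) ⧸ radHom k E Y) := by
  let Ψ : (E ⟶ Y) →ₗ[k] (radHom k L Y ⧸ (radSqHom k L Y).submoduleOf (radHom k L Y)) :=
    Submodule.mkQ _ ∘ₗ (Linear.leftComp k Y f).codRestrict (radHom k L Y)
      (fun h => comp_mem_radHom_right hf h)
  have hΨ : Function.Surjective Ψ := fun z => by
    obtain ⟨⟨r, hr⟩, rfl⟩ := Submodule.Quotient.mk_surjective _ z
    obtain ⟨r', rfl⟩ := hext Y r hr
    exact ⟨r', rfl⟩
  have hsq : ∀ z ∈ radSqHom k L Y, ∃ h ∈ radHom k E Y, f ≫ h = z := fun z hz => by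
    induction hz using Submodule.span_induction with
    | mem z hz =>
      obtain ⟨Z, a, b, ha, hb, rfl⟩ := hz
      obtain ⟨a', rfl⟩ := hext Z a ha
      exact ⟨a' ≫ b, comp_mem_radHom_left a' hb, (Category.assoc _ _ _).symm⟩
    | zero => exact ⟨0, Submodule.zero_mem _, comp_zero⟩
    | add x y _ _ hx hy =>
      obtain ⟨a, ha, rfl⟩ := hx
      obtain ⟨b, hb, rfl⟩ := hy
      exact ⟨a + b, Submodule.add_mem _ ha hb, Preadditive.comp_add _ _ _ _ _ _⟩
    | smul c x _ hx =>
      obtain ⟨a, ha, rfl⟩ := hx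
      exact ⟨c • a, Submodule.smul_mem _ _ ha, Linear.comp_smul _ _ _ _ _ _⟩
  have hk : LinearMap.ker Ψ = radHom k E Y := by
    ext h
    have h0 : Ψ h = 0 ↔ f ≫ h ∈ radSqHom k L Y := Submodule.Quotient.mk_eq_zero _
    rw [LinearMap.mem_ker, h0]
    constructor
    · intro hh
      obtain ⟨h', hh', h1⟩ := hsq _ hh
      obtain ⟨h'', h2⟩ := hcoker Y (h - h') (by rw [Preadditive.comp_sub, h1, sub_self])
      have h3 : h = h' + g ≫ h'' := by rw [h2]; abel
      rw [h3]
      exact Submodule.add_mem _ hh' (comp_mem_radHom_right hg _)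
    · intro hh
      exact Submodule.subset_span ⟨E, f, h, hf, hh, rfl⟩
  rw [irrDim, ← hk]
  exact (Ψ.quotKerEquivOfSurjective hΨ).finrank_eq.symm

end RadicalIdeal

section Bridge

open scoped ModuleCat

variable {k : Type w} [Field k] {A : Type v} [Ring A] [Algebra k A]

/-- A linear map as a morphism of finitely generated modules. -/
def fgHom {M N : FGModuleCat.{v} A} (f : M →ₗ[A] N) : M ⟶ N := ConcreteCategory.ofHom f

/-- The linear map underlying a morphism. -/
abbrev linMap {M N : FGModuleCat.{v} A} (f : M ⟶ N) : M →ₗ[A] N := f.hom.hom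

theorem fgModuleCat_isIso_iff_bijective {M N : FGModuleCat.{v} A} (f : M ⟶ N) :
    IsIso f ↔ Function.Bijective (linMap f) := by
  constructor
  · intro h
    have h1 : linMap (f ≫ inv f) = LinearMap.id := by rw [IsIso.hom_inv_id]; rfl
    have h2 : linMap (inv f ≫ f) = LinearMap.id := by rw [IsIso.inv_hom_id]; rfl
    exact Function.bijective_iff_has_inverse.2
      ⟨linMap (inv f), LinearMap.congr_fun h1, LinearMap.congr_fun h2⟩
  · intro h
    let e := LinearEquiv.ofBijective (linMap f) h
    exact ⟨fgHom e.symm.toLinearMap, FGModuleCat.hom_ext (LinearMap.ext e.symm_apply_apply),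
      FGModuleCat.hom_ext (LinearMap.ext e.apply_symm_apply)⟩

theorem fgModuleCat_isIso_iff_isUnit {M : FGModuleCat.{v} A} (f : M ⟶ M) :
    IsIso f ↔ IsUnit (linMap f : Module.End A M) := by
  rw [fgModuleCat_isIso_iff_bijective, Module.End.isUnit_iff]

/-- A linear equivalence as an isomorphism. -/
def fgIso {M N : FGModuleCat.{v} A} (e : M ≃ₗ[A] N) : M ≅ N where
  hom := fgHom e.toLinearMap
  inv := fgHom e.symm.toLinearMap
  hom_inv_id := FGModuleCat.hom_ext (LinearMap.ext e.symm_apply_apply)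
  inv_hom_id := FGModuleCat.hom_ext (LinearMap.ext e.apply_symm_apply)

theorem fgModuleCat_nonempty_iso_iff {M N : FGModuleCat.{v} A} :
    Nonempty (M ≅ N) ↔ Nonempty (M ≃ₗ[A] N) :=
  ⟨fun ⟨e⟩ => ⟨FGModuleCat.isoToLinearEquiv e⟩, fun ⟨e⟩ => ⟨fgIso e⟩⟩

theorem isHomFinite_fgModuleCat [FiniteDimensional k A] : IsHomFinite k (FGModuleCat.{v} A) := by
  intro M N
  have := finiteDimensional_of_finite k A M
  have := finiteDimensional_of_finite k A N
  have := finiteDimensional_linearMap k A M N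
  let F : (M ⟶ N) →ₗ[k] (M →ₗ[A] N) :=
    { toFun := linMap, map_add' := fun _ _ => rfl, map_smul' := fun _ _ => rfl }
  exact Module.Finite.of_injective F fun f g h => FGModuleCat.hom_ext h

theorem indecomposable_iff_isIndec (M : FGModuleCat.{v} A) :
    Indecomposable M.obj ↔ IsIndec A M := by
  constructor
  · rintro ⟨h0, h⟩
    have hnt : Nontrivial M := by
      by_contra hM
      rw [not_nontrivial_iff_subsingleton] at hM
      exact h0 (ModuleCat.isZero_of_subsingleton M.obj)
    refine ⟨hnt, fun e he => ?_⟩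
    have he' : ∀ x, e (e x) = e x := LinearMap.congr_fun he
    have hc : IsCompl (LinearMap.ker e) (LinearMap.range e) :=
      LinearMap.IsIdempotentElem.isCompl (f := e) he |>.symm
    have hiso : M.obj ≅ ModuleCat.of A (LinearMap.ker e) ⊞ ModuleCat.of A (LinearMap.range e) :=
      (Submodule.prodEquivOfIsCompl _ _ hc).symm.toModuleIso ≪≫
        (ModuleCat.biprodIsoProd (ModuleCat.of A (LinearMap.ker e))
          (ModuleCat.of A (LinearMap.range e))).symm
    rcases h _ _ hiso with h1 | h1
    · right
      have : Subsingleton (LinearMap.ker e) := ModuleCat.subsingleton_of_isZero h1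
      ext x
      have h2 : x - e x ∈ LinearMap.ker e := by simp [he']
      have h3 := congrArg Subtype.val (Subsingleton.elim (⟨_, h2⟩ : LinearMap.ker e) 0)
      exact (sub_eq_zero.1 h3).symm
    · left
      have : Subsingleton (LinearMap.range e) := ModuleCat.subsingleton_of_isZero h1
      ext x
      exact congrArg Subtype.val (Subsingleton.elim (⟨_, x, rfl⟩ : LinearMap.range e) 0)
  · rintro ⟨h0, h⟩
    refine ⟨fun hz => ?_, fun Y Z e => ?_⟩
    · have := ModuleCat.subsingleton_of_isZero hz
      exact not_subsingleton M this
    · let ε : M.obj ⟶ M.obj := e.hom ≫ biprod.fst ≫ biprod.inl ≫ e.inv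
      have hε : ε ≫ ε = ε := by simp [ε]
      rcases h ε.hom (congrArg ModuleCat.Hom.hom hε) with h1 | h1
      · left
        have h2 : ε = 0 := ModuleCat.hom_ext h1
        rw [IsZero.iff_id_eq_zero]
        have h3 : biprod.inl ≫ e.inv ≫ ε ≫ e.hom ≫ biprod.fst = 𝟙 Y := by simp [ε]
        rw [← h3, h2]
        simp
      · right
        have h2 : ε = 𝟙 _ := ModuleCat.hom_ext h1
        rw [IsZero.iff_id_eq_zero]
        have h3 : biprod.inr ≫ e.inv ≫ ε ≫ e.hom ≫ biprod.snd = 𝟙 Z := by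
          rw [h2]; simp
        rw [← h3]
        simp [ε]

theorem mem_radHom_iff_isUnit {M N : FGModuleCat.{v} A} (f : M ⟶ N) :
    f ∈ radHom k M N ↔ ∀ g : N →ₗ[A] M, IsUnit (1 - g ∘ₗ linMap f : Module.End A M) := by
  constructor
  · intro h g
    exact (fgModuleCat_isIso_iff_isUnit _).1 (h (fgHom g))
  · intro h g
    exact (fgModuleCat_isIso_iff_isUnit _).2 (h (linMap g))

/-- A map from an indecomposable module is radical if and only if it is not a split
monomorphism. -/
theorem IsIndec.mem_radHom_iff [IsArtinianRing A] {M N : FGModuleCat.{v} A} (hM : IsIndec A M)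
    (f : M ⟶ N) : f ∈ radHom k M N ↔ ∀ s : N →ₗ[A] M, s ∘ₗ linMap f ≠ LinearMap.id := by
  have := hM.1
  rw [mem_radHom_iff_isUnit]
  constructor
  · intro h s hs
    have := h s
    rw [hs] at this
    change IsUnit (1 - 1 : Module.End A M) at this
    simp at this
  · intro h g
    have h1 : IsUnit ((1 - g ∘ₗ linMap f : Module.End A M) + g ∘ₗ linMap f) := by
      rw [sub_add_cancel]; exact isUnit_one
    refine (hM.isUnit_or_isUnit_of_add h1).resolve_right ?_
    rintro ⟨u, hu⟩
    refine h ((↑u⁻¹ : Module.End A M) ∘ₗ g) ?_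
    rw [LinearMap.comp_assoc, ← hu]
    exact Units.inv_mul u

/-- A map to an indecomposable module is radical if and only if it is not a split epimorphism. -/
theorem IsIndec.mem_radHom_iff' [IsArtinianRing A] {M N : FGModuleCat.{v} A} (hN : IsIndec A N)
    (f : M ⟶ N) : f ∈ radHom k M N ↔ ∀ s : N →ₗ[A] M, linMap f ∘ₗ s ≠ LinearMap.id := by
  rw [mem_radHom_iff_comp_mem']
  constructor
  · intro h s hs
    exact (hN.mem_radHom_iff (k := k) _).1 (h (fgHom s)) LinearMap.id hs
  · intro h g
    rw [hN.mem_radHom_iff]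
    intro s hs
    have := hN.1
    obtain ⟨h1, h2⟩ := hN.bijective_of_isUnit_comp (linMap (g ≫ f)) s (by
      rw [hs]; exact isUnit_one)
    let e := LinearEquiv.ofBijective _ h1
    refine h (linMap g ∘ₗ e.symm.toLinearMap) (LinearMap.ext fun x => ?_)
    exact e.apply_symm_apply x

theorem IsIndec.isSplitLocal [IsAlgClosed k] [FiniteDimensional k A] {M : FGModuleCat.{v} A}
    (hM : IsIndec A M) : IsSplitLocal k M := by
  have : IsArtinianRing A := IsArtinianRing.of_finite k A
  have := hM.1
  refine ⟨fun h => (hM.mem_radHom_iff (k := k) (𝟙 M)).1 h LinearMap.id rfl, fun u => ?_⟩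
  have := finiteDimensional_of_finite k A M
  obtain ⟨c, hc⟩ := Module.End.exists_eigenvalue ((linMap u).restrictScalars k)
  obtain ⟨x, hx⟩ := hc.exists_hasEigenvector
  refine ⟨c, (hM.mem_radHom_iff _).2 fun s hs => hx.2 ?_⟩
  have h1 : linMap (u - c • 𝟙 M) x = linMap u x - c • x := rfl
  have h2 : linMap u x = c • x := hx.apply_eq_smul
  have h3 := LinearMap.congr_fun hs x
  rw [LinearMap.comp_apply, h1, h2, sub_self, map_zero] at h3
  exact h3.symm

section AlmostSplit

variable {L E X : FGModuleCat.{v} A} {a : L →ₗ[A] E} {b : E →ₗ[A] X}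

theorem IsAlmostSplit.left_mem_radHom [IsArtinianRing A] (h : IsAlmostSplit a b)
    (hL : IsIndec A L) : fgHom a ∈ radHom k L E := by
  rw [hL.mem_radHom_iff]
  intro s hs
  obtain ⟨r, hr⟩ := exists_comp_eq_of_surjective b h.surjective (LinearMap.id - a ∘ₗ s)
    fun x hx => by
      obtain ⟨y, rfl⟩ := (h.exact x).1 hx
      have : s (a y) = y := LinearMap.congr_fun hs y
      simp [this]
  refine h.not_split r ?_
  ext x
  obtain ⟨y, rfl⟩ := h.surjective x
  have h1 : r (b y) = y - a (s y) := LinearMap.congr_fun hr y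
  simp [h1, h.exact.apply_apply_eq_zero]

theorem IsAlmostSplit.right_mem_radHom [IsArtinianRing A] (h : IsAlmostSplit a b)
    (hX : IsIndec A X) : fgHom b ∈ radHom k E X := by
  rw [hX.mem_radHom_iff']
  exact h.not_split

theorem IsAlmostSplit.irrDim_right [IsArtinianRing A] (h : IsAlmostSplit a b) (hL : IsIndec A L)
    (hX : IsIndec A X) (Y : FGModuleCat.{v} A) :
    irrDim k Y X = Module.finrank k ((Y ⟶ E) ⧸ radHom k Y E) :=
  irrDim_eq_of_lift (fgHom a) (fgHom b) (h.left_mem_radHom hL) (h.right_mem_radHom hX)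
    (fun Y r hr => by
      obtain ⟨r', hr'⟩ := exists_comp_eq_of_injective a h.injective (linMap r) fun y =>
        (h.exact _).1 (LinearMap.congr_fun (congrArg linMap hr) y)
      exact ⟨fgHom r', FGModuleCat.hom_ext hr'⟩)
    (fun Y r hr => by
      obtain ⟨r', hr'⟩ := h.lift Y (linMap r) ((hX.mem_radHom_iff' r).1 hr)
      exact ⟨fgHom r', FGModuleCat.hom_ext hr'⟩) Y

theorem IsAlmostSplit.irrDim_left [IsArtinianRing A] (h : IsAlmostSplit a b) (hL : IsIndec A L)
    (hX : IsIndec A X) (Y : FGModuleCat.{v} A) :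
    irrDim k L Y = Module.finrank k ((E ⟶ Y) ⧸ radHom k E Y) :=
  irrDim_eq_of_extend (fgHom a) (fgHom b) (h.left_mem_radHom hL) (h.right_mem_radHom hX)
    (fun Y r hr => by
      obtain ⟨r', hr'⟩ := exists_comp_eq_of_surjective b h.surjective (linMap r) fun x hx => by
        obtain ⟨y, rfl⟩ := (h.exact x).1 hx
        exact LinearMap.congr_fun (congrArg linMap hr) y
      exact ⟨fgHom r', FGModuleCat.hom_ext hr'⟩)
    (fun Y r hr => by
      obtain ⟨r', hr'⟩ := h.extend Y (linMap r) ((hL.mem_radHom_iff r).1 hr)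
      exact ⟨fgHom r', FGModuleCat.hom_ext hr'⟩) Y

/-- The valuation of the Auslander-Reiten quiver: irreducible maps `Y → X` and `τ X → Y`. -/
theorem IsAlmostSplit.irrDim_eq [IsAlgClosed k] [FiniteDimensional k A] (h : IsAlmostSplit a b)
    (hL : IsIndec A L) (hX : IsIndec A X) {Y : FGModuleCat.{v} A} (hY : IsIndec A Y) :
    irrDim k Y X = irrDim k L Y := by
  have : IsArtinianRing A := IsArtinianRing.of_finite k A
  rw [h.irrDim_right hL hX, h.irrDim_left hL hX,
    hY.isSplitLocal.finrank_quotient_radHom_comm isHomFinite_fgModuleCat]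

/-- The middle term of an almost split sequence contains each module with its multiplicity. -/
theorem IsAlmostSplit.sum_irrDim_mul_finrank_le [IsAlgClosed k] [FiniteDimensional k A]
    (h : IsAlmostSplit a b) (hL : IsIndec A L) (hX : IsIndec A X) {σ : Type*} (s : Finset σ)
    (Y : σ → FGModuleCat.{v} A) (hY : ∀ j, IsIndec A (Y j))
    (hne : ∀ j j', Nonempty (Y j ≅ Y j') → j = j') :
    ∑ j ∈ s, irrDim k (Y j) X * Module.finrank k (Y j) ≤
      Module.finrank k L + Module.finrank k X := by
  classical
  have : IsArtinianRing A := IsArtinianRing.of_finite k A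
  have hfd := fun M : FGModuleCat.{v} A => finiteDimensional_of_finite k A M
  obtain ⟨ι, _, F, e, inc, prj, hF, -, -, hsum⟩ := exists_decomposition_maps (A := A) E
  have hsum' : ∑ i, fgHom (prj i) ≫ fgHom (inc i) = 𝟙 E := by
    apply FGModuleCat.hom_ext
    refine Eq.trans ?_ hsum
    exact map_sum (AddMonoidHom.mk' (fun f : E ⟶ E => linMap f) fun _ _ => rfl) _ _
  have hE : Module.finrank k E = Module.finrank k L + Module.finrank k X := by
    have h1 := LinearMap.finrank_range_add_finrank_ker (b.restrictScalars k)
    have h2 := LinearMap.finrank_range_add_finrank_ker (a.restrictScalars k)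
    have h3 : LinearMap.ker (b.restrictScalars k) = LinearMap.range (a.restrictScalars k) := by
      ext x
      exact h.exact x
    have h4 : LinearMap.ker (a.restrictScalars k) = ⊥ := LinearMap.ker_eq_bot.2 h.injective
    have h5 : LinearMap.range (b.restrictScalars k) = ⊤ := LinearMap.range_eq_top.2 h.surjective
    rw [h4, finrank_bot, add_zero] at h2
    rw [h3, h2, h5, finrank_top] at h1
    rw [← h1, add_comm]
  have hEF : Module.finrank k E = ∑ i, Module.finrank k (F i) := by
    rw [← Module.finrank_pi_fintype]
    exact (e.restrictScalars k).finrank_eq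
  rw [← hE, hEF]
  calc ∑ j ∈ s, irrDim k (Y j) X * Module.finrank k (Y j)
      ≤ ∑ j ∈ s, ∑ i with Nonempty (F i ≅ Y j), Module.finrank k (F i) := by
        refine Finset.sum_le_sum fun j _ => ?_
        have h1 : ∀ i ∈ Finset.univ.filter (fun i => Nonempty (F i ≅ Y j)),
            Module.finrank k (F i) = Module.finrank k (Y j) := fun i hi => by
          obtain ⟨u⟩ := fgModuleCat_nonempty_iso_iff.1 (Finset.mem_filter.1 hi).2
          exact (u.restrictScalars k).finrank_eq
        rw [Finset.sum_congr rfl h1, Finset.sum_const, smul_eq_mul]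
        refine Nat.mul_le_mul_right _ ?_
        rw [h.irrDim_right hL hX]
        refine ((hY j).isSplitLocal.finrank_quotient_radHom_le (fun i => (hF i).isSplitLocal)
          (fun i => fgHom (inc i)) (fun i => fgHom (prj i)) hsum').trans ?_
        rw [Nat.card_eq_fintype_card, Fintype.card_subtype]
    _ = ∑ i ∈ s.biUnion fun j => Finset.univ.filter fun i => Nonempty (F i ≅ Y j),
          Module.finrank k (F i) := by
        refine (Finset.sum_biUnion fun j _ j' _ hjj' => ?_).symm
        rw [Function.onFun, Finset.disjoint_left]
        intro i hi hi'
        obtain ⟨u⟩ := (Finset.mem_filter.1 hi).2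
        obtain ⟨u'⟩ := (Finset.mem_filter.1 hi').2
        exact hjj' (hne j j' ⟨u.symm ≪≫ u'⟩)
    _ ≤ ∑ i, Module.finrank k (F i) :=
        Finset.sum_le_sum_of_subset (Finset.subset_univ _)

end AlmostSplit

end Bridge

section HaradaSai

open scoped ModuleCat

variable {k : Type w} [Field k] {A : Type v} [Ring A] [Algebra k A]

/-- Composites of `n` nonisomorphisms between modules in the class `U`. -/
inductive NonisoChain (U : FGModuleCat.{v} A → Prop) :
    ℕ → ∀ {M N : FGModuleCat.{v} A}, (M →ₗ[A] N) → Prop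
  | nil {M : FGModuleCat.{v} A} (hM : U M) : NonisoChain U 0 (LinearMap.id : M →ₗ[A] M)
  | snoc {n : ℕ} {M N L : FGModuleCat.{v} A} {c : M →ₗ[A] N} (hc : NonisoChain U n c)
      (f : N →ₗ[A] L) (hf : ¬ Function.Bijective f) (hL : U L) : NonisoChain U (n + 1) (f ∘ₗ c)

theorem NonisoChain.target_mem {U : FGModuleCat.{v} A → Prop} {n : ℕ} {M N : FGModuleCat.{v} A}
    {c : M →ₗ[A] N} (hc : NonisoChain U n c) : U N := by
  cases hc <;> assumption

theorem NonisoChain.split {U : FGModuleCat.{v} A → Prop} (m : ℕ) {n : ℕ}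
    {M N : FGModuleCat.{v} A} {c : M →ₗ[A] N} (hc : NonisoChain U (m + n) c) :
    ∃ (K : FGModuleCat.{v} A) (c₁ : M →ₗ[A] K) (c₂ : K →ₗ[A] N), U K ∧ NonisoChain U m c₁ ∧
      NonisoChain U n c₂ ∧ c = c₂ ∘ₗ c₁ := by
  induction n generalizing N with
  | zero =>
    have hN : U N := hc.target_mem
    exact ⟨N, c, LinearMap.id, hN, hc, .nil hN, rfl⟩
  | succ n ih =>
    rw [← add_assoc] at hc
    cases hc with
    | snoc hc f hf hL =>
      obtain ⟨K, c₁, c₂, hK, h₁, h₂, rfl⟩ := ih hc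
      exact ⟨K, c₁, f ∘ₗ c₂, hK, h₁, .snoc h₂ f hf hL, rfl⟩

/-- Restricting to the image of `g` a map `h` of the same rank as `h ∘ g`. -/
theorem isCompl_range_ker_of_finrank {k V W Z : Type*} [Field k] [AddCommGroup V] [Module k V]
    [AddCommGroup W] [Module k W] [FiniteDimensional k W] [AddCommGroup Z] [Module k Z]
    (g : V →ₗ[k] W) (h : W →ₗ[k] Z)
    (h₁ : Module.finrank k (LinearMap.range (h ∘ₗ g)) = Module.finrank k (LinearMap.range g))
    (h₂ : Module.finrank k (LinearMap.range (h ∘ₗ g)) = Module.finrank k (LinearMap.range h)) :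
    IsCompl (LinearMap.range g) (LinearMap.ker h) := by
  have h3 := LinearMap.finrank_range_add_finrank_ker (h ∘ₗ (LinearMap.range g).subtype)
  have h4 : LinearMap.range (h ∘ₗ (LinearMap.range g).subtype) = LinearMap.range (h ∘ₗ g) := by
    rw [LinearMap.range_comp, LinearMap.range_comp, Submodule.range_subtype]
  rw [h4, h₁] at h3
  have h5 : LinearMap.ker (h ∘ₗ (LinearMap.range g).subtype) = ⊥ :=
    Submodule.finrank_eq_zero.1 (by omega)
  have hdisj : Disjoint (LinearMap.range g) (LinearMap.ker h) := by
    rw [Submodule.disjoint_def]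
    intro x hx hx'
    have : (⟨x, hx⟩ : LinearMap.range g) ∈ LinearMap.ker (h ∘ₗ (LinearMap.range g).subtype) := hx'
    rw [h5, Submodule.mem_bot] at this
    exact congrArg Subtype.val this
  refine ⟨hdisj, codisjoint_iff.2 (Submodule.eq_top_of_finrank_eq ?_)⟩
  have h6 := Submodule.finrank_sup_add_finrank_inf_eq (LinearMap.range g) (LinearMap.ker h)
  have h7 := LinearMap.finrank_range_add_finrank_ker h
  rw [disjoint_iff.1 hdisj, finrank_bot] at h6
  omega

theorem IsIndec.eq_bot_or_eq_bot_of_isCompl_restrictScalars {M : FGModuleCat.{v} A}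
    (hM : IsIndec A M) {p q : Submodule A M}
    (h : IsCompl (p.restrictScalars k) (q.restrictScalars k)) : p = ⊥ ∨ q = ⊥ := by
  refine hM.eq_bot_or_eq_bot ⟨?_, ?_⟩
  · rw [Submodule.disjoint_def]
    exact fun x hx hx' => Submodule.disjoint_def.1 h.1 x hx hx'
  · rw [codisjoint_iff, eq_top_iff]
    intro x _
    have hx : x ∈ p.restrictScalars k ⊔ q.restrictScalars k := by
      rw [codisjoint_iff.1 h.2]; trivial
    obtain ⟨y, hy, z, hz, rfl⟩ := Submodule.mem_sup.1 hx
    exact Submodule.add_mem_sup hy hz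

/-- The Harada-Sai lemma. -/
theorem NonisoChain.finrank_range_le [FiniteDimensional k A] {U : FGModuleCat.{v} A → Prop} {b : ℕ}
    (hU : ∀ M, U M → IsIndec A M ∧ Module.finrank k M ≤ b) (m : ℕ) {M N : FGModuleCat.{v} A}
    {c : M →ₗ[A] N} (hc : NonisoChain U (2 ^ m - 1) c) :
    Module.finrank k (LinearMap.range (c.restrictScalars k)) ≤ b - m := by
  have hfd := fun M : FGModuleCat.{v} A => finiteDimensional_of_finite k A M
  have hN : U N := hc.target_mem
  induction m generalizing M N with
  | zero => exact (Submodule.finrank_le _).trans (hU N hN).2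
  | succ m ih =>
    have hpow : 2 ^ (m + 1) - 1 = (2 ^ m - 1) + 1 + (2 ^ m - 1) := by
      have := Nat.one_le_two_pow (n := m)
      omega
    rw [hpow] at hc
    obtain ⟨K, c₁, c₂, hK, h₁, h₂, rfl⟩ := hc.split
    cases h₁ with
    | @snoc _ _ J _ c₁ h₁ f hf _ =>
    have hJ : U J := h₁.target_mem
    by_contra! hlt
    have hc₁ := ih h₁ hJ
    have hc₂ := ih h₂ hN
    have key : ∀ {V₁ V₂ V₃ : FGModuleCat.{v} A} (g : V₁ →ₗ[A] V₂) (h : V₂ →ₗ[A] V₃),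
        Module.finrank k (LinearMap.range ((h ∘ₗ g).restrictScalars k)) ≤
          Module.finrank k (LinearMap.range (h.restrictScalars k)) ∧
        Module.finrank k (LinearMap.range ((h ∘ₗ g).restrictScalars k)) ≤
          Module.finrank k (LinearMap.range (g.restrictScalars k)) := by
      intro V₁ V₂ V₃ g h
      constructor
      · apply Submodule.finrank_mono
        rintro _ ⟨x, rfl⟩
        exact ⟨g x, rfl⟩
      · change Module.finrank k (LinearMap.range (h.restrictScalars k ∘ₗ g.restrictScalars k)) ≤ _
        rw [LinearMap.range_comp]
        exact Submodule.finrank_map_le _ _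
    have k₁ := key c₁ (c₂ ∘ₗ f)
    have k₂ := key (f ∘ₗ c₁) c₂
    have k₃ := key f c₂
    have k₄ := key c₁ f
    have e₀ : (c₂ ∘ₗ f) ∘ₗ c₁ = c₂ ∘ₗ (f ∘ₗ c₁) := rfl
    rw [e₀] at k₁
    have hJ' := isCompl_range_ker_of_finrank (c₁.restrictScalars k) ((c₂ ∘ₗ f).restrictScalars k)
      (by change Module.finrank k (LinearMap.range ((c₂ ∘ₗ (f ∘ₗ c₁)).restrictScalars k)) = _
          omega)
      (by change Module.finrank k (LinearMap.range ((c₂ ∘ₗ (f ∘ₗ c₁)).restrictScalars k)) = _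
          omega)
    have hK' := isCompl_range_ker_of_finrank ((f ∘ₗ c₁).restrictScalars k) (c₂.restrictScalars k)
      (by change Module.finrank k (LinearMap.range ((c₂ ∘ₗ (f ∘ₗ c₁)).restrictScalars k)) = _
          omega)
      (by change Module.finrank k (LinearMap.range ((c₂ ∘ₗ (f ∘ₗ c₁)).restrictScalars k)) = _
          omega)
    have hbot : ∀ {V₁ V₂ : FGModuleCat.{v} A} (g : V₁ →ₗ[A] V₂),
        0 < Module.finrank k (LinearMap.range (g.restrictScalars k)) → LinearMap.range g ≠ ⊥ := by
      intro V₁ V₂ g hg h0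
      have : g = 0 := LinearMap.range_eq_bot.1 h0
      subst this
      have : LinearMap.range ((0 : V₁ →ₗ[A] V₂).restrictScalars k) = ⊥ :=
        LinearMap.range_eq_bot.2 rfl
      rw [this, finrank_bot] at hg
      exact lt_irrefl _ hg
    have hJk : LinearMap.ker (c₂ ∘ₗ f) = ⊥ :=
      ((hU J hJ).1.eq_bot_or_eq_bot_of_isCompl_restrictScalars (k := k)
        (p := LinearMap.range c₁) (q := LinearMap.ker (c₂ ∘ₗ f)) hJ').resolve_left
        (hbot c₁ (by omega))
    have hKk : LinearMap.ker c₂ = ⊥ :=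
      ((hU K hK).1.eq_bot_or_eq_bot_of_isCompl_restrictScalars (k := k)
        (p := LinearMap.range (f ∘ₗ c₁)) (q := LinearMap.ker c₂) hK').resolve_left
        (hbot (f ∘ₗ c₁) (by omega))
    refine hf ⟨?_, ?_⟩
    · have : Function.Injective (c₂ ∘ₗ f) := LinearMap.ker_eq_bot.1 hJk
      exact Function.Injective.of_comp this
    · have h3 := codisjoint_iff.1 hK'.2
      have h4 : LinearMap.ker (c₂.restrictScalars k) = ⊥ :=
        (LinearMap.ker_eq_bot (f := c₂.restrictScalars k)).2 fun x y hxy =>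
          LinearMap.ker_eq_bot.1 hKk hxy
      rw [h4, sup_bot_eq, LinearMap.range_eq_top] at h3
      exact Function.Surjective.of_comp h3

theorem NonisoChain.eq_zero [FiniteDimensional k A] {U : FGModuleCat.{v} A → Prop} {b : ℕ}
    (hU : ∀ M, U M → IsIndec A M ∧ Module.finrank k M ≤ b) {M N : FGModuleCat.{v} A}
    {c : M →ₗ[A] N} (hc : NonisoChain U (2 ^ b - 1) c) : c = 0 := by
  have hfd := fun M : FGModuleCat.{v} A => finiteDimensional_of_finite k A M
  have h := hc.finrank_range_le (k := k) hU
  rw [Nat.sub_self, Nat.le_zero, Submodule.finrank_eq_zero, LinearMap.range_eq_bot] at h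
  exact LinearMap.ext fun x => LinearMap.congr_fun h x

end HaradaSai

section Auslander

open scoped ModuleCat

variable {k : Type w} [Field k] {A : Type v} [Ring A] [Algebra k A]

/-- A class of modules is closed under predecessors: each of its members `M` has a right almost
split map from a finite direct sum of members. -/
def IsPredClosed (U : FGModuleCat.{v} A → Prop) : Prop :=
  ∀ M, U M → ∃ (ι : Type) (_ : Fintype ι) (F : ι → FGModuleCat.{v} A) (g : ∀ i, F i →ₗ[A] M),
    (∀ i, U (F i)) ∧ (∀ i, ¬ Function.Bijective (g i)) ∧
    ∀ (N : FGModuleCat.{v} A) (r : N →ₗ[A] M), IsIndec A N → ¬ Function.Bijective r →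
      ∃ r' : ∀ i, N →ₗ[A] F i, r = ∑ i, g i ∘ₗ r' i

theorem IsPredClosed.exists_finite_or_chain {U : FGModuleCat.{v} A → Prop} (h : IsPredClosed U)
    (n : ℕ) (M : FGModuleCat.{v} A) (hM : U M) :
    ∃ R : Set (FGModuleCat.{v} A), R.Finite ∧ (∀ V ∈ R, U V) ∧
      ∀ (N W : FGModuleCat.{v} A) (r : N →ₗ[A] M) (d : M →ₗ[A] W), IsIndec A N → d ∘ₗ r ≠ 0 →
        (∃ V ∈ R, Nonempty (N ≅ V)) ∨
        ∃ (V : FGModuleCat.{v} A) (c : V →ₗ[A] M) (f : N →ₗ[A] V), NonisoChain U n c ∧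
          d ∘ₗ c ∘ₗ f ≠ 0 := by
  induction n generalizing M with
  | zero =>
    exact ⟨∅, Set.finite_empty, fun V hV => hV.elim, fun N W r d _ hr =>
      Or.inr ⟨M, LinearMap.id, r, .nil hM, hr⟩⟩
  | succ n ih =>
    obtain ⟨ι, _, F, g, hF, hg, hr⟩ := h M hM
    choose R hRf hRU hR using fun i => ih (F i) (hF i)
    refine ⟨{M} ∪ ⋃ i, R i, (Set.finite_singleton M).union (Set.finite_iUnion hRf), ?_, ?_⟩
    · rintro V (rfl | hV)
      · exact hM
      · obtain ⟨i, hi⟩ := Set.mem_iUnion.1 hV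
        exact hRU i V hi
    · intro N W r d hN hdr
      by_cases hb : Function.Bijective r
      · exact Or.inl ⟨M, Or.inl rfl, ⟨fgIso (LinearEquiv.ofBijective r hb)⟩⟩
      · obtain ⟨r', hr'⟩ := hr N r hN hb
        obtain ⟨i, hi⟩ : ∃ i, (d ∘ₗ g i) ∘ₗ r' i ≠ 0 := by
          by_contra! hall
          apply hdr
          rw [hr']
          ext x
          simp only [LinearMap.comp_apply, LinearMap.sum_apply, map_sum, LinearMap.zero_apply]
          exact Finset.sum_eq_zero fun i _ => LinearMap.congr_fun (hall i) x
        rcases hR i N W (r' i) (d ∘ₗ g i) hN hi with ⟨V, hV, hNV⟩ | ⟨V, c, f, hc, hne⟩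
        · exact Or.inl ⟨V, Or.inr (Set.mem_iUnion.2 ⟨i, hV⟩), hNV⟩
        · exact Or.inr ⟨V, g i ∘ₗ c, f, .snoc hc (g i) (hg i) hM, hne⟩

/-- Only finitely many indecomposable modules map to a module in a class of bounded length that is
closed under predecessors, and they belong to the class. -/
theorem IsPredClosed.exists_finite [FiniteDimensional k A] {U : FGModuleCat.{v} A → Prop}
    (h : IsPredClosed U) {b : ℕ} (hU : ∀ M, U M → IsIndec A M ∧ Module.finrank k M ≤ b)
    (M : FGModuleCat.{v} A) (hM : U M) :
    ∃ R : Set (FGModuleCat.{v} A), R.Finite ∧ (∀ V ∈ R, U V) ∧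
      ∀ (N : FGModuleCat.{v} A) (r : N →ₗ[A] M), IsIndec A N → r ≠ 0 →
        ∃ V ∈ R, Nonempty (N ≅ V) := by
  obtain ⟨R, hR, hRU, H⟩ := h.exists_finite_or_chain (2 ^ b - 1) M hM
  refine ⟨R, hR, hRU, fun N r hN hr => ?_⟩
  rcases H N M r LinearMap.id hN hr with h1 | ⟨V, c, f, hc, hne⟩
  · exact h1
  · exfalso
    apply hne
    rw [hc.eq_zero (k := k) hU]
    rfl

/-- Auslander's theorem: over a symmetric algebra, a class of indecomposable modules of bounded
length that is closed under predecessors only meets blocks of finite representation type. -/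
theorem IsPredClosed.not_blockIsRepInfinite (hA : IsSymmetricFDAlgebra k A)
    {U : FGModuleCat.{v} A → Prop}
    (h : IsPredClosed U) {b : ℕ} (hU : ∀ M, U M → IsIndec A M ∧ Module.finrank k M ≤ b)
    (X : FGModuleCat.{v} A) (hX : U X) : ¬ BlockIsRepInfinite X := by
  classical
  have hart := hA.isArtinianRing
  obtain ⟨_, t, ht, hn⟩ := hA
  choose! R hRf hRU hR using fun M hM => h.exists_finite (k := k) hU M hM
  obtain ⟨ι, _, P, -, inc, prj, hP, hpi, hpi0, hsum⟩ := exists_decomposition_maps (A := A) A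
  have hproj : ∀ i, Module.Projective A (P i) := fun i =>
    Module.Projective.of_split (inc i) (prj i) (hpi i)
  let J : Finset ι := Finset.univ.filter fun i => ∃ M, U M ∧ Nonempty (P i ≅ M)
  have hJ : ∀ i, i ∈ J ↔ ∃ M, U M ∧ Nonempty (P i ≅ M) := fun i => by simp [J]
  have hmem : ∀ (M N : FGModuleCat.{v} A) (r : N →ₗ[A] M), U M → IsIndec A N → r ≠ 0 →
      ∃ V, U V ∧ Nonempty (N ≅ V) := fun M N r hM hN hr => by
    obtain ⟨V, hV, hNV⟩ := hR M hM N r hN hr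
    exact ⟨V, hRU M hM V hV, hNV⟩
  have hzero : ∀ i j, i ∈ J → j ∉ J → ∀ f : P j →ₗ[A] P i, f = 0 := fun i j hi hj f => by
    obtain ⟨M, hM, ⟨e⟩⟩ := (hJ i).1 hi
    by_contra hf
    refine hj ((hJ j).2 (hmem M (P j) ((FGModuleCat.isoToLinearEquiv e).toLinearMap ∘ₗ f) hM (hP j)
      fun h0 => hf ?_))
    ext x
    have := LinearMap.congr_fun h0 x
    simpa using this
  have hzero' : ∀ i j, i ∈ J → j ∉ J → ∀ f : P i →ₗ[A] P j, f = 0 := fun i j hi hj f => by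
    obtain ⟨Tr, hTr⟩ := exists_isTraceForm (k := k) ht (P i)
    refine hTr.eq_zero_of_right ht hn f fun g => ?_
    rw [hzero i j hi hj g, LinearMap.zero_comp, map_zero]
  let π : Module.End A A := ∑ i ∈ J, inc i ∘ₗ prj i
  have hπ : ∀ x, π x = ∑ i ∈ J, inc i (prj i x) := fun x => by simp [π]
  let c : A := π 1
  have hπc : ∀ a, π a = a * c := fun a => by
    rw [← smul_eq_mul a c, ← map_smul, smul_eq_mul, mul_one]
  have hππ : ∀ x, π (π x) = π x := fun x => by
    rw [hπ (π x)]
    conv_rhs => rw [hπ x]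
    refine Finset.sum_congr rfl fun i hi => ?_
    rw [hπ, map_sum, Finset.sum_eq_single i]
    · have := LinearMap.congr_fun (hpi i) (prj i x)
      simp only [LinearMap.comp_apply, LinearMap.id_apply] at this
      rw [this]
    · intro j _ hji
      exact LinearMap.congr_fun (hpi0 j i hji) (prj j x)
    · exact fun h => (h hi).elim
  have hid : ∀ x, ∑ i, inc i (prj i x) = x := fun x => by
    have := LinearMap.congr_fun hsum x
    simpa using this
  have hsplit : ∀ x, π x + ∑ i ∈ Jᶜ, inc i (prj i x) = x := fun x => by
    rw [hπ, Finset.sum_add_sum_compl, hid]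
  have hcomm : ∀ (f : Module.End A A) x, π (f x) = f (π x) := fun f x => by
    have h1 : π (f (∑ i ∈ Jᶜ, inc i (prj i x))) = 0 := by
      rw [map_sum, map_sum]
      refine Finset.sum_eq_zero fun j hj => ?_
      rw [hπ]
      refine Finset.sum_eq_zero fun i hi => ?_
      have := LinearMap.congr_fun (hzero i j hi (Finset.mem_compl.1 hj)
        (prj i ∘ₗ f ∘ₗ inc j)) (prj j x)
      simp only [LinearMap.comp_apply, LinearMap.zero_apply] at this
      rw [this, map_zero]
    have h2 : ∑ j ∈ Jᶜ, inc j (prj j (f (π x))) = 0 := by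
      refine Finset.sum_eq_zero fun j hj => ?_
      rw [hπ, map_sum, map_sum]
      rw [Finset.sum_eq_zero, map_zero]
      intro i hi
      exact LinearMap.congr_fun (hzero' i j hi (Finset.mem_compl.1 hj)
        (prj j ∘ₗ f ∘ₗ inc i)) (prj i x)
    have h3 := hsplit (f (π x))
    rw [h2, add_zero] at h3
    conv_lhs => rw [← hsplit x]
    rw [map_add, map_add, h1, add_zero, h3]
  have hcentral : c ∈ Subring.center A := Subring.mem_center_iff.2 fun a => by
    have := hcomm (LinearMap.toSpanSingleton A A a) 1
    simp only [LinearMap.toSpanSingleton_apply, smul_eq_mul, one_mul] at this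
    rw [← hπc, this]
  have hidem : IsIdempotentElem c := by
    rw [IsIdempotentElem, ← hπc]
    exact hππ 1
  intro hinf
  refine hinf c hcentral hidem (fun x => ?_) ?_
  · have h1 := congrArg (fun a : A => a • x) (hsplit 1)
    simp only [add_smul, one_smul] at h1
    have h2 : (∑ i ∈ Jᶜ, inc i (prj i 1)) • x = 0 := by
      rw [Finset.sum_smul]
      refine Finset.sum_eq_zero fun j hj => ?_
      by_contra hne
      refine Finset.mem_compl.1 hj ((hJ j).2 (hmem X (P j)
        (LinearMap.toSpanSingleton A X x ∘ₗ inc j) hX (hP j) fun h0 => hne ?_))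
      exact LinearMap.congr_fun h0 (prj j 1)
    rw [h2, add_zero] at h1
    exact h1
  · choose! M hMU hM using fun i (hi : i ∈ J) => (hJ i).1 hi
    have hfin : (⋃ i ∈ J, R (M i)).Finite := by
      refine Set.Finite.biUnion J.finite_toSet fun i hi => hRf (M i) (hMU i hi)
    refine (hfin.image (toSkeleton (C := FGModuleCat.{v} A))).subset ?_
    rintro x ⟨hx, hcx⟩
    rw [indecomposable_iff_isIndec] at hx
    have := hx.1
    obtain ⟨y, hy⟩ := exists_ne (0 : isoClassRep x)
    obtain ⟨ξ, hξ⟩ : ∃ ξ : Module.Dual k (isoClassRep x), ξ y ≠ 0 := by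
      by_contra! hall
      exact hy ((Module.forall_dual_apply_eq_zero_iff k y).1 hall)
    obtain ⟨f, hf⟩ := exists_linearMap_of_form ht hn ξ
    have hfy : f y ≠ 0 := fun h0 => hξ (by rw [← hf, h0, map_zero])
    have hπf : π (f y) = f y := by
      have h1 : c • y = y := hcx y
      conv_rhs => rw [← h1]
      rw [map_smul, smul_eq_mul, hπc, Subring.mem_center_iff.1 hcentral]
    obtain ⟨i, hi, hne⟩ : ∃ i ∈ J, prj i ∘ₗ f ≠ 0 := by
      by_contra! hall
      apply hfy
      rw [← hπf, hπ]
      refine Finset.sum_eq_zero fun i hi => ?_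
      have := LinearMap.congr_fun (hall i hi) y
      simp only [LinearMap.comp_apply, LinearMap.zero_apply] at this
      rw [this, map_zero]
    obtain ⟨e⟩ := hM i hi
    obtain ⟨V, hV, ⟨e'⟩⟩ := hR (M i) (hMU i hi) (isoClassRep x)
      ((FGModuleCat.isoToLinearEquiv e).toLinearMap ∘ₗ prj i ∘ₗ f) hx (fun h0 => hne (by
        ext z
        have := LinearMap.congr_fun h0 z
        simpa using this))
    refine ⟨V, Set.mem_biUnion hi hV, ?_⟩
    exact toSkeleton_eq_iff.2 ⟨e'.symm⟩

end Auslander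

/-! ### Valued translation quivers with a subadditive function -/

section Tubes

variable {V : Type*} {d : V → V → ℕ} {τ : V → V} {f : V → ℕ}

/-- A stable translation quiver, with `d x y` arrows from `x` to `y` and a translation `τ` with
`τ² = 1`, together with a positive `τ`-invariant subadditive function `f`. -/
structure IsSubadditive (d : V → V → ℕ) (τ : V → V) (f : V → ℕ) : Prop where
  tau_tau : ∀ x, τ (τ x) = x
  arrow : ∀ x y, d x y = d (τ y) x
  pos : ∀ x, 0 < f x
  map_tau : ∀ x, f (τ x) = f x
  sum_le : ∀ x (s : Finset V), ∑ y ∈ s, d y x * f y ≤ 2 * f x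

namespace IsSubadditive

variable (h : IsSubadditive d τ f)
include h

theorem arrow_tau (x y : V) : d (τ x) (τ y) = d x y := by
  rw [h.arrow x y, h.arrow (τ y) x]

theorem arrow_tau_right (x y : V) : d x (τ y) = d y x := by
  rw [h.arrow x (τ y), h.tau_tau]

theorem le_of_arrow (x y : V) : d x y * f x ≤ 2 * f y := by
  simpa using h.sum_le y {x}

theorem le_two_mul_of_arrow {x y : V} (hxy : d x y ≠ 0) : f x ≤ 2 * f y :=
  le_trans (Nat.le_mul_of_pos_left _ (Nat.pos_of_ne_zero hxy)) (h.le_of_arrow x y)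

theorem le_two_mul_of_arrow' {x y : V} (hxy : d x y ≠ 0) : f y ≤ 2 * f x := by
  rw [h.arrow] at hxy
  simpa [h.map_tau] using h.le_two_mul_of_arrow hxy

theorem sum_two_le {x y z : V} (hne : y ≠ z) : d y x * f y + d z x * f z ≤ 2 * f x := by
  classical
  have := h.sum_le x {y, z}
  rwa [Finset.sum_pair hne] at this

theorem sum_three_le {x y z w : V} (h₁ : y ≠ z) (h₂ : y ≠ w) (h₃ : z ≠ w) :
    d y x * f y + d z x * f z + d w x * f w ≤ 2 * f x := by
  classical
  have := h.sum_le x {y, z, w}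
  rwa [Finset.sum_insert (by simp [h₁, h₂]), Finset.sum_pair h₃, ← add_assoc] at this

omit h in
/-- The set of vertices reached from a set `B` without increasing `f`. -/
inductive Descent (d : V → V → ℕ) (f : V → ℕ) (B : Set V) : V → Prop
  | base {z : V} (hz : z ∈ B) : Descent d f B z
  | step {y z : V} (hy : Descent d f B y) (hyz : d y z ≠ 0 ∨ d z y ≠ 0) (hle : f z ≤ f y) :
      Descent d f B z

omit h in
theorem Descent.le {B : Set V} {K : ℕ} (hB : ∀ z ∈ B, f z ≤ K) {z : V} (hz : Descent d f B z) :
    f z ≤ K := by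
  induction hz with
  | base hz => exact hB _ hz
  | step _ _ hle ih => exact hle.trans ih

theorem descent_tau {B : Set V} (hB : ∀ z ∈ B, τ z ∈ B) {z : V} (hz : Descent d f B z) :
    Descent d f B (τ z) := by
  induction hz with
  | base hz => exact .base (hB _ hz)
  | step _ hyz hle ih =>
    refine .step ih ?_ (by rwa [h.map_tau, h.map_tau])
    rwa [h.arrow_tau, h.arrow_tau]

/-- If no neighbour of `B` has a larger value, then `f` is bounded on the component. -/
theorem descent_of_eqvGen {B : Set V} (hB : ∀ z ∈ B, τ z ∈ B)
    (hn : ∀ z ∈ B, ∀ w, d z w ≠ 0 ∨ d w z ≠ 0 → w ∈ B ∨ f w ≤ f z) {x y : V} (hx : x ∈ B)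
    (hxy : Relation.EqvGen (fun a b => d a b ≠ 0) x y) : Descent d f B y := by
  have hclosed : ∀ z, Descent d f B z → ∀ w, d z w ≠ 0 ∨ d w z ≠ 0 → Descent d f B w := by
    intro z hz w hzw
    cases hz with
    | base hz => exact (hn z hz w hzw).elim .base fun hle => .step (.base hz) hzw hle
    | @step y _ hy hyz hle =>
      by_cases h1 : w = y
      · exact h1 ▸ hy
      by_cases h2 : w = τ y
      · exact h2 ▸ h.descent_tau hB hy
      refine .step (.step hy hyz hle) hzw ?_
      obtain ⟨y', hy', hfy, hyz'⟩ : ∃ y', (y' = y ∨ y' = τ y) ∧ f y' = f y ∧ d y' z ≠ 0 := by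
        rcases hyz with h3 | h3
        · exact ⟨y, Or.inl rfl, rfl, h3⟩
        · exact ⟨τ y, Or.inr rfl, h.map_tau y, by rwa [← h.arrow]⟩
      obtain ⟨w', hw', hfw, hwz'⟩ : ∃ w', (w' = w ∨ w' = τ w) ∧ f w' = f w ∧ d w' z ≠ 0 := by
        rcases hzw with h3 | h3
        · exact ⟨τ w, Or.inr rfl, h.map_tau w, by rwa [← h.arrow]⟩
        · exact ⟨w, Or.inl rfl, rfl, h3⟩
      have hne : y' ≠ w' := by
        rintro rfl
        have := h.tau_tau w
        have := h.tau_tau y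
        grind
      have h4 := h.sum_two_le (x := z) hne
      have h5 := Nat.le_mul_of_pos_left (f y') (Nat.pos_of_ne_zero hyz')
      have h6 := Nat.le_mul_of_pos_left (f w') (Nat.pos_of_ne_zero hwz')
      omega
  have key : ∀ a b, Relation.EqvGen (fun a b => d a b ≠ 0) a b →
      (Descent d f B a ↔ Descent d f B b) := by
    intro a b hab
    induction hab with
    | rel a b hab => exact ⟨fun ha => hclosed a ha b (Or.inl hab),
        fun hb => hclosed b hb a (Or.inr hab)⟩
    | refl => exact Iff.rfl
    | symm _ _ _ ih => exact ih.symm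
    | trans _ _ _ _ _ ih₁ ih₂ => exact ih₁.trans ih₂
  exact (key x y hxy).1 (.base hx)

omit h in
/-- The invariant of the inductive construction of a ray: `B` is the part of the component behind
the vertex `y`, and `x` is the last vertex of `B`. -/
structure RayInv (d : V → V → ℕ) (τ : V → V) (f : V → ℕ) (x₀ : V) (B : Set V) (x y : V) : Prop where
  reach : Relation.EqvGen (fun a b => d a b ≠ 0) x₀ y
  mem : x ∈ B
  arrow_ne : d x y ≠ 0
  lt : f x < f y
  tau_mem : ∀ z ∈ B, τ z ∈ B
  le : ∀ z ∈ B, f z ≤ f y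
  nbr : ∀ z ∈ B, ∀ w, d z w ≠ 0 ∨ d w z ≠ 0 → w ∈ B ∨ w = y ∨ w = τ y

variable {x₀ : V} (hunb : ∀ b, ∃ y, Relation.EqvGen (fun a b => d a b ≠ 0) x₀ y ∧ b < f y)
include hunb

theorem exists_larger_pred {B : Set V} {y : V}
    (hy : Relation.EqvGen (fun a b => d a b ≠ 0) x₀ y) (hB : ∀ z ∈ B, τ z ∈ B)
    (hle : ∀ z ∈ B, f z ≤ f y)
    (hn : ∀ z ∈ B, ∀ w, d z w ≠ 0 ∨ d w z ≠ 0 → w ∈ B ∨ w = y ∨ w = τ y) :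
    ∃ p, d p y ≠ 0 ∧ f y < f p := by
  by_contra! hall
  obtain ⟨z, hz, hlt⟩ := hunb (f y)
  have hcur : ∀ w, d y w ≠ 0 ∨ d w y ≠ 0 → f w ≤ f y := by
    rintro w (h1 | h1)
    · rw [← h.map_tau w]
      exact hall _ (by rwa [← h.arrow])
    · exact hall _ h1
  refine absurd (Descent.le (K := f y) ?_ (h.descent_of_eqvGen (B := B ∪ {y, τ y}) ?_ ?_
    (Or.inr (Or.inl rfl)) (.trans _ _ _ (.symm _ _ hy) hz))) (not_le.2 hlt)
  · rintro z (hz | rfl | rfl)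
    · exact hle z hz
    · exact le_rfl
    · exact (h.map_tau y).le
  · rintro z (hz | rfl | rfl)
    · exact Or.inl (hB z hz)
    · exact Or.inr (Or.inr rfl)
    · exact Or.inr (Or.inl (h.tau_tau y))
  · rintro z (hz | rfl | rfl) w hw
    · exact Or.inl (by
        rcases hn z hz w hw with h1 | h1 | h1
        · exact Or.inl h1
        · exact Or.inr (Or.inl h1)
        · exact Or.inr (Or.inr h1))
    · exact Or.inr (hcur w hw)
    · right
      have h1 := hcur (τ w) (by
        rw [← h.arrow_tau y, ← h.arrow_tau (τ w), h.tau_tau]; exact hw)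
      rwa [h.map_tau] at h1 ⊢

theorem exists_next {B : Set V} {x y : V} (hI : RayInv d τ f x₀ B x y) :
    ∃ z, RayInv d τ f x₀ (B ∪ {y, τ y}) y z ∧ d x y = 1 ∧ d y z = 1 ∧
      ∀ w, d w y ≠ 0 → w = x ∨ w = τ z := by
  obtain ⟨p, hp, hlt⟩ := h.exists_larger_pred hunb hI.reach hI.tau_mem hI.le hI.nbr
  have hxp : x ≠ p := by
    rintro rfl
    exact absurd hI.lt (not_lt.2 hlt.le)
  have hx2 := h.le_two_mul_of_arrow' hI.arrow_ne
  have hpos := h.pos x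
  have h1 := h.sum_two_le (x := y) hxp
  have hdx : d x y = 1 := by
    by_contra hne
    have h2 : 2 ≤ d x y := by have := hI.arrow_ne; omega
    have h3 := Nat.mul_le_mul_right (f x) h2
    have h4 := Nat.le_mul_of_pos_left (f p) (Nat.pos_of_ne_zero hp)
    omega
  have hdp : d p y = 1 := by
    by_contra hne
    have h2 : 2 ≤ d p y := by omega
    have h3 := Nat.mul_le_mul_right (f p) h2
    have h4 := Nat.le_mul_of_pos_left (f x) (Nat.pos_of_ne_zero hI.arrow_ne)
    omega
  have hw : ∀ w, d w y ≠ 0 → w = x ∨ w = p := fun w hw => by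
    by_contra! hne
    have h2 := h.sum_three_le (x := y) hxp hne.1.symm hne.2.symm
    have h3 := h.le_two_mul_of_arrow' hw
    have h4 := Nat.le_mul_of_pos_left (f w) (Nat.pos_of_ne_zero hw)
    rw [hdx, hdp, one_mul, one_mul] at h2
    omega
  have hn : ∀ w, d y w ≠ 0 ∨ d w y ≠ 0 → (w = x ∨ w = τ x) ∨ w = τ p ∨ w = p := by
    rintro w (h1 | h1)
    · rw [h.arrow] at h1
      rcases hw _ h1 with h2 | h2
      · exact Or.inl (Or.inr (by rw [← h2, h.tau_tau]))
      · exact Or.inr (Or.inl (by rw [← h2, h.tau_tau]))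
    · rcases hw _ h1 with h2 | h2
      · exact Or.inl (Or.inl h2)
      · exact Or.inr (Or.inr h2)
  have hmem : ∀ w, w = x ∨ w = τ x → w ∈ B := by
    rintro w (rfl | rfl)
    · exact hI.mem
    · exact hI.tau_mem _ hI.mem
  have hdz : d y (τ p) = 1 := by rw [h.arrow_tau_right, hdp]
  refine ⟨τ p, ⟨.trans _ _ _ hI.reach (.rel _ _ (by rw [hdz]; exact one_ne_zero)),
    Or.inr (Or.inl rfl), by rw [hdz]; exact one_ne_zero, by rwa [h.map_tau], ?_, ?_, ?_⟩, hdx, hdz,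
    by rwa [h.tau_tau]⟩
  · rintro z (hz | rfl | rfl)
    · exact Or.inl (hI.tau_mem z hz)
    · exact Or.inr (Or.inr rfl)
    · exact Or.inr (Or.inl (h.tau_tau y))
  · rw [h.map_tau]
    rintro z (hz | rfl | rfl)
    · exact (hI.le z hz).trans hlt.le
    · exact hlt.le
    · rw [h.map_tau]; exact hlt.le
  · rw [h.tau_tau]
    rintro z (hz | rfl | rfl) w hzw
    · rcases hI.nbr z hz w hzw with h2 | h2 | h2
      · exact Or.inl (Or.inl h2)
      · exact Or.inl (Or.inr (Or.inl h2))
      · exact Or.inl (Or.inr (Or.inr h2))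
    · rcases hn w hzw with h2 | h2
      · exact Or.inl (Or.inl (hmem w h2))
      · exact Or.inr h2
    · have h3 := hn (τ w) (by
        rw [← h.arrow_tau y, ← h.arrow_tau (τ w), h.tau_tau]; exact hzw)
      rcases h3 with h2 | h2 | h2
      · have := hI.tau_mem _ (hmem _ h2)
        rw [h.tau_tau] at this
        exact Or.inl (Or.inl this)
      · have := congrArg τ h2
        rw [h.tau_tau, h.tau_tau] at this
        exact Or.inr (Or.inr this)
      · have := congrArg τ h2
        rw [h.tau_tau] at this
        exact Or.inr (Or.inl this)

theorem exists_start : ∃ x y, Relation.EqvGen (fun a b => d a b ≠ 0) x₀ x ∧ d x y = 1 ∧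
    (∀ w, d w x ≠ 0 → w = τ y) ∧ RayInv d τ f x₀ {x, τ x} x y := by
  classical
  have hex : ∃ n x, Relation.EqvGen (fun a b => d a b ≠ 0) x₀ x ∧ f x = n := ⟨_, x₀, .refl _, rfl⟩
  obtain ⟨x, hx, hfx⟩ := Nat.find_spec hex
  have hmin : ∀ y, Relation.EqvGen (fun a b => d a b ≠ 0) x₀ y → f x ≤ f y := fun y hy => by
    rw [hfx]
    exact Nat.find_min' hex ⟨y, hy, rfl⟩
  obtain ⟨p, hp, hlt⟩ := h.exists_larger_pred hunb (B := ∅) hx (fun z hz => hz.elim)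
    (fun z hz => hz.elim) (fun z hz => hz.elim)
  have hw : ∀ w, d w x ≠ 0 → w = p := fun w hw => by
    by_contra hne
    have h1 := h.sum_two_le (x := x) hne
    have h2 := Nat.le_mul_of_pos_left (f w) (Nat.pos_of_ne_zero hw)
    have h3 := Nat.le_mul_of_pos_left (f p) (Nat.pos_of_ne_zero hp)
    have h4 := hmin w (.trans _ _ _ hx (.symm _ _ (.rel _ _ hw)))
    omega
  have hdp : d p x = 1 := by
    by_contra hne
    have h2 : 2 ≤ d p x := by omega
    have h3 := Nat.mul_le_mul_right (f p) h2
    have h4 := h.le_of_arrow p x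
    omega
  have hdx : d x (τ p) = 1 := by rw [h.arrow_tau_right, hdp]
  have hn : ∀ w, d x w ≠ 0 ∨ d w x ≠ 0 → w = τ p ∨ w = p := by
    rintro w (h1 | h1)
    · rw [h.arrow] at h1
      exact Or.inl (by rw [← hw _ h1, h.tau_tau])
    · exact Or.inr (hw _ h1)
  refine ⟨x, τ p, hx, hdx, by rwa [h.tau_tau], ⟨.trans _ _ _ hx (.rel _ _ (by
    rw [hdx]; exact one_ne_zero)), Or.inl rfl, by rw [hdx]; exact one_ne_zero, by rwa [h.map_tau],
    ?_, ?_, ?_⟩⟩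
  · rintro z (rfl | rfl)
    · exact Or.inr rfl
    · exact Or.inl (h.tau_tau x)
  · rw [h.map_tau]
    rintro z (rfl | rfl)
    · exact hlt.le
    · rw [h.map_tau]; exact hlt.le
  · rw [h.tau_tau]
    rintro z (rfl | rfl) w hzw
    · exact Or.inr (hn w hzw)
    · rcases hn (τ w) (by
        rw [← h.arrow_tau x, ← h.arrow_tau (τ w), h.tau_tau]; exact hzw) with h2 | h2
      · have := congrArg τ h2
        rw [h.tau_tau, h.tau_tau] at this
        exact Or.inr (Or.inr this)
      · have := congrArg τ h2
        rw [h.tau_tau] at this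
        exact Or.inr (Or.inl this)

/-- An infinite ray that contains, up to `τ`, all vertices of the component. -/
theorem exists_ray : ∃ x : ℕ → V, (∀ i, Relation.EqvGen (fun a b => d a b ≠ 0) x₀ (x i)) ∧
    (∀ i, f (x i) < f (x (i + 1))) ∧ (∀ i, d (x i) (x (i + 1)) = 1) ∧
    (∀ w, d w (x 0) ≠ 0 → w = τ (x 1)) ∧
    ∀ i w, d w (x (i + 1)) ≠ 0 → w = x i ∨ w = τ (x (i + 2)) := by
  obtain ⟨a, b, ha, hab, hpa, hI⟩ := h.exists_start hunb
  let σ := {q : Set V × V × V // RayInv d τ f x₀ q.1 q.2.1 q.2.2}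
  have hnext : ∀ q : σ, ∃ q' : σ, q'.1.2.1 = q.1.2.2 ∧ d q.1.2.1 q.1.2.2 = 1 ∧
      ∀ w, d w q.1.2.2 ≠ 0 → w = q.1.2.1 ∨ w = τ q'.1.2.2 := fun q => by
    obtain ⟨z, hz, h1, h2, h3⟩ := h.exists_next hunb q.2
    exact ⟨⟨(_, _, z), hz⟩, rfl, h1, h3⟩
  choose next hnext₁ hnext₂ hnext₃ using hnext
  let s : ℕ → σ := fun n => Nat.rec ⟨({a, τ a}, a, b), hI⟩ (fun _ q => next q) n
  have hs : ∀ n, (s (n + 1)).1.2.1 = (s n).1.2.2 := fun n => hnext₁ (s n)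
  refine ⟨fun n => (s n).1.2.1, fun i => ?_, fun i => ?_, fun i => ?_, fun w hw => ?_,
    fun i w hw => ?_⟩
  · cases i with
    | zero => exact ha
    | succ i => beta_reduce; rw [hs]; exact (s i).2.reach
  · beta_reduce; rw [hs]; exact (s i).2.lt
  · beta_reduce; rw [hs]; exact hnext₂ (s i)
  · have : (s 1).1.2.1 = b := hs 0
    beta_reduce
    rw [this]
    exact hpa w hw
  · beta_reduce at hw ⊢
    rw [hs] at hw
    have : (s (i + 2)).1.2.1 = (s (i + 1)).1.2.2 := hs (i + 1)
    rw [this]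
    exact hnext₃ (s i) w hw

/-- A component on which a subadditive function is unbounded is a stable tube. -/
theorem exists_tube : ∃ r, (r = 1 ∨ r = 2) ∧
    ∃ e : ZMod r × ℕ ≃ {y | Relation.EqvGen (fun a b => d a b ≠ 0) x₀ y},
      (∀ p q, d (e p).1 (e q).1 = tubeArrows r p q) ∧
      ∀ p, (e (p.1 - 1, p.2)).1 = τ (e p).1 := by
  classical
  obtain ⟨x, hx, hlt, hd, hw0, hw⟩ := h.exists_ray hunb
  have hmono : StrictMono (f ∘ x) := strictMono_nat_of_lt_succ hlt
  have hinj : ∀ {i j}, f (x i) = f (x j) → i = j := fun {i j} hij => hmono.injective hij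
  have hxinj : ∀ {i j}, x i = x j → i = j := fun hij => hinj (congrArg f hij)
  have hxτ : ∀ {i j}, x i = τ (x j) → i = j := fun {i j} hij => hinj (by rw [hij, h.map_tau])
  have hDne : ∀ i j, d (x i) (x j) ≠ 0 → j = i + 1 ∨ (i = j + 1 ∧ τ (x i) = x i) := by
    intro i j hij
    cases j with
    | zero =>
      have h1 := hw0 _ hij
      obtain rfl := hxτ h1
      exact Or.inr ⟨rfl, h1.symm⟩
    | succ j =>
      rcases hw j _ hij with h1 | h1
      · exact Or.inl (by rw [hxinj h1])
      · obtain rfl := hxτ h1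
        exact Or.inr ⟨rfl, h1.symm⟩
  have hD2 : ∀ j, τ (x (j + 1)) = x (j + 1) → d (x (j + 1)) (x j) = 1 := fun j hj => by
    rw [← hj, ← h.arrow, hd]
  have hadjQ : ∀ a b, (d a b ≠ 0 ∨ d b a ≠ 0) → (∃ i, a = x i ∨ a = τ (x i)) →
      ∃ i, b = x i ∨ b = τ (x i) := by
    have hpred : ∀ i w, d w (x i) ≠ 0 → ∃ j, w = x j ∨ w = τ (x j) := fun i w hiw => by
      cases i with
      | zero => exact ⟨1, Or.inr (hw0 w hiw)⟩
      | succ i =>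
        rcases hw i w hiw with h1 | h1
        · exact ⟨i, Or.inl h1⟩
        · exact ⟨i + 2, Or.inr h1⟩
    have hswap : ∀ w, (∃ j, τ w = x j ∨ τ w = τ (x j)) → ∃ j, w = x j ∨ w = τ (x j) := by
      rintro w ⟨j, h1 | h1⟩
      · exact ⟨j, Or.inr (by rw [← h1, h.tau_tau])⟩
      · exact ⟨j, Or.inl (by rw [← h.tau_tau w, h1, h.tau_tau])⟩
    rintro a b hab ⟨i, rfl | rfl⟩
    · rcases hab with h1 | h1
      · rw [h.arrow] at h1
        exact hswap b (hpred i _ h1)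
      · exact hpred i b h1
    · rcases hab with h1 | h1
      · exact hpred i b (by rwa [h.arrow])
      · rw [h.arrow_tau_right, h.arrow] at h1
        exact hswap b (hpred i _ h1)
  have hQ : ∀ y, Relation.EqvGen (fun a b => d a b ≠ 0) x₀ y → ∃ i, y = x i ∨ y = τ (x i) := by
    intro y hy
    have key : ∀ a b, Relation.EqvGen (fun a b => d a b ≠ 0) a b →
        ((∃ i, a = x i ∨ a = τ (x i)) ↔ ∃ i, b = x i ∨ b = τ (x i)) := by
      intro a b hab
      induction hab with
      | rel a b hab => exact ⟨hadjQ a b (Or.inl hab), hadjQ b a (Or.inr hab)⟩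
      | refl => exact Iff.rfl
      | symm _ _ _ ih => exact ih.symm
      | trans _ _ _ _ _ ih₁ ih₂ => exact ih₁.trans ih₂
    exact (key (x 0) y (.trans _ _ _ (.symm _ _ (hx 0)) hy)).1 ⟨0, Or.inl rfl⟩
  have hτS : ∀ i, Relation.EqvGen (fun a b => d a b ≠ 0) x₀ (τ (x i)) := fun i => by
    refine .trans _ _ _ (hx (i + 1)) (.symm _ _ (.trans _ (τ (x (i + 1))) _ (.rel _ _ ?_)
      (.trans _ (x i) _ (.rel _ _ ?_) (.rel _ _ ?_))))
    · rw [h.arrow_tau, hd]; exact one_ne_zero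
    · rw [← h.arrow, hd]; exact one_ne_zero
    · rw [hd]; exact one_ne_zero
  by_cases h0 : τ (x 0) = x 0
  · have hfix : ∀ i, τ (x i) = x i := fun i => by
      induction i with
      | zero => exact h0
      | succ i ih =>
        have h1 : d (x (i + 1)) (x i) ≠ 0 := by
          rw [h.arrow, ih, hd]; exact one_ne_zero
        rcases hDne _ _ h1 with h2 | h2
        · omega
        · exact h2.2
    refine ⟨1, Or.inl rfl, Equiv.ofBijective (fun p => ⟨x p.2, hx p.2⟩) ⟨?_, ?_⟩, ?_, ?_⟩
    · rintro ⟨a, i⟩ ⟨b, j⟩ hij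
      obtain rfl := hxinj (congrArg Subtype.val hij)
      exact Prod.ext (Subsingleton.elim a b) rfl
    · rintro ⟨y, hy⟩
      obtain ⟨i, rfl | rfl⟩ := hQ y hy
      · exact ⟨(0, i), rfl⟩
      · exact ⟨(0, i), Subtype.ext (hfix i).symm⟩
    · rintro ⟨a, i⟩ ⟨b, j⟩
      change d (x i) (x j) = tubeArrows 1 (a, i) (b, j)
      simp only [tubeArrows, Subsingleton.elim b a, Subsingleton.elim (a + 1) a, true_and]
      by_cases h1 : j = i + 1
      · subst h1
        rw [hd, if_pos rfl, if_neg (by omega)]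
      · by_cases h2 : i = j + 1
        · subst h2
          rw [hD2 j (hfix _), if_neg (by omega), if_pos rfl]
        · rw [if_neg h1, if_neg h2]
          by_contra hne
          rcases hDne i j hne with h3 | h3
          · exact h1 h3
          · exact h2 h3.1
    · rintro ⟨a, i⟩
      exact (hfix i).symm
  · have hfree : ∀ i, τ (x i) ≠ x i := fun i => by
      induction i with
      | zero => exact h0
      | succ i ih =>
        intro h1
        have h2 : d (τ (x i)) (x (i + 1)) ≠ 0 := by
          rw [← h1, h.arrow_tau, hd]; exact one_ne_zero
        rcases hw i _ h2 with h3 | h3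
        · exact ih h3
        · have := hinj ((h.map_tau _).symm.trans ((congrArg f h3).trans (h.map_tau _)))
          omega
    have hD : ∀ i j, d (x i) (x j) = if j = i + 1 then 1 else 0 := fun i j => by
      split_ifs with h1
      · rw [h1, hd]
      · by_contra hne
        rcases hDne i j hne with h2 | h2
        · exact h1 h2
        · exact hfree i h2.2
    let g : ZMod 2 → ℕ → V := fun a i => if a = 0 then x i else τ (x i)
    have hg0 : ∀ i, g 0 i = x i := fun i => if_pos rfl
    have hg1 : ∀ i, g 1 i = τ (x i) := fun i => if_neg (by decide)
    have hcases : ∀ a : ZMod 2, a = 0 ∨ a = 1 := by decide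
    refine ⟨2, Or.inr rfl, Equiv.ofBijective (fun p => ⟨g p.1 p.2, ?_⟩) ⟨?_, ?_⟩, ?_, ?_⟩
    · change Relation.EqvGen _ _ _
      rcases hcases p.1 with h1 | h1
      · rw [h1, hg0]; exact hx _
      · rw [h1, hg1]; exact hτS _
    · rintro ⟨a, i⟩ ⟨b, j⟩ hij
      have hij' : g a i = g b j := congrArg Subtype.val hij
      rcases hcases a with rfl | rfl <;> rcases hcases b with rfl | rfl
      · rw [hg0, hg0] at hij'
        rw [hxinj hij']
      · rw [hg0, hg1] at hij'
        obtain rfl := hxτ hij'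
        exact (hfree i hij'.symm).elim
      · rw [hg1, hg0] at hij'
        obtain rfl := hxτ hij'.symm
        exact (hfree j hij').elim
      · rw [hg1, hg1] at hij'
        have := congrArg τ hij'
        rw [h.tau_tau, h.tau_tau] at this
        rw [hxinj this]
    · rintro ⟨y, hy⟩
      obtain ⟨i, rfl | rfl⟩ := hQ y hy
      · exact ⟨(0, i), Subtype.ext (hg0 i)⟩
      · exact ⟨(1, i), Subtype.ext (hg1 i)⟩
    · rintro ⟨a, i⟩ ⟨b, j⟩
      change d (g a i) (g b j) = tubeArrows 2 (a, i) (b, j)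
      have e1 : (0 : ZMod 2) = 1 ↔ False := by decide
      have e2 : (1 : ZMod 2) = 0 ↔ False := by decide
      have e3 : (1 + 1 : ZMod 2) = 0 := by decide
      rcases hcases a with rfl | rfl <;> rcases hcases b with rfl | rfl
      · rw [hg0, hg0, hD]; simp [tubeArrows]
      · rw [hg0, hg1, h.arrow_tau_right, hD]; simp [tubeArrows]
      · rw [hg1, hg0, ← h.arrow, hD]; simp [tubeArrows, e3]
      · rw [hg1, hg1, h.arrow_tau, hD]; simp [tubeArrows, e3]
    · rintro ⟨a, i⟩
      change g (a - 1) i = τ (g a i)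
      rcases hcases a with rfl | rfl
      · rw [hg0]
        exact hg1 i
      · rw [hg1, h.tau_tau]
        exact hg0 i

end IsSubadditive

end Tubes

section IndecProjective

variable {A : Type v} [Ring A] [IsArtinianRing A] {P : Type*} [AddCommGroup P] [Module A P]
  [Module.Finite A P] [Module.Projective A P]

/-- The sum of two proper submodules of an indecomposable projective module is proper. -/
theorem IsIndec.eq_top_or_eq_top_of_sup_eq_top (hP : IsIndec A P) {K L : Submodule A P}
    (h : K ⊔ L = ⊤) : K = ⊤ ∨ L = ⊤ := by
  have hs : Function.Surjective (L.mkQ ∘ₗ K.subtype) := by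
    rw [← LinearMap.range_eq_top, LinearMap.range_comp, Submodule.range_subtype]
    exact (Submodule.map_mkQ_eq_top L K).2 (by rwa [sup_comm])
  obtain ⟨g, hg⟩ := Module.projective_lifting_property _ L.mkQ hs
  have hunit : IsUnit ((K.subtype ∘ₗ g : Module.End A P) + (1 - K.subtype ∘ₗ g)) := by
    rw [add_sub_cancel]; exact isUnit_one
  rcases hP.isUnit_or_isUnit_of_add hunit with h1 | h1
  · left
    rw [eq_top_iff]
    intro x _
    obtain ⟨y, rfl⟩ := ((Module.End.isUnit_iff _).1 h1).2 x
    exact (g y).2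
  · right
    rw [eq_top_iff]
    intro x _
    obtain ⟨y, rfl⟩ := ((Module.End.isUnit_iff _).1 h1).2 x
    have := LinearMap.congr_fun hg y
    rw [← Submodule.ker_mkQ L, LinearMap.mem_ker, LinearMap.sub_apply, map_sub, sub_eq_zero]
    exact this.symm

/-- An indecomposable projective module has a largest proper submodule. -/
theorem IsIndec.exists_largest_submodule (hP : IsIndec A P) :
    ∃ R : Submodule A P, R ≠ ⊤ ∧ ∀ K : Submodule A P, K ≠ ⊤ → K ≤ R := by
  have := hP.1
  obtain ⟨R, hR, -⟩ := (eq_top_or_exists_le_coatom (⊥ : Submodule A P)).resolve_left bot_ne_top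
  refine ⟨R, hR.1, fun K hK => ?_⟩
  by_contra hle
  rcases hP.eq_top_or_eq_top_of_sup_eq_top (hR.2 (K ⊔ R) (right_lt_sup.2 hle)) with h | h
  · exact hK h
  · exact hR.1 h

/-- A nonzero submodule of an indecomposable projective module over a symmetric algebra is
indecomposable. -/
theorem IsIndec.submodule {k : Type w} [Field k] [Algebra k A] (hA : IsSymmetricFDAlgebra k A)
    (hP : IsIndec A P) (R : Submodule A P) [Nontrivial R] : IsIndec A R := by
  refine ⟨inferInstance, fun e he => ?_⟩
  obtain ⟨e', he'⟩ := hA.exists_extension R.subtype R.injective_subtype (R.subtype ∘ₗ e)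
  rcases hP.isUnit_or_isNilpotent e' with h | ⟨n, hn⟩
  · right
    have hinj : Function.Injective e := by
      have h1 : Function.Injective (e' ∘ₗ R.subtype) :=
        ((Module.End.isUnit_iff _).1 h).1.comp R.injective_subtype
      rw [he', LinearMap.coe_comp] at h1
      exact h1.of_comp
    ext1 x
    exact hinj (LinearMap.congr_fun he x)
  · left
    have h1 := pow_comp_eq_of_comp_eq he' n
    rw [hn, LinearMap.zero_comp] at h1
    have h2 : e ^ n = 0 := by
      refine LinearMap.ext fun x => Subtype.ext ?_
      exact (LinearMap.congr_fun h1 x).symm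
    cases n with
    | zero =>
      rw [pow_zero] at h2
      exact (one_ne_zero h2).elim
    | succ n =>
      have h3 : IsIdempotentElem e := he
      rwa [h3.pow_succ_eq] at h2

end IndecProjective

section StableQuiver

open scoped ModuleCat

variable {k : Type w} [Field k] {A : Type v} [Ring A] [Algebra k A]

theorem factorsProj_of_factorsThroughProjective {M N : FGModuleCat.{v} A} {f : M ⟶ N}
    (h : FactorsThroughProjective f) : FactorsProj (linMap f) := by
  obtain ⟨P, a, b, hP, rfl⟩ := h
  exact FactorsProj.of_comp (linMap a) (linMap b)

theorem factorsThroughProjective_of_factorsProj {M N : FGModuleCat.{v} A} {f : M →ₗ[A] N}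
    (h : FactorsProj f) : FactorsThroughProjective (fgHom f) := by
  obtain ⟨n, a, b, rfl⟩ := h
  exact ⟨FGModuleCat.of A (Fin n → A), fgHom a, fgHom b,
    inferInstanceAs (Module.Projective A (Fin n → A)), rfl⟩

theorem StableVertex.isIndec (x : StableVertex A) : IsIndec A (isoClassRep x.1) :=
  (indecomposable_iff_isIndec _).1 x.2.1

theorem exists_stableVertex {M : FGModuleCat.{v} A} (hM : IsIndec A M)
    (hMp : ¬ Module.Projective A M) :
    ∃ x : StableVertex A, Nonempty (M ≅ isoClassRep x.1) := by
  let i := fromSkeletonToSkeletonIso M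
  let e := FGModuleCat.isoToLinearEquiv i
  refine ⟨⟨toSkeleton M, (indecomposable_iff_isIndec _).2 (hM.of_equiv e.symm), fun h => hMp ?_⟩,
    ⟨i.symm⟩⟩
  exact Module.Projective.of_equiv e

theorem StableVertex.ext_of_iso {x y : StableVertex A}
    (h : Nonempty (isoClassRep x.1 ≅ isoClassRep y.1)) : x = y := by
  apply Subtype.ext
  obtain ⟨e⟩ := h
  have := (toSkeleton_eq_iff (X := isoClassRep x.1)).2 ⟨e⟩
  exact (Quotient.out_eq x.1).symm.trans this

theorem IsSymmetricFDAlgebra.exists_isTranslate (hA : IsSymmetricFDAlgebra k A)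
    (x : StableVertex A) : ∃ y : StableVertex A, IsTranslate k x y := by
  obtain ⟨N, hN⟩ := hA.exists_isARTranslate (isoClassRep x.1)
  obtain ⟨h1, h2, -⟩ := hA.exists_isAlmostSplit_of_isARTranslate hN x.isIndec x.2.2
  obtain ⟨y, ⟨e⟩⟩ := exists_stableVertex h1 h2
  obtain ⟨P₁, P₀, f, g, h, ⟨e'⟩⟩ := hN
  exact ⟨y, P₁, P₀, f, g, h, ⟨(FGModuleCat.isoToLinearEquiv e).symm.trans e'⟩⟩

variable [IsAlgClosed k] (hA : IsSymmetricFDAlgebra k A)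
  {τ : StableVertex A → StableVertex A} (hτ : ∀ x, IsTranslate k x (τ x))

include hA hτ in
/-- The dimensions of the modules, added up over the orbits of an involutive translation, are a
subadditive function on the stable Auslander-Reiten quiver. -/
theorem isSubadditive_finrank (hττ : ∀ x, τ (τ x) = x) :
    IsSubadditive (arrowCount k) τ fun x =>
      Module.finrank k (isoClassRep x.1) + Module.finrank k (isoClassRep (τ x).1) := by
  have := hA.1
  have hfd := fun M : FGModuleCat.{v} A => finiteDimensional_of_finite k A M
  have harrow : ∀ x y, arrowCount k x y = arrowCount k (τ y) x := fun x y => by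
    obtain ⟨-, -, E, a, b, h⟩ :=
      hA.exists_isAlmostSplit_of_isARTranslate (hτ y) y.isIndec y.2.2
    exact h.irrDim_eq (τ y).isIndec y.isIndec x.isIndec
  have hsum : ∀ (x : StableVertex A) (s : Finset (StableVertex A))
      (σ : StableVertex A → StableVertex A), Function.Injective σ →
      ∑ y ∈ s, arrowCount k (σ y) x * Module.finrank k (isoClassRep (σ y).1) ≤
        Module.finrank k (isoClassRep (τ x).1) + Module.finrank k (isoClassRep x.1) := by
    intro x s σ hσ
    obtain ⟨-, -, E, a, b, h⟩ :=
      hA.exists_isAlmostSplit_of_isARTranslate (hτ x) x.isIndec x.2.2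
    exact h.sum_irrDim_mul_finrank_le (τ x).isIndec x.isIndec s (fun y => isoClassRep (σ y).1)
      (fun y => (σ y).isIndec) fun y y' hyy' => hσ (StableVertex.ext_of_iso hyy')
  refine ⟨hττ, harrow, fun x => ?_, fun x => ?_, fun x s => ?_⟩
  · have := x.isIndec.1
    exact Nat.add_pos_left Module.finrank_pos _
  · rw [hττ, add_comm]
  · have h1 := hsum x s id Function.injective_id
    have h2 := hsum (τ x) s τ (Function.LeftInverse.injective hττ)
    rw [hττ] at h2
    have h3 : ∀ y, arrowCount k (τ y) (τ x) = arrowCount k y x := fun y => by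
      rw [harrow y x, harrow (τ x) y]
    simp only [h3] at h2
    simp only [id] at h1
    simp only [mul_add, Finset.sum_add_distrib]
    omega

omit [IsAlgClosed k] in
include hA in
/-- If there is an irreducible map from `L` to an indecomposable projective module `P`, then `L`
is the largest proper submodule of `P`. -/
theorem exists_bijective_of_irrDim_ne_zero {L P : FGModuleCat.{v} A} (hL : IsIndec A L)
    (hP : IsIndec A P) [Module.Projective A P] (h : irrDim k L P ≠ 0) {R : Submodule A P}
    (hR : R ≠ ⊤) (hmax : ∀ K : Submodule A P, K ≠ ⊤ → K ≤ R) :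
    ∃ f : L →ₗ[A] R, Function.Bijective f := by
  have := hA.isArtinianRing
  have hL0 := hL.1
  obtain ⟨f, hf, hf2⟩ : ∃ f ∈ radHom k L P, f ∉ radSqHom k L P := by
    by_contra! hall
    apply h
    have h1 : (radSqHom k L P).submoduleOf (radHom k L P) = ⊤ :=
      Submodule.submoduleOf_eq_top.2 hall
    have : Subsingleton (radHom k L P ⧸ (radSqHom k L P).submoduleOf (radHom k L P)) :=
      Submodule.Quotient.subsingleton_iff.2 h1
    exact Module.finrank_zero_of_subsingleton
  have hns : LinearMap.range (linMap f) ≠ ⊤ := fun htop => by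
    obtain ⟨s, hs⟩ := Module.projective_lifting_property (linMap f) LinearMap.id
      (LinearMap.range_eq_top.1 htop)
    exact (hP.mem_radHom_iff' f).1 hf s hs
  let f' : L →ₗ[A] R := (linMap f).codRestrict R fun x => hmax _ hns ⟨x, rfl⟩
  have hinc : fgHom (M := FGModuleCat.of A R) R.subtype ∈ radHom k (FGModuleCat.of A R) P := by
    refine (hP.mem_radHom_iff' _).2 fun s hs => hR ?_
    rw [eq_top_iff]
    intro x _
    have := LinearMap.congr_fun hs x
    rw [LinearMap.id_apply] at this
    rw [← this]
    exact (s x).2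
  have hf' : fgHom (N := FGModuleCat.of A R) f' ∉ radHom k L (FGModuleCat.of A R) := fun hmem =>
    hf2 (Submodule.subset_span ⟨FGModuleCat.of A R, fgHom f', fgHom R.subtype, hmem, hinc, rfl⟩)
  rw [hL.mem_radHom_iff] at hf'
  push Not at hf'
  obtain ⟨s, hs⟩ := hf'
  have hRnt : Nontrivial R := by
    obtain ⟨x, hx⟩ := exists_ne (0 : L)
    refine ⟨f' x, 0, fun h0 => hx ?_⟩
    have h1 : s (f' x) = x := LinearMap.congr_fun hs x
    rw [← h1, h0]
    exact map_zero s
  refine ⟨f', ((hP.submodule hA R).bijective_of_isUnit_comp f' s ?_).1⟩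
  have : s ∘ₗ f' = (1 : Module.End A L) := hs
  rw [this]
  exact isUnit_one

include hA hτ in
/-- On the component of a module in a block of infinite representation type, the dimensions
are unbounded. -/
theorem exists_lt_finrank (hττ : ∀ x, τ (τ x) = x) (x : StableVertex A)
    (hx : BlockIsRepInfinite (isoClassRep x.1)) (b : ℕ) :
    ∃ y, Relation.EqvGen (fun a b => arrowCount k a b ≠ 0) x y ∧
      b < Module.finrank k (isoClassRep y.1) + Module.finrank k (isoClassRep (τ y).1) := by
  by_contra! hb
  have hsub := isSubadditive_finrank hA hτ hττ
  have := hA.1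
  have hart := hA.isArtinianRing
  have hfd := fun M : FGModuleCat.{v} A => finiteDimensional_of_finite k A M
  let S : Set (StableVertex A) := {y | y ∈ stableComponent k x ∨ τ y ∈ stableComponent k x}
  have hSb : ∀ y ∈ S, Module.finrank k (isoClassRep (τ y).1) +
      Module.finrank k (isoClassRep y.1) ≤ b := by
    rintro y (hy | hy)
    · rw [add_comm]; exact hb y hy
    · have h1 := hb _ hy
      rwa [hττ] at h1
  have hSτ : ∀ y ∈ S, τ y ∈ S := by
    rintro y (hy | hy)
    · exact Or.inr (by rwa [hττ])
    · exact Or.inl hy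
  have hSpred : ∀ y ∈ S, ∀ z, arrowCount k z y ≠ 0 → z ∈ S := by
    rintro y (hy | hy) z hz
    · exact Or.inl (.trans _ _ _ hy (.symm _ _ (.rel _ _ hz)))
    · exact Or.inr (.trans _ _ _ hy (.symm _ _ (.rel _ _ (by rwa [hsub.arrow_tau]))))
  let U : FGModuleCat.{v} A → Prop := fun M => (∃ y ∈ S, Nonempty (M ≅ isoClassRep y.1)) ∨
    (IsIndec A M ∧ Module.Projective A M ∧ ∃ y ∈ S, irrDim k M (isoClassRep y.1) ≠ 0)
  have hUrep : ∀ y ∈ S, U (isoClassRep y.1) := fun y hy => Or.inl ⟨y, hy, ⟨Iso.refl _⟩⟩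
  have hUb : ∀ M, U M → IsIndec A M ∧ Module.finrank k M ≤ b := by
    rintro M (⟨y, hy, ⟨e⟩⟩ | ⟨hM, -, y, hy, hne⟩)
    · have e' := FGModuleCat.isoToLinearEquiv e
      refine ⟨y.isIndec.of_equiv e'.symm, ?_⟩
      rw [(e'.restrictScalars k).finrank_eq]
      have := hSb y hy
      omega
    · refine ⟨hM, ?_⟩
      obtain ⟨-, -, E, i, p, h⟩ :=
        hA.exists_isAlmostSplit_of_isARTranslate (hτ y) y.isIndec y.2.2
      have h1 := h.sum_irrDim_mul_finrank_le (k := k) (τ y).isIndec y.isIndec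
        (Finset.univ : Finset Unit) (fun _ => M) (fun _ => hM) fun _ _ _ => rfl
      simp only [Finset.univ_unique, Finset.sum_singleton] at h1
      exact (Nat.le_mul_of_pos_left _ (Nat.pos_of_ne_zero hne)).trans (h1.trans (hSb y hy))
  refine IsPredClosed.not_blockIsRepInfinite hA (U := U) ?_ hUb _ (hUrep x (Or.inl (.refl _))) hx
  rintro M (⟨y, hy, ⟨e⟩⟩ | ⟨hM, hMp, y, hy, hne⟩)
  · obtain ⟨-, -, E, i, p, h⟩ :=
      hA.exists_isAlmostSplit_of_isARTranslate (hτ y) y.isIndec y.2.2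
    obtain ⟨ι, _, F, -, inc, prj, hF, hpi, -, hsum⟩ := exists_decomposition_maps (A := A) E
    have e' : M ≃ₗ[A] isoClassRep y.1 := FGModuleCat.isoToLinearEquiv e
    refine ⟨ι, inferInstance, F, fun j => e'.symm.toLinearMap ∘ₗ p ∘ₗ inc j, fun j => ?_,
      fun j hj => ?_, fun N r hN hr => ?_⟩
    · by_cases hp : Module.Projective A (F j)
      · refine Or.inr ⟨hF j, hp, y, hy, ?_⟩
        rw [h.irrDim_right (τ y).isIndec y.isIndec]
        exact (hF j).isSplitLocal.finrank_quotient_radHom_ne_zero isHomFinite_fgModuleCat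
          (fgHom (inc j)) (fgHom (prj j)) (FGModuleCat.hom_ext (hpi j))
      · obtain ⟨z, ⟨u⟩⟩ := exists_stableVertex (hF j) hp
        refine Or.inl ⟨z, hSpred y hy z ?_, ⟨u⟩⟩
        rw [arrowCount, h.irrDim_right (τ y).isIndec y.isIndec]
        refine z.isIndec.isSplitLocal.finrank_quotient_radHom_ne_zero isHomFinite_fgModuleCat
          (u.inv ≫ fgHom (inc j)) (fgHom (prj j) ≫ u.hom) ?_
        have h1 : fgHom (inc j) ≫ fgHom (prj j) = 𝟙 _ := FGModuleCat.hom_ext (hpi j)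
        rw [Category.assoc, reassoc_of% h1, u.inv_hom_id]
    · let u := LinearEquiv.ofBijective _ hj
      refine h.not_split (inc j ∘ₗ u.symm.toLinearMap ∘ₗ e'.symm.toLinearMap) ?_
      ext1 z
      apply e'.symm.injective
      exact u.apply_symm_apply (e'.symm z)
    · obtain ⟨r', hr'⟩ := h.lift N (e'.toLinearMap ∘ₗ r) (fun s hs => hr (by
        have := y.isIndec.1
        have h1 := (hN.bijective_of_isUnit_comp s (e'.toLinearMap ∘ₗ r) (by
          rw [hs]; exact isUnit_one)).2
        rw [LinearMap.coe_comp] at h1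
        exact (Function.Bijective.of_comp_iff' e'.bijective r).1 h1))
      refine ⟨fun j => prj j ∘ₗ r', ?_⟩
      ext1 n
      apply e'.injective
      have h1 := LinearMap.congr_fun hsum (r' n)
      have h2 := LinearMap.congr_fun hr' n
      simp only [LinearMap.sum_apply, LinearMap.comp_apply, LinearMap.id_apply,
        LinearEquiv.coe_coe] at h1 h2 ⊢
      rw [← h2, map_sum]
      simp only [LinearEquiv.apply_symm_apply]
      rw [← map_sum, h1]
  · obtain ⟨R, hR, hmax⟩ := hM.exists_largest_submodule
    obtain ⟨-, -, E, i, p, h⟩ :=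
      hA.exists_isAlmostSplit_of_isARTranslate (hτ y) y.isIndec y.2.2
    rw [h.irrDim_eq (τ y).isIndec y.isIndec hM] at hne
    obtain ⟨f, hf⟩ := exists_bijective_of_irrDim_ne_zero hA (τ y).isIndec hM hne hR hmax
    refine ⟨Unit, inferInstance, fun _ => FGModuleCat.of A R, fun _ => R.subtype, fun _ =>
      Or.inl ⟨τ y, hSτ y hy, ⟨fgIso (LinearEquiv.ofBijective f hf).symm⟩⟩, fun _ hb => hR ?_,
      fun N r hN hr => ?_⟩
    · rw [← R.range_subtype]
      exact LinearMap.range_eq_top.2 hb.2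
    · have hns : LinearMap.range r ≠ ⊤ := fun htop => by
        obtain ⟨s, hs⟩ := Module.projective_lifting_property r LinearMap.id
          (LinearMap.range_eq_top.1 htop)
        have := hM.1
        exact hr (hN.bijective_of_isUnit_comp s r (by rw [hs]; exact isUnit_one)).2
      exact ⟨fun _ => r.codRestrict R fun n => hmax _ hns ⟨n, rfl⟩, by ext n; simp⟩

include hA in
/-- If `τ²` is stably the identity, then the components of the stable Auslander-Reiten quiver that
belong to blocks of infinite representation type are tubes of rank one or two. -/
theorem isStableTube_stableComponent
    (h2 : ∀ M N₁ N₂ : FGModuleCat.{v} A, IsARTranslate k M N₁ → IsARTranslate k N₁ N₂ →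
      StablyIso N₂ M) (x : StableVertex A) (hx : BlockIsRepInfinite (isoClassRep x.1)) :
    IsStableTube k 1 (stableComponent k x) ∨ IsStableTube k 2 (stableComponent k x) := by
  have := hA.isArtinianRing
  choose τ hτ using hA.exists_isTranslate
  have hττ : ∀ x, τ (τ x) = x := fun x => by
    obtain ⟨f, g, hfg, -⟩ := h2 _ _ _ (hτ x) (hτ (τ x))
    apply StableVertex.ext_of_iso
    have h3 := factorsProj_of_factorsThroughProjective hfg
    exact ⟨fgIso (LinearEquiv.ofBijective (linMap f)
      ((τ (τ x)).isIndec.bijective_of_stablyIso x.isIndec (τ (τ x)).2.2 (linMap f) (linMap g) h3))⟩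
  obtain ⟨r, hr, e, he, heτ⟩ := (isSubadditive_finrank hA hτ hττ).exists_tube (x₀ := x)
    (exists_lt_finrank hA hτ hττ x hx)
  have h3 : IsStableTube k r (stableComponent k x) := ⟨e, he, fun p => by
    have h4 := hτ (e p).1
    rw [← heτ] at h4
    exact h4⟩
  rcases hr with rfl | rfl
  · exact Or.inl h3
  · exact Or.inr h3

end StableQuiver

theorem IsSymmetricFDAlgebra.mulOpposite {k : Type w} [Field k] {A : Type v} [Ring A] [Algebra k A]
    (hA : IsSymmetricFDAlgebra k A) : IsSymmetricFDAlgebra k Aᵐᵒᵖ := by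
  obtain ⟨h, t, ht, hn⟩ := hA
  refine ⟨Module.Finite.equiv (MulOpposite.opLinearEquiv k : A ≃ₗ[k] Aᵐᵒᵖ),
    t ∘ₗ (MulOpposite.opLinearEquiv k : A ≃ₗ[k] Aᵐᵒᵖ).symm.toLinearMap, fun a b => ?_,
    fun a ha => MulOpposite.unop_injective (hn a.unop fun b => ?_)⟩
  · exact ht b.unop a.unop
  · rw [ht]
    exact ha (MulOpposite.op b)

section Schanuel

variable {A : Type v} [Ring A]

theorem stablyIso_iff {M N : FGModuleCat.{v} A} : StablyIso M N ↔
    ∃ (f : M →ₗ[A] N) (g : N →ₗ[A] M), FactorsProj (g ∘ₗ f - LinearMap.id) ∧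
      FactorsProj (f ∘ₗ g - LinearMap.id) := by
  constructor
  · rintro ⟨f, g, h₁, h₂⟩
    exact ⟨linMap f, linMap g, factorsProj_of_factorsThroughProjective h₁,
      factorsProj_of_factorsThroughProjective h₂⟩
  · rintro ⟨f, g, h₁, h₂⟩
    exact ⟨fgHom f, fgHom g, factorsThroughProjective_of_factorsProj h₁,
      factorsThroughProjective_of_factorsProj h₂⟩

/-- A map of modules induces a map between their syzygies. -/
theorem exists_syzygy_map {M M' N N' P P' : Type*} [AddCommGroup M] [Module A M] [AddCommGroup M']
    [Module A M'] [AddCommGroup N] [Module A N] [AddCommGroup N'] [Module A N'] [AddCommGroup P]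
    [Module A P] [Module.Projective A P] [AddCommGroup P'] [Module A P']
    {i : N →ₗ[A] P} {p : P →ₗ[A] M} (hip : Function.Exact i p)
    {i' : N' →ₗ[A] P'} {p' : P' →ₗ[A] M'} (hi' : Function.Injective i')
    (hip' : Function.Exact i' p') (hp' : Function.Surjective p') (f : M →ₗ[A] M') :
    ∃ (f₀ : P →ₗ[A] P') (f₁ : N →ₗ[A] N'), p' ∘ₗ f₀ = f ∘ₗ p ∧ i' ∘ₗ f₁ = f₀ ∘ₗ i := by
  obtain ⟨f₀, hf₀⟩ := Module.projective_lifting_property p' (f ∘ₗ p) hp'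
  obtain ⟨f₁, hf₁⟩ := exists_comp_eq_of_injective i' hi' (f₀ ∘ₗ i) fun x =>
    (hip' _).1 (by
      have := LinearMap.congr_fun hf₀ (i x)
      simp only [LinearMap.comp_apply, hip.apply_apply_eq_zero, map_zero] at this
      exact this)
  exact ⟨f₀, f₁, hf₀, hf₁⟩

/-- The map induced on syzygies by a stably trivial endomorphism is stably trivial. -/
theorem factorsProj_syzygy_map {M N P : Type*} [AddCommGroup M] [Module A M] [AddCommGroup N]
    [Module A N] [AddCommGroup P] [Module A P] [Module.Finite A P] [Module.Projective A P]
    {i : N →ₗ[A] P} {p : P →ₗ[A] M} (hi : Function.Injective i) (hip : Function.Exact i p)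
    (hp : Function.Surjective p) {f : M →ₗ[A] M} {f₀ : P →ₗ[A] P} {f₁ : N →ₗ[A] N}
    (h₀ : p ∘ₗ f₀ = f ∘ₗ p) (h₁ : i ∘ₗ f₁ = f₀ ∘ₗ i) (hf : FactorsProj f) : FactorsProj f₁ := by
  obtain ⟨g, hg⟩ := hf.exists_lift p hp
  obtain ⟨c, hc⟩ := exists_comp_eq_of_injective i hi (f₀ - g ∘ₗ p) fun x =>
    (hip _).1 (by
      have h2 := LinearMap.congr_fun h₀ x
      have h3 := LinearMap.congr_fun hg (p x)
      simp only [LinearMap.comp_apply] at h2 h3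
      simp [h2, h3])
  have : f₁ = c ∘ₗ i := by
    ext x
    apply hi
    have h2 := LinearMap.congr_fun h₁ x
    have h3 := LinearMap.congr_fun hc (i x)
    simp only [LinearMap.comp_apply, LinearMap.sub_apply, hip.apply_apply_eq_zero, map_zero,
      sub_zero] at h2 h3
    rw [h2, LinearMap.comp_apply, h3]
  rw [this]
  exact FactorsProj.of_comp i c

theorem StablyIso.syzygy {M M' N N' : FGModuleCat.{v} A} (h : StablyIso M M') (hN : IsSyzygy M N)
    (hN' : IsSyzygy M' N') : StablyIso N N' := by
  obtain ⟨f, g, hgf, hfg⟩ := stablyIso_iff.1 h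
  obtain ⟨P, i, p, hP, hi, hip, hp⟩ := hN
  obtain ⟨P', i', p', hP', hi', hip', hp'⟩ := hN'
  obtain ⟨f₀, f₁, hf₀, hf₁⟩ := exists_syzygy_map hip hi' hip' hp' f
  obtain ⟨g₀, g₁, hg₀, hg₁⟩ := exists_syzygy_map hip' hi hip hp g
  refine stablyIso_iff.2 ⟨f₁, g₁, ?_, ?_⟩
  · refine factorsProj_syzygy_map hi hip hp (f₀ := g₀ ∘ₗ f₀ - LinearMap.id) ?_ ?_ hgf
    · rw [LinearMap.comp_sub, ← LinearMap.comp_assoc, hg₀, LinearMap.comp_assoc, hf₀,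
        ← LinearMap.comp_assoc]
      rfl
    · rw [LinearMap.comp_sub, ← LinearMap.comp_assoc, hg₁, LinearMap.comp_assoc, hf₁,
        ← LinearMap.comp_assoc]
      rfl
  · refine factorsProj_syzygy_map hi' hip' hp' (f₀ := f₀ ∘ₗ g₀ - LinearMap.id) ?_ ?_ hfg
    · rw [LinearMap.comp_sub, ← LinearMap.comp_assoc, hf₀, LinearMap.comp_assoc, hg₀,
        ← LinearMap.comp_assoc]
      rfl
    · rw [LinearMap.comp_sub, ← LinearMap.comp_assoc, hf₁, LinearMap.comp_assoc, hg₁,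
        ← LinearMap.comp_assoc]
      rfl

end Schanuel

section AddHom

variable {C : Type u} [Category.{v} C] [Preadditive C]

/-- The map of `End T`-modules `Hom(T, X) → Hom(T, Y)` given by composition. -/
def postcomp (T : C) {X Y : C} (f : X ⟶ Y) : (T ⟶ X) →ₗ[(End T)ᵐᵒᵖ] (T ⟶ Y) where
  toFun g := g ≫ f
  map_add' _ _ := Preadditive.add_comp _ _ _ _ _ _
  map_smul' _ _ := Category.assoc _ _ _

@[simp] theorem postcomp_apply {T X Y : C} (f : X ⟶ Y) (g : T ⟶ X) : postcomp T f g = g ≫ f := rfl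

theorem postcomp_comp (T : C) {X Y Z : C} (f : X ⟶ Y) (g : Y ⟶ Z) :
    postcomp T (f ≫ g) = postcomp T g ∘ₗ postcomp T f :=
  LinearMap.ext fun _ => (Category.assoc _ _ _).symm

/-- The map of `End T`-modules on `Hom(T, X)` with given coefficients and values. -/
def coeffMap {T X : C} {n : ℕ} (a : Fin n → (X ⟶ T)) {M : Type*} [AddCommGroup M]
    [Module (End T)ᵐᵒᵖ M] (x : Fin n → M) : (T ⟶ X) →ₗ[(End T)ᵐᵒᵖ] M where
  toFun g := ∑ i, MulOpposite.op (α := End T) (g ≫ a i) • x i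
  map_add' g g' := by
    rw [← Finset.sum_add_distrib]
    refine Finset.sum_congr rfl fun i _ => ?_
    rw [← add_smul, ← MulOpposite.op_add, Preadditive.add_comp]
  map_smul' c g := by
    rw [RingHom.id_apply, Finset.smul_sum]
    refine Finset.sum_congr rfl fun i _ => ?_
    rw [smul_smul]
    congr 1
    exact congrArg MulOpposite.op (Category.assoc c.unop g (a i))

theorem coeffMap_apply {T X : C} {n : ℕ} (a : Fin n → (X ⟶ T)) {M : Type*} [AddCommGroup M]
    [Module (End T)ᵐᵒᵖ M] (x : Fin n → M) (g : T ⟶ X) :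
    coeffMap a x g = ∑ i, MulOpposite.op (α := End T) (g ≫ a i) • x i := rfl

theorem comp_coeffMap {T X : C} {n : ℕ} (a : Fin n → (X ⟶ T)) {M N : Type*} [AddCommGroup M]
    [Module (End T)ᵐᵒᵖ M] [AddCommGroup N] [Module (End T)ᵐᵒᵖ N] (x : Fin n → M)
    (h : M →ₗ[(End T)ᵐᵒᵖ] N) : h ∘ₗ coeffMap a x = coeffMap a fun i => h (x i) := by
  ext g
  simp [coeffMap_apply]

theorem coeffMap_eq_id {T X : C} {n : ℕ} (a : Fin n → (X ⟶ T)) (b : Fin n → (T ⟶ X))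
    (hab : ∑ i, a i ≫ b i = 𝟙 X) : coeffMap a b = LinearMap.id := by
  ext g
  have : ∑ i, (g ≫ a i) ≫ b i = g := by
    simp only [Category.assoc]
    rw [← Preadditive.comp_sum, hab, Category.comp_id]
  exact this

variable [HasFiniteBiproducts C]

theorem inAdd_iff {T X : C} : InAdd T X ↔ ∃ (n : ℕ) (a : Fin n → (X ⟶ T)) (b : Fin n → (T ⟶ X)),
    ∑ i, a i ≫ b i = 𝟙 X := by
  constructor
  · rintro ⟨n, ⟨r⟩⟩
    refine ⟨n, fun i => r.i ≫ biproduct.π _ i,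
      fun i => biproduct.ι (fun _ : Fin n => T) i ≫ r.r, ?_⟩
    have h := r.retract
    rw [← Category.id_comp r.r, ← biproduct.total, Preadditive.sum_comp, Preadditive.comp_sum] at h
    simpa using h
  · rintro ⟨n, a, b, h⟩
    exact ⟨n, ⟨⟨biproduct.lift a, biproduct.desc b, by rw [biproduct.lift_desc, h]⟩⟩⟩

namespace InAdd

theorem biproduct (T : C) (n : ℕ) : InAdd T (⨁ fun _ : Fin n => T) := ⟨n, ⟨Retract.refl _⟩⟩

theorem self (T : C) : InAdd T T := inAdd_iff.2 ⟨1, fun _ => 𝟙 T, fun _ => 𝟙 T, by simp⟩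

theorem trans {T T' X : C} (h : InAdd T T') (h' : InAdd T' X) : InAdd T X := by
  obtain ⟨n, a, b, hab⟩ := inAdd_iff.1 h
  obtain ⟨m, c, d, hcd⟩ := inAdd_iff.1 h'
  refine inAdd_iff.2 ⟨m * n, fun i => c (finProdFinEquiv.symm i).1 ≫ a (finProdFinEquiv.symm i).2,
    fun i => b (finProdFinEquiv.symm i).2 ≫ d (finProdFinEquiv.symm i).1, ?_⟩
  rw [Equiv.sum_comp finProdFinEquiv.symm fun q : Fin m × Fin n =>
    (c q.1 ≫ a q.2) ≫ b q.2 ≫ d q.1, Fintype.sum_prod_type, ← hcd]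
  refine Finset.sum_congr rfl fun i _ => ?_
  have h1 : ∀ j, (c i ≫ a j) ≫ b j ≫ d i = c i ≫ (a j ≫ b j) ≫ d i := fun j => by
    simp only [Category.assoc]
  simp only [h1]
  rw [← Preadditive.comp_sum, ← Preadditive.sum_comp, hab, Category.id_comp]

theorem map {D : Type*} [Category D] [Preadditive D] [HasFiniteBiproducts D] {T X : C}
    (h : InAdd T X) (F : C ⥤ D) [F.Additive] : InAdd (F.obj T) (F.obj X) := by
  obtain ⟨n, a, b, hab⟩ := inAdd_iff.1 h
  refine inAdd_iff.2 ⟨n, fun i => F.map (a i), fun i => F.map (b i), ?_⟩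
  rw [← F.map_id, ← hab, F.map_sum]
  simp

variable {T X : C} (h : InAdd T X)
include h

theorem eq_zero_of_comp {Y : C} (f : X ⟶ Y) (hf : ∀ g : T ⟶ X, g ≫ f = 0) : f = 0 := by
  obtain ⟨n, a, b, hab⟩ := inAdd_iff.1 h
  rw [← Category.id_comp f, ← hab, Preadditive.sum_comp]
  exact Finset.sum_eq_zero fun i _ => by rw [Category.assoc, hf, comp_zero]

theorem eq_zero_of_comp_right {Y : C} (f : Y ⟶ X) (hf : ∀ g : X ⟶ T, f ≫ g = 0) : f = 0 := by
  obtain ⟨n, a, b, hab⟩ := inAdd_iff.1 h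
  rw [← Category.comp_id f, ← hab, Preadditive.comp_sum]
  exact Finset.sum_eq_zero fun i _ => by rw [← Category.assoc, hf, zero_comp]

theorem exists_postcomp_eq {Y : C} (φ : (T ⟶ X) →ₗ[(End T)ᵐᵒᵖ] (T ⟶ Y)) :
    ∃ f : X ⟶ Y, postcomp T f = φ := by
  obtain ⟨n, a, b, hab⟩ := inAdd_iff.1 h
  refine ⟨∑ i, a i ≫ φ (b i), ?_⟩
  have h1 : φ = coeffMap a fun i => φ (b i) := by
    rw [← comp_coeffMap, coeffMap_eq_id a b hab, LinearMap.comp_id]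
  ext g
  refine Eq.trans ?_ (LinearMap.congr_fun h1 g).symm
  rw [postcomp_apply, Preadditive.comp_sum, coeffMap_apply]
  exact Finset.sum_congr rfl fun i _ => (Category.assoc _ _ _).symm

theorem projective : Module.Projective (End T)ᵐᵒᵖ (T ⟶ X) := by
  obtain ⟨n, a, b, hab⟩ := inAdd_iff.1 h
  refine Module.Projective.of_split (coeffMap a fun i => Pi.single i 1)
    (Fintype.linearCombination (End T)ᵐᵒᵖ b) ?_
  rw [comp_coeffMap, ← coeffMap_eq_id a b hab]
  congr 1
  funext i
  simp [Fintype.linearCombination_apply_single]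

theorem finite : Module.Finite (End T)ᵐᵒᵖ (T ⟶ X) := by
  obtain ⟨n, a, b, hab⟩ := inAdd_iff.1 h
  refine Module.Finite.of_surjective (Fintype.linearCombination (End T)ᵐᵒᵖ b) fun g =>
    ⟨fun i => MulOpposite.op (α := End T) (g ≫ a i), ?_⟩
  exact LinearMap.congr_fun (coeffMap_eq_id a b hab) g

end InAdd

end AddHom

section LinearHom

variable {k : Type w} [Field k] {C : Type u} [Category.{v} C] [Preadditive C] [Linear k C]

instance (T X : C) : IsScalarTower k (End T)ᵐᵒᵖ (T ⟶ X) where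
  smul_assoc c a f := Linear.smul_comp T T X c a.unop f

theorem IsHomFinite.module_finite (hfin : IsHomFinite k C) (T X : C) :
    Module.Finite (End T)ᵐᵒᵖ (T ⟶ X) :=
  have := hfin T X
  Module.Finite.of_restrictScalars_finite k (End T)ᵐᵒᵖ (T ⟶ X)

/-- A right approximation by a sum of copies of `T`. -/
theorem IsHomFinite.exists_approximation [HasFiniteBiproducts C] (hfin : IsHomFinite k C)
    (T X : C) :
    ∃ (n : ℕ) (p : (⨁ fun _ : Fin n => T) ⟶ X), ∀ g : T ⟶ X, ∃ g', g = g' ≫ p := by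
  have := hfin T X
  let b := Module.finBasis k (T ⟶ X)
  refine ⟨_, biproduct.desc b, fun g => ⟨biproduct.lift fun i => b.repr g i • 𝟙 T, ?_⟩⟩
  rw [biproduct.lift_desc]
  simp [b.sum_repr g]

variable [HasShift C ℤ] (hfin : IsHomFinite k C)
  {e : ∀ X Y : C, (X ⟶ Y) ≃ₗ[k] Module.Dual k (Y ⟶ X⟦(2 : ℤ)⟧)}
  (he : ∀ (X X' Y Y' : C) (a : X' ⟶ X) (f : X ⟶ Y) (b : Y ⟶ Y') (g : Y' ⟶ X'⟦(2 : ℤ)⟧),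
    e X' Y' (a ≫ f ≫ b) g = e X Y f (b ≫ g ≫ a⟦(2 : ℤ)⟧'))

include he in
theorem serre_comp_right {X Y Y' : C} (f : X ⟶ Y) (b : Y ⟶ Y') (g : Y' ⟶ X⟦(2 : ℤ)⟧) :
    e X Y' (f ≫ b) g = e X Y f (b ≫ g) := by
  have := he X X Y Y' (𝟙 X) f b g
  simpa using this

include he in
theorem serre_comp_left {X X' Y : C} (a : X' ⟶ X) (f : X ⟶ Y) (g : Y ⟶ X'⟦(2 : ℤ)⟧) :
    e X' Y (a ≫ f) g = e X Y f (g ≫ a⟦(2 : ℤ)⟧') := by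
  have := he X X' Y Y a f (𝟙 Y) g
  simpa using this

theorem serre_eq_zero {X Y : C} (m : Y ⟶ X⟦(2 : ℤ)⟧) (hm : ∀ f, e X Y f m = 0) : m = 0 := by
  refine (Module.forall_dual_apply_eq_zero_iff k m).1 fun ξ => ?_
  obtain ⟨f, rfl⟩ := (e X Y).surjective ξ
  exact hm f

include hfin in
variable (e) in
theorem exists_serre_eq {X Y : C} (ω : (X ⟶ Y) →ₗ[k] k) :
    ∃ m : Y ⟶ X⟦(2 : ℤ)⟧, ∀ f, e X Y f m = ω f := by
  have := hfin Y (X⟦(2 : ℤ)⟧)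
  refine ⟨(Module.evalEquiv k (Y ⟶ X⟦(2 : ℤ)⟧)).symm (ω ∘ₗ (e X Y).symm.toLinearMap),
    fun f => by simp⟩

end LinearHom

section ClusterTilting

open Pretriangulated

variable {k : Type w} [Field k] {C : Type u} [Category.{v} C] [Preadditive C] [HasZeroObject C]
  [HasShift C ℤ] [∀ n : ℤ, (shiftFunctor C n).Additive] [Pretriangulated C] [Linear k C]
  {T : C}

namespace IsClusterTilting

variable (hT : IsClusterTilting T)
include hT

variable (hfin : IsHomFinite k C)
include hfin

theorem exists_triangle (X : C) : ∃ (T₁ T₀ : C) (a : T₁ ⟶ T₀) (p : T₀ ⟶ X) (w : X ⟶ T₁⟦(1 : ℤ)⟧),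
    Triangle.mk a p w ∈ distTriang C ∧ InAdd T T₁ ∧ InAdd T T₀ ∧ ∀ g : T ⟶ X, ∃ g', g = g' ≫ p := by
  obtain ⟨n, p, hp⟩ := hfin.exists_approximation T X
  obtain ⟨T₁, a, w, htri⟩ := distinguished_cocone_triangle₁ p
  refine ⟨T₁, _, a, p, w, htri, (hT T₁).2 fun f => ?_, .biproduct T n, hp⟩
  obtain ⟨g, rfl⟩ := Triangle.coyoneda_exact₁ _ htri f
    ((hT _).1 (.biproduct T n) _)
  obtain ⟨g', rfl⟩ := hp g
  have : p ≫ w = 0 := comp_distTriang_mor_zero₂₃ _ htri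
  change (g' ≫ p) ≫ w = 0
  rw [Category.assoc, this, comp_zero]

theorem exists_triangle_shift (X : C) : ∃ (T₁ T₀ : C) (f : X ⟶ T₁) (a : T₁ ⟶ T₀)
    (p : T₀ ⟶ X⟦(1 : ℤ)⟧), Triangle.mk f a p ∈ distTriang C ∧ InAdd T T₁ ∧ InAdd T T₀ ∧
      ∀ g : T ⟶ X⟦(1 : ℤ)⟧, ∃ g', g = g' ≫ p := by
  obtain ⟨n, p, hp⟩ := hfin.exists_approximation T (X⟦(1 : ℤ)⟧)
  obtain ⟨T₁, f, a, htri⟩ := distinguished_cocone_triangle₂ p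
  refine ⟨T₁, _, f, a, p, htri, (hT T₁).2 fun h => ?_, .biproduct T n, hp⟩
  have htri' := rot_of_distTriang _ (rot_of_distTriang _ htri)
  obtain ⟨g, hg⟩ := Triangle.coyoneda_exact₃ _ htri' h ((hT _).1 (.biproduct T n) _)
  obtain ⟨g', rfl⟩ := hp g
  have h0 : p ≫ (-f⟦(1 : ℤ)⟧') = 0 := comp_distTriang_mor_zero₁₂ _ htri'
  rw [hg]
  change (g' ≫ p) ≫ (-f⟦(1 : ℤ)⟧') = 0
  rw [Category.assoc, h0, comp_zero]

/-- The functor `Hom(T, -)` is full. -/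
theorem exists_postcomp_eq {X Y : C} (φ : (T ⟶ X) →ₗ[(End T)ᵐᵒᵖ] (T ⟶ Y)) :
    ∃ f : X ⟶ Y, postcomp T f = φ := by
  obtain ⟨T₁, T₀, a, p, w, htri, h₁, h₀, hp⟩ := hT.exists_triangle hfin X
  obtain ⟨u, hu⟩ := h₀.exists_postcomp_eq (φ ∘ₗ postcomp T p)
  have hap : a ≫ p = 0 := comp_distTriang_mor_zero₁₂ _ htri
  obtain ⟨f, hf⟩ := Triangle.yoneda_exact₂ _ htri u (h₁.eq_zero_of_comp _ fun g => by
    have h2 := LinearMap.congr_fun hu (g ≫ a)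
    simp only [postcomp_apply, LinearMap.comp_apply, Category.assoc, hap, comp_zero,
      map_zero] at h2
    exact h2)
  refine ⟨f, LinearMap.ext fun g => ?_⟩
  obtain ⟨g, rfl⟩ := hp g
  have h2 := LinearMap.congr_fun hu g
  have hf' : u = p ≫ f := hf
  rw [hf'] at h2
  exact (Category.assoc _ _ _).trans h2

/-- The functor `Hom(T, -)` is dense. -/
theorem exists_linearEquiv (M : Type v) [AddCommGroup M] [Module (End T)ᵐᵒᵖ M]
    [Module.Finite (End T)ᵐᵒᵖ M] : ∃ X : C, Nonempty (M ≃ₗ[(End T)ᵐᵒᵖ] (T ⟶ X)) := by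
  have hcover : ∀ (M : Type v) [AddCommGroup M] [Module (End T)ᵐᵒᵖ M]
      [Module.Finite (End T)ᵐᵒᵖ M], ∃ (n : ℕ)
      (φ : (T ⟶ ⨁ fun _ : Fin n => T) →ₗ[(End T)ᵐᵒᵖ] M), Function.Surjective φ := by
    intro M _ _ _
    obtain ⟨n, s, hs⟩ := Module.Finite.exists_fin (R := (End T)ᵐᵒᵖ) (M := M)
    refine ⟨n, coeffMap (fun i => biproduct.π (fun _ => T) i) s, ?_⟩
    rw [← LinearMap.range_eq_top, eq_top_iff, ← hs, Submodule.span_le]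
    rintro _ ⟨i, rfl⟩
    refine ⟨biproduct.ι (fun _ => T) i, ?_⟩
    rw [coeffMap_apply, Finset.sum_eq_single i]
    · rw [biproduct.ι_π_self]
      exact one_smul _ _
    · intro j _ hj
      rw [biproduct.ι_π_ne _ hj.symm]
      exact zero_smul _ _
    · simp
  have hA : FiniteDimensional k (End T)ᵐᵒᵖ := by
    have : FiniteDimensional k (End T) := hfin T T
    exact Module.Finite.equiv (MulOpposite.opLinearEquiv k : End T ≃ₗ[k] (End T)ᵐᵒᵖ)
  have : IsNoetherianRing (End T)ᵐᵒᵖ := by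
    have := IsArtinianRing.of_finite k (End T)ᵐᵒᵖ
    infer_instance
  have hF := fun X => hfin.module_finite T X
  obtain ⟨n, π, hπ⟩ := hcover M
  obtain ⟨m, ρ, hρ⟩ := hcover (LinearMap.ker π)
  obtain ⟨a, ha⟩ := (InAdd.biproduct T m).exists_postcomp_eq ((LinearMap.ker π).subtype ∘ₗ ρ)
  obtain ⟨X, p, w, htri⟩ := distinguished_cocone_triangle a
  have hap : a ≫ p = 0 := comp_distTriang_mor_zero₁₂ _ htri
  have hp : Function.Surjective (postcomp T p) := fun g => by
    obtain ⟨g', hg'⟩ := Triangle.coyoneda_exact₃ _ htri g ((hT _).1 (.biproduct T m) _)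
    exact ⟨g', hg'.symm⟩
  have hker : LinearMap.ker π = LinearMap.ker (postcomp T p) := by
    ext g
    constructor
    · intro hg
      obtain ⟨g', hg'⟩ := hρ ⟨g, hg⟩
      have h1 := LinearMap.congr_fun ha g'
      rw [LinearMap.comp_apply, hg'] at h1
      rw [LinearMap.mem_ker]
      change g' ≫ a = g at h1
      rw [← h1, postcomp_apply, Category.assoc, hap, comp_zero]
    · intro hg
      obtain ⟨g', rfl⟩ := Triangle.coyoneda_exact₂ _ htri g hg
      have h1 := LinearMap.congr_fun ha g'
      change g' ≫ a = _ at h1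
      change g' ≫ a ∈ _
      rw [h1]
      exact (ρ g').2
  exact ⟨X, ⟨(π.quotKerEquivOfSurjective hπ).symm.trans
    ((Submodule.quotEquivOfEq _ _ hker).trans ((postcomp T p).quotKerEquivOfSurjective hp))⟩⟩

end IsClusterTilting

section CalabiYau

variable (hfin : IsHomFinite k C)
  {e : ∀ X Y : C, (X ⟶ Y) ≃ₗ[k] Module.Dual k (Y ⟶ X⟦(2 : ℤ)⟧)}
  (he : ∀ (X X' Y Y' : C) (a : X' ⟶ X) (f : X ⟶ Y) (b : Y ⟶ Y') (g : Y' ⟶ X'⟦(2 : ℤ)⟧),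
    e X' Y' (a ≫ f ≫ b) g = e X Y f (b ≫ g ≫ a⟦(2 : ℤ)⟧'))

variable (hT : IsClusterTilting T)

include hfin he hT in
/-- If `End T` is symmetric, then `T` is a direct summand of `Σ² T`. -/
theorem exists_retraction_shift_two (hsymm : IsSymmetricFDAlgebra k (End T)) :
    ∃ (ψ : T ⟶ T⟦(2 : ℤ)⟧) (s : T⟦(2 : ℤ)⟧ ⟶ T), ψ ≫ s = 𝟙 T := by
  obtain ⟨_, t, ht, hn⟩ := hsymm
  obtain ⟨ψ, hψ⟩ := exists_serre_eq hfin e (X := T) (Y := T) t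
  have := hfin T T
  have := hfin T (T⟦(2 : ℤ)⟧)
  have hinj : Function.Injective (postcomp T ψ) := by
    rw [injective_iff_map_eq_zero]
    intro a ha
    refine hn a fun f => ?_
    change t (f ≫ a) = 0
    rw [← hψ, serre_comp_right he]
    change a ≫ ψ = 0 at ha
    rw [ha, map_zero]
  have hbij : Function.Bijective (postcomp T ψ) := by
    refine ⟨hinj, ?_⟩
    have h1 : Module.finrank k (T ⟶ T) = Module.finrank k (T ⟶ T⟦(2 : ℤ)⟧) := by
      rw [(e T T).finrank_eq, Subspace.dual_finrank_eq]
    exact (LinearMap.injective_iff_surjective_of_finrank_eq_finrank h1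
      (f := (postcomp T ψ).restrictScalars k)).1 hinj
  let u := LinearEquiv.ofBijective _ hbij
  obtain ⟨s, hs⟩ := hT.exists_postcomp_eq hfin u.symm.toLinearMap
  refine ⟨ψ, s, ?_⟩
  have h1 := LinearMap.congr_fun hs ψ
  have h2 : u (𝟙 T) = ψ := Category.id_comp ψ
  rw [postcomp_apply, LinearEquiv.coe_coe, ← h2, LinearEquiv.symm_apply_apply, h2] at h1
  exact h1

include hfin he hT in
theorem eq_zero_of_shift_one (hsymm : IsSymmetricFDAlgebra k (End T)) (f : T⟦(1 : ℤ)⟧ ⟶ T) :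
    f = 0 := by
  obtain ⟨ψ, s, hs⟩ := exists_retraction_shift_two hfin he hT hsymm
  let σ := (shiftFunctorAdd' C (1 : ℤ) 1 2 (by norm_num)).app T
  obtain ⟨g, hg⟩ := (shiftFunctor C (1 : ℤ)).map_surjective (f ≫ ψ ≫ σ.hom)
  rw [(hT T).1 (.self T) g, Functor.map_zero] at hg
  have h1 : f ≫ ψ = (f ≫ ψ ≫ σ.hom) ≫ σ.inv := by simp
  rw [← Category.comp_id f, ← hs, ← Category.assoc, h1, ← hg, zero_comp, zero_comp]

include hfin he hT in
theorem inAdd_shift_two (hsymm : IsSymmetricFDAlgebra k (End T)) : InAdd T (T⟦(2 : ℤ)⟧) := by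
  refine (hT _).2 fun f => ?_
  let σ := shiftComm T (2 : ℤ) 1
  have h1 : f ≫ σ.hom = 0 := serre_eq_zero (e := e) _ fun g => by
    rw [eq_zero_of_shift_one hfin he hT hsymm g, map_zero, LinearMap.zero_apply]
  rw [← Category.comp_id f, ← σ.hom_inv_id, ← Category.assoc, h1, zero_comp]

end CalabiYau

end ClusterTilting

section SyzygyDuality

open Pretriangulated

variable {k : Type w} [Field k] {C : Type u} [Category.{v} C] [Preadditive C] [HasZeroObject C]
  [HasShift C ℤ] [∀ n : ℤ, (shiftFunctor C n).Additive] [Pretriangulated C] [Linear k C]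
  {T : C} (hfin : IsHomFinite k C) (hT : IsClusterTilting T) (h0 : ∀ f : T⟦(1 : ℤ)⟧ ⟶ T, f = 0)

include hfin hT h0

omit hfin hT in
theorem eq_zero_of_inAdd_shift {X Y : C} (hX : InAdd T X) (hY : InAdd T Y)
    (f : X⟦(1 : ℤ)⟧ ⟶ Y) : f = 0 :=
  hY.eq_zero_of_comp_right f fun _ =>
    (hX.map (shiftFunctor C (1 : ℤ))).eq_zero_of_comp _ fun _ => h0 _

/-- A morphism to an object of `add T` is determined by its image under `Hom(T, -)`. -/
theorem eq_zero_of_postcomp_eq_zero {X Y : C} (hY : InAdd T Y) (f : X ⟶ Y)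
    (hf : postcomp T f = 0) : f = 0 := by
  obtain ⟨T₁, T₀, a, p, w, htri, h₁, h₀, -⟩ := hT.exists_triangle hfin X
  obtain ⟨g, hg⟩ := Triangle.yoneda_exact₃ _ htri f (h₀.eq_zero_of_comp _ fun g =>
    (Category.assoc g p f).symm.trans (LinearMap.congr_fun hf (g ≫ p)))
  have hg' : f = w ≫ g := hg
  rw [hg', eq_zero_of_inAdd_shift h0 h₁ hY g, comp_zero]

/-- For a triangle `X → T₁ → T₀ → Σ X` with `T₀ → Σ X` a right approximation, the module
`Hom(T, X)` is the second syzygy of `Hom(T, Σ X)`. -/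
theorem exists_syzygies (X : C) : ∃ (T₁ T₀ : C) (f : X ⟶ T₁) (a : T₁ ⟶ T₀) (p : T₀ ⟶ X⟦(1 : ℤ)⟧)
    (q : (T ⟶ T₁) →ₗ[(End T)ᵐᵒᵖ] LinearMap.ker (postcomp T p)),
    Triangle.mk f a p ∈ distTriang C ∧ InAdd T T₁ ∧ InAdd T T₀ ∧
    Function.Surjective (postcomp T p) ∧ Function.Injective (postcomp T f) ∧
    Function.Exact (postcomp T f) q ∧ Function.Surjective q ∧
    (LinearMap.ker (postcomp T p)).subtype ∘ₗ q = postcomp T a := by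
  obtain ⟨T₁, T₀, f, a, p, htri, h₁, h₀, hp⟩ := hT.exists_triangle_shift hfin X
  have hap : a ≫ p = 0 := comp_distTriang_mor_zero₂₃ _ htri
  have hfa : f ≫ a = 0 := comp_distTriang_mor_zero₁₂ _ htri
  refine ⟨T₁, T₀, f, a, p, (postcomp T a).codRestrict _ fun g => ?_, htri, h₁, h₀, fun g => ?_,
    ?_, fun g => ⟨fun hg => ?_, ?_⟩, fun ⟨g, hg⟩ => ?_, rfl⟩
  · rw [LinearMap.mem_ker]
    simp [hap]
  · obtain ⟨g', hg'⟩ := hp g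
    exact ⟨g', hg'.symm⟩
  · rw [injective_iff_map_eq_zero]
    intro g hg
    have htri' := rot_of_distTriang _ (rot_of_distTriang _ htri)
    change g ≫ f = 0 at hg
    obtain ⟨u, hu⟩ := Triangle.coyoneda_exact₂ _ htri' (g⟦(1 : ℤ)⟧') (by
      change g⟦(1 : ℤ)⟧' ≫ (-f⟦(1 : ℤ)⟧') = 0
      rw [Preadditive.comp_neg, ← Functor.map_comp, hg, Functor.map_zero, neg_zero])
    have h2 : u = 0 := eq_zero_of_inAdd_shift h0 (.self T) h₀ u
    rw [h2, zero_comp] at hu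
    exact (shiftFunctor C (1 : ℤ)).map_injective (hu.trans (Functor.map_zero _ _ _).symm)
  · obtain ⟨g', hg'⟩ := Triangle.coyoneda_exact₂ _ htri g (congrArg Subtype.val hg)
    exact ⟨g', hg'.symm⟩
  · rintro ⟨g', rfl⟩
    refine Subtype.ext ?_
    change (g' ≫ f) ≫ a = 0
    rw [Category.assoc, hfa, comp_zero]
  · obtain ⟨g', hg'⟩ := Triangle.coyoneda_exact₃ _ htri g hg
    exact ⟨g', Subtype.ext hg'.symm⟩

/-- The stable dual of `Hom(X, -)`, computed in the category `C`, is represented by a syzygy of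
`Hom(T, Σ² X)`. -/
theorem exists_isStableDuality_ker
    {e : ∀ X Y : C, (X ⟶ Y) ≃ₗ[k] Module.Dual k (Y ⟶ X⟦(2 : ℤ)⟧)}
    (he : ∀ (X X' Y Y' : C) (a : X' ⟶ X) (f : X ⟶ Y) (b : Y ⟶ Y') (g : Y' ⟶ X'⟦(2 : ℤ)⟧),
      e X' Y' (a ≫ f ≫ b) g = e X Y f (b ≫ g ≫ a⟦(2 : ℤ)⟧'))
    (h2 : InAdd T (T⟦(2 : ℤ)⟧)) (X : C) {T₁ T₀ : C} {f₀ : X⟦(1 : ℤ)⟧ ⟶ T₁} {a : T₁ ⟶ T₀}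
    {p : T₀ ⟶ X⟦(1 : ℤ)⟧⟦(1 : ℤ)⟧} (htri : Triangle.mk f₀ a p ∈ distTriang C) (h₁ : InAdd T T₁)
    (h₀ : InAdd T T₀) (hp : Function.Surjective (postcomp T p))
    {q : (T ⟶ T₁) →ₗ[(End T)ᵐᵒᵖ] LinearMap.ker (postcomp T p)} (hq : Function.Surjective q)
    (hqa : (LinearMap.ker (postcomp T p)).subtype ∘ₗ q = postcomp T a) :
    ∃ φ : ((T ⟶ X) →ₗ[(End T)ᵐᵒᵖ] LinearMap.ker (postcomp T p)) →ₗ[k] k,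
      IsStableDuality φ := by
  let K := LinearMap.ker (postcomp T p)
  let σ := ((shiftFunctorAdd' C (1 : ℤ) 1 2 (by norm_num)).app X).symm
  have hσ : ∀ {Y : C} (g : Y ⟶ T₀), g ≫ p ≫ σ.hom = 0 ↔ g ≫ p = 0 := fun g => by
    rw [← Category.assoc, Preadditive.IsIso.comp_right_eq_zero]
  have hlift : ∀ {Y : C} (hY : InAdd T Y) (u : Y ⟶ X⟦(2 : ℤ)⟧),
      ∃ u' : Y ⟶ T₀, u = u' ≫ p ≫ σ.hom := by
    intro Y hY u
    have := hY.projective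
    obtain ⟨φ, hφ⟩ := Module.projective_lifting_property (postcomp T p)
      (postcomp T (u ≫ σ.inv)) hp
    obtain ⟨u', rfl⟩ := hY.exists_postcomp_eq φ
    refine ⟨u', ?_⟩
    rw [← postcomp_comp] at hφ
    have h3 : u' ≫ p = u ≫ σ.inv := sub_eq_zero.1 (hY.eq_zero_of_comp _ fun g => by
      rw [Preadditive.comp_sub, sub_eq_zero]
      exact LinearMap.congr_fun hφ g)
    rw [← Category.assoc, h3, Category.assoc, σ.inv_hom_id, Category.comp_id]
  let Φ : (X ⟶ T₀) →ₗ[k] ((T ⟶ X) →ₗ[(End T)ᵐᵒᵖ] (T ⟶ T₀)) :=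
    { toFun := fun f => postcomp T f
      map_add' := fun f g => LinearMap.ext fun u => Preadditive.comp_add _ _ _ u f g
      map_smul' := fun c f => LinearMap.ext fun u => Linear.comp_smul _ _ _ u c f }
  have hΦ : Function.Bijective Φ := by
    refine ⟨(injective_iff_map_eq_zero Φ).2 fun f hf =>
      eq_zero_of_postcomp_eq_zero hfin hT h0 h₀ f hf, fun φ => ?_⟩
    obtain ⟨f, hf⟩ := hT.exists_postcomp_eq hfin φ
    exact ⟨f, hf⟩
  let Ψ := (LinearEquiv.ofBijective Φ hΦ).symm
  let φ : ((T ⟶ X) →ₗ[(End T)ᵐᵒᵖ] K) →ₗ[k] k :=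
    e X X (𝟙 X) ∘ₗ Linear.rightComp k X (p ≫ σ.hom) ∘ₗ Ψ.toLinearMap ∘ₗ
      (homComp k (T ⟶ X) K (T ⟶ T₀)).flip K.subtype
  have hφ : ∀ (h : (T ⟶ X) →ₗ[(End T)ᵐᵒᵖ] K) (f : X ⟶ T₀), postcomp T f = K.subtype ∘ₗ h →
      φ h = e X X (𝟙 X) (f ≫ p ≫ σ.hom) := by
    intro h f hf
    have h3 : Ψ (K.subtype ∘ₗ h) = f := by
      rw [← hf]
      exact (LinearEquiv.ofBijective Φ hΦ).symm_apply_apply f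
    change e X X (𝟙 X) (Ψ (K.subtype ∘ₗ h) ≫ p ≫ σ.hom) = _
    rw [h3]
  have hφ' : ∀ {Y : C} (f : X ⟶ Y) (g : (T ⟶ Y) →ₗ[(End T)ᵐᵒᵖ] K) (g' : Y ⟶ T₀),
      postcomp T g' = K.subtype ∘ₗ g →
      φ (g ∘ₗ postcomp T f) = e X Y f (g' ≫ p ≫ σ.hom) := by
    intro Y f g g' hg
    rw [hφ _ (f ≫ g') (by rw [postcomp_comp, hg, LinearMap.comp_assoc]), Category.assoc,
      ← serre_comp_right he, Category.id_comp]
  have hdense : ∀ (N : Type v) [AddCommGroup N] [Module (End T)ᵐᵒᵖ N]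
      [Module.Finite (End T)ᵐᵒᵖ N], ∃ Y : C, Nonempty (N ≃ₗ[(End T)ᵐᵒᵖ] (T ⟶ Y)) :=
    fun N _ _ _ => hT.exists_linearEquiv hfin N
  refine ⟨φ, ⟨fun h hh => ?_, fun N _ _ _ f hf => ?_, fun N _ _ _ g hg => ?_⟩⟩
  · obtain ⟨g, rfl⟩ := hh.exists_lift q hq
    obtain ⟨g', rfl⟩ := hT.exists_postcomp_eq hfin g
    have hap : a ≫ p = 0 := comp_distTriang_mor_zero₂₃ _ htri
    rw [hφ _ (g' ≫ a) (by rw [postcomp_comp, ← hqa, LinearMap.comp_assoc]),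
      (hσ (g' ≫ a)).2 (by rw [Category.assoc, hap, comp_zero]), map_zero]
  · obtain ⟨Y, ⟨u⟩⟩ := hdense N
    obtain ⟨f', hf'⟩ := hT.exists_postcomp_eq hfin (u.toLinearMap ∘ₗ f)
    let W : Submodule k (X ⟶ Y) :=
      { carrier := {f | FactorsProj (postcomp T f)}
        zero_mem' := by
          have : postcomp T (0 : X ⟶ Y) = 0 := LinearMap.ext fun _ => comp_zero
          rw [Set.mem_ofPred_eq, this]
          exact .zero
        add_mem' := fun {f g} hf hg => by
          have : postcomp T (f + g) = postcomp T f + postcomp T g :=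
            LinearMap.ext fun _ => Preadditive.comp_add _ _ _ _ _ _
          rw [Set.mem_ofPred_eq, this]
          exact hf.add hg
        smul_mem' := fun c f hf => by
          have : c • f = f ≫ (c • 𝟙 Y) := by rw [Linear.comp_smul, Category.comp_id]
          rw [Set.mem_ofPred_eq, this, postcomp_comp]
          exact FactorsProj.comp_left hf _ }
    suffices hW : f' ∈ W by
      have h3 : FactorsProj (postcomp T f') := hW
      rw [hf'] at h3
      have h4 := h3.comp_left u.symm.toLinearMap
      rwa [← LinearMap.comp_assoc, LinearEquiv.symm_comp, LinearMap.id_comp] at h4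
    by_contra hW
    obtain ⟨ω, hω, hωW⟩ := Submodule.exists_le_ker_of_notMem hW
    obtain ⟨m, hm⟩ := exists_serre_eq hfin e ω
    have hmW : ∀ g ∈ W, e X Y g m = 0 := fun g hg => (hm g).trans (hωW hg)
    have hm0 : postcomp T m = 0 := LinearMap.ext fun g => by
      refine serre_eq_zero (e := e) _ fun v => ?_
      rw [postcomp_apply, ← serre_comp_right he]
      refine hmW _ ?_
      change FactorsProj (postcomp T (v ≫ g))
      rw [postcomp_comp]
      have := (InAdd.self T).projective
      have := (InAdd.self T).finite
      exact FactorsProj.of_comp _ _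
    obtain ⟨S₁, S₀, b, c, w, htri', hS₁, hS₀, -⟩ := hT.exists_triangle hfin X
    have hmw : m ≫ w⟦(2 : ℤ)⟧' = 0 := serre_eq_zero (e := e) _ fun v => by
      rw [← serre_comp_left he]
      refine hmW _ ?_
      have h3 : postcomp T (w ≫ v) = 0 := LinearMap.ext fun g => by
        rw [postcomp_apply, ← Category.assoc, (hT S₁).1 hS₁ (g ≫ w), zero_comp,
          LinearMap.zero_apply]
      change FactorsProj (postcomp T (w ≫ v))
      rw [h3]
      exact .zero
    obtain ⟨m', hm'⟩ : ∃ m' : Y ⟶ S₀⟦(2 : ℤ)⟧, m = m' ≫ c⟦(2 : ℤ)⟧' := by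
      have h3 := Triangle.shift_distinguished _ htri' 2
      obtain ⟨m', hm'⟩ := Triangle.coyoneda_exact₃ _ h3 m (by
        change m ≫ ((2 : ℤ).negOnePow • w⟦(2 : ℤ)⟧' ≫ (shiftFunctorComm C 1 2).hom.app S₁) = 0
        rw [Linear.comp_units_smul, reassoc_of% hmw, zero_comp, smul_zero])
      refine ⟨m', ?_⟩
      have h4 : m = m' ≫ ((2 : ℤ).negOnePow • c⟦(2 : ℤ)⟧') := hm'
      rwa [Int.negOnePow_even 2 even_two, one_smul] at h4
    obtain ⟨c', hc'⟩ := hlift (h2.trans (hS₀.map (shiftFunctor C (2 : ℤ)))) (c⟦(2 : ℤ)⟧')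
    have hmp : m = (m' ≫ c') ≫ p ≫ σ.hom := by rw [hm', hc', Category.assoc]
    have hker : ∀ g : T ⟶ Y, g ≫ m' ≫ c' ∈ K := fun g => by
      change (g ≫ m' ≫ c') ≫ p = 0
      rw [← hσ, Category.assoc, ← hmp]
      exact LinearMap.congr_fun hm0 g
    apply hω
    rw [← hm, hmp, ← hφ' f' ((postcomp T (m' ≫ c')).codRestrict K hker) (m' ≫ c') rfl, hf']
    exact hf ((postcomp T (m' ≫ c')).codRestrict K hker ∘ₗ u.toLinearMap)
  · obtain ⟨Y, ⟨u⟩⟩ := hdense N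
    obtain ⟨g', hg'⟩ := hT.exists_postcomp_eq hfin (K.subtype ∘ₗ g ∘ₗ u.symm.toLinearMap)
    have h3 : g' ≫ p ≫ σ.hom = 0 := serre_eq_zero (e := e) _ fun f => by
      rw [← hφ' f _ g' hg']
      exact hg (u.symm.toLinearMap ∘ₗ postcomp T f)
    obtain ⟨g'', hg''⟩ := Triangle.coyoneda_exact₃ _ htri g' ((hσ g').1 h3)
    have hg3 : g' = g'' ≫ a := hg''
    have h4 : g = q ∘ₗ postcomp T g'' ∘ₗ u.toLinearMap := by
      ext1 x
      apply Subtype.ext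
      have h5 := LinearMap.congr_fun hg' (u x)
      have h6 := LinearMap.congr_fun hqa (u x ≫ g'')
      rw [hg3] at h5
      simp only [LinearMap.comp_apply, postcomp_apply, LinearEquiv.coe_coe,
        LinearEquiv.symm_apply_apply] at h5 h6 ⊢
      exact h5.symm.trans ((Category.assoc _ _ _).symm.trans h6.symm)
    rw [h4]
    have := h₁.projective
    have := h₁.finite
    exact FactorsProj.of_comp _ _

end SyzygyDuality

section FourthSyzygy

open Pretriangulated

open scoped ModuleCat

variable {k : Type w} [Field k] {C : Type u} [Category.{v} C] [Preadditive C] [HasZeroObject C]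
  [HasShift C ℤ] [∀ n : ℤ, (shiftFunctor C n).Additive] [Pretriangulated C] [Linear k C]
  {T : C}

/-- Over the symmetric endomorphism algebra of a cluster-tilting object in a 2-Calabi-Yau category,
the fourth syzygy is stably the identity. -/
theorem IsClusterTilting.stablyIso_syzygy_four (hT : IsClusterTilting T) (hfin : IsHomFinite k C)
    (hCY : IsTwoCalabiYau k C) (hsymm : IsSymmetricFDAlgebra k (End T))
    {M N₁ N₂ N₃ N₄ : FGModuleCat.{v} (End T)ᵐᵒᵖ} (h₁ : IsSyzygy M N₁) (h₂ : IsSyzygy N₁ N₂)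
    (h₃ : IsSyzygy N₂ N₃) (h₄ : IsSyzygy N₃ N₄) : StablyIso N₄ M := by
  obtain ⟨e, he⟩ := hCY
  have h0 := eq_zero_of_shift_one hfin he hT hsymm
  have hS := inAdd_shift_two hfin he hT hsymm
  have hart := hsymm.mulOpposite.isArtinianRing
  obtain ⟨_, t, ht, hn⟩ := hsymm.mulOpposite
  have hF := fun X => hfin.module_finite T X
  obtain ⟨X, ⟨u⟩⟩ := hT.exists_linearEquiv hfin M
  obtain ⟨T₁, T₀, f, a, p, q, htri, hT₁, hT₀, hp, hf, hfq, hq, hqa⟩ :=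
    exists_syzygies hfin hT h0 (X⟦(1 : ℤ)⟧)
  obtain ⟨T₁', T₀', f', a', p', q', -, hT₁', hT₀', hp', hf', hfq', hq', -⟩ :=
    exists_syzygies hfin hT h0 X
  let K : FGModuleCat.{v} (End T)ᵐᵒᵖ := FGModuleCat.of _ (LinearMap.ker (postcomp T p))
  let K' : FGModuleCat.{v} (End T)ᵐᵒᵖ := FGModuleCat.of _ (LinearMap.ker (postcomp T p'))
  let FX : FGModuleCat.{v} (End T)ᵐᵒᵖ := FGModuleCat.of _ (T ⟶ X⟦(1 : ℤ)⟧)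
  have hK : IsSyzygy K FX :=
    ⟨FGModuleCat.of _ (T ⟶ T₁), postcomp T f, q, hT₁.projective, hf, hfq, hq⟩
  have hK' : IsSyzygy FX K' :=
    ⟨FGModuleCat.of _ (T ⟶ T₀'), (LinearMap.ker (postcomp T p')).subtype, postcomp T p',
      hT₀'.projective, Submodule.injective_subtype _, LinearMap.exact_subtype_ker_map _, hp'⟩
  have hM : IsSyzygy K' M :=
    ⟨FGModuleCat.of _ (T ⟶ T₁'), postcomp T f' ∘ₗ u.toLinearMap, q', hT₁'.projective,
      hf'.comp u.injective, fun x => (hfq' x).trans (by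
        rw [LinearMap.coe_comp]
        exact (Set.ext_iff.1 (u.surjective.range_comp (postcomp T f')) x).symm), hq'⟩
  have hstab : StablyIso N₁ K := by
    obtain ⟨P, i, π, hP, hi, hiπ, hπ⟩ := h₁
    obtain ⟨φ, hφ⟩ := exists_isStableDuality ht hn (X := (T ⟶ X)) (K := N₁) (P := P) i
      (u.toLinearMap ∘ₗ π) hi (fun x => by
        rw [← hiπ x]
        exact u.map_eq_zero_iff) (u.surjective.comp hπ)
    obtain ⟨φ', hφ'⟩ := exists_isStableDuality_ker hfin hT h0 he hS X htri hT₁ hT₀ hp hq hqa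
    exact stablyIso_iff.2 (hφ.unique hφ')
  exact (((hstab.syzygy h₂ hK).syzygy h₃ hK').syzygy h₄ hM)

end FourthSyzygy

theorem mainTheorem3 (k : Type w) [Field k] [IsAlgClosed k]
    (C : Type u) [Category.{v} C] [Preadditive C] [HasZeroObject C] [HasShift C ℤ]
    [∀ n : ℤ, (shiftFunctor C n).Additive] [Pretriangulated C] [IsTriangulated C]
    [Linear k C] [∀ n : ℤ, (shiftFunctor C n).Linear k]
    (hfin : IsHomFinite k C) (hCY : IsTwoCalabiYau k C)
    (T : C) (hT : IsClusterTilting T) (hsymm : IsSymmetricFDAlgebra k (End T)) :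
    -- `mod Λ` is the category of finitely generated right modules over `Λ = End T`
    (∀ x : StableVertex (End T)ᵐᵒᵖ, BlockIsRepInfinite (isoClassRep x.1) →
      IsStableTube k 1 (stableComponent k x) ∨ IsStableTube k 2 (stableComponent k x)) ∧
    (∀ M N₁ N₂ : FGModuleCat.{v} (End T)ᵐᵒᵖ,
      IsARTranslate k M N₁ → IsARTranslate k N₁ N₂ → StablyIso N₂ M) ∧
    (∀ M N₁ N₂ N₃ N₄ : FGModuleCat.{v} (End T)ᵐᵒᵖ,
      IsSyzygy M N₁ → IsSyzygy N₁ N₂ → IsSyzygy N₂ N₃ → IsSyzygy N₃ N₄ → StablyIso N₄ M) := by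
  have hA := hsymm.mulOpposite
  have h4 : ∀ M N₁ N₂ N₃ N₄ : FGModuleCat.{v} (End T)ᵐᵒᵖ, IsSyzygy M N₁ → IsSyzygy N₁ N₂ →
      IsSyzygy N₂ N₃ → IsSyzygy N₃ N₄ → StablyIso N₄ M := fun _ _ _ _ _ h₁ h₂ h₃ h₄ =>
    hT.stablyIso_syzygy_four hfin hCY hsymm h₁ h₂ h₃ h₄
  have h2 : ∀ M N₁ N₂ : FGModuleCat.{v} (End T)ᵐᵒᵖ, IsARTranslate k M N₁ →
      IsARTranslate k N₁ N₂ → StablyIso N₂ M := fun M N₁ N₂ h₁ h₂ => by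
    obtain ⟨K₁, hK₁, hK₁'⟩ := hA.isSyzygy_of_isARTranslate h₁
    obtain ⟨K₂, hK₂, hK₂'⟩ := hA.isSyzygy_of_isARTranslate h₂
    exact h4 _ _ _ _ _ hK₁ hK₁' hK₂ hK₂'
  exact ⟨fun x hx => isStableTube_stableComponent hA h2 x hx, h2, h4⟩
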